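/- **Setting.** Let $d\ge 2$ and let $G=\mathbb Z^d$ be the nearest-neighbour lattice with symmetric conductances $\omega_{xy}=\omega_{yx}\ge 0$, where $\omega_{xy}>0$ if and only if $|x-y|=1$. Let $\pi(x)=\sum_y\omega_{xy}$, let $d(\cdot,\cdot)$ be the graph distance, $B(x,R)=\{y: d(x,y)<R\}$, and let $\tilde d(x,y)=\inf \sum_i \big(1\wedge\omega_{x_ix_{i+1}}^{-1/2}\big)$, the infimum being over nearest-neighbour paths $(x_i)$ from $x$ to $y$, with balls $\tilde B(x,R)=\{y:\tilde d(x,y)<R\}$. Let $X$ be either the constant speed walk (CSRW, $\theta=\pi$) or the variable speed walk (VSRW, $\theta\equiv 1$): the continuous-time Markov chain with jump probabilities $\omega_{xy}/\pi(x)$ and exponential holding times of mean $\theta(x)/\pi(x)$ at $x$. Write $p_t(x,y)=P^x(X_t=y)/\theta(y)$, $\mathcal L f(x)=\theta(x)^{-1}\sum_y (f(y)-f(x))\omega_{xy}$, $\theta(A)=\sum_{x\in A}\theta(x)$, $\pi(A)=\sum_{x\in A}\pi(x)$ and $\tau_A=\inf\{t\ge 0:X_t\notin A\}$. **Assumption.**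 For the chosen walk, the following hold, each with some $\delta,\kappa,c,C>0$ and some threshold in $[1,\infty)$ (which may depend on $\omega$ and differ from item to item): (i) $p_t(x,y)\le c\,t^{-d/2}$ for all large $t$ and all $x,y\in B(0,t^{(1+\delta)/2})$. (ii) For all large $r$: in the CSRW case $E^x[\tau_{B(x,r)}]\ge c r^2$ for all $x\in B(0,r^{1+\delta})$; in the VSRW case $E^x[\tau_{\tilde B(x,r)}]\ge c r^2$ for all $x\in\tilde B(0,r^{1+\delta})$. (iii) For all large $R$, every $h$ that is positive on $B(0,R)$ and its neighbours and satisfies $\mathcal L h=0$ on $B(0,R)$ satisfies $\sup_{B(0,R/2)}h\le C\inf_{B(0,R/2)}h$. (iv) $cR^d\le\theta(B(0,R))\le\sup_{x\in B(0,R^{1+\delta})}\theta(B(x,R))\le CR^d$ for all large $R$. (v) For all large $R$: in the CSRW case $\min_{x\in B(0,R)}\pi(x)\ge R^{-\kappa}$; in the VSRW case $\tilde d(x,y)\ge c\,d(x,y)$ whenever $x\in B(0,R^{1+\delta})$ and $d(x,y)\ge R$. **Proposition.** Suppose moreover that $\lim_{R\to\infty}R^{-d}\pi(B(0,R))$ exists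 and is positive, and that for some positive definite matrix $\Sigma$, with $k_t(x)=\big((2\pi t)^d\det\Sigma\big)^{-1/2}\exp\big(-\tfrac{x\cdot\Sigma^{-1}x}{2t}\big)$ (here $\pi$ is the number $3.14\ldots$), $$\lim_{n\to\infty}P^0\big(n^{-1/2}X_{\lfloor nt\rfloor}\in y+[-R,R]^d\big)=\int_{y+[-R,R]^d}k_t(z)\,dz\qquad\text{for all }y\in\mathbb R^d,\ R,t>0.$$ Then there is $a>0$ such that for all $T_1,T_2>0$ and all $M>0$, $$\lim_{n\to\infty}\ \sup_{|x|\le M}\ \sup_{t\in[T_1,T_2]}\big|n^d p_{n^2t}(0,\lfloor nx\rfloor)-a\,k_t(x)\big|=0,$$ where $\lfloor nx\rfloor$ is taken coordinatewise. -/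

import Mathlib

open Set Filter Topology MeasureTheory ProbabilityTheory
open scoped ENNReal NNReal Matrix

noncomputable section

/-- A weighted graph on the vertex set `V`: symmetric non-negative conductances `ω x y`, where `x`
and `y` are neighbours iff `0 < ω x y`; the degree is bounded and the graph is connected. -/
structure WeightedGraph (V : Type*) where
  ω : V → V → ℝ
  symm : ∀ x y, ω x y = ω y x
  nonneg : ∀ x y, 0 ≤ ω x y
  bounded_degree : ∃ M : ℕ, ∀ x, {y | 0 < ω x y}.encard ≤ M
  connected : (SimpleGraph.fromRel fun x y => 0 < ω x y).Connected

/-- The two walks: constant speed (reference measure `π`) and variable speed (counting measure). -/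
inductive Speed
  | constant
  | variable

namespace WeightedGraph

variable {V : Type*} (Γ : WeightedGraph V)

/-- The graph whose edges are the pairs of distinct vertices with positive conductance. -/
def graph : SimpleGraph V := SimpleGraph.fromRel fun x y => 0 < Γ.ω x y

/-- The weight `π(x) = ∑_y ω_{xy}` of a vertex (a finite sum). -/
def π (x : V) : ℝ := ∑' y, Γ.ω x y

/-- The reference measure: `θ = π` for the constant speed walk, `θ = 1` for the variable speed
walk. -/
def θ : Speed → V → ℝ
  | .constant, x => Γ.π x
  | .variable, _ => 1

/-- The open ball `B(x, R) = {y : d(x, y) < R}` of the graph distance. -/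
def ball (x : V) (R : ℝ) : Set V := {y | (Γ.graph.dist x y : ℝ) < R}

/-- The length of a walk in the graph, in which an edge `e` counts `1 ∧ ω_e ^ (-1/2)`. -/
def chemLength {x y : V} (p : Γ.graph.Walk x y) : ℝ :=
  (p.darts.map fun e => min 1 (Γ.ω e.fst e.snd ^ (-(1 / 2) : ℝ))).sum

/-- The metric `d̃(x, y)`: the least weighted length of a path from `x` to `y`. -/
def chemDist (x y : V) : ℝ := ⨅ p : Γ.graph.Walk x y, Γ.chemLength p

/-- The open ball `B̃(x, R)` of the metric `d̃`. -/
def chemBall (x : V) (R : ℝ) : Set V := {y | Γ.chemDist x y < R}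

/-- The total mass `∑_{x ∈ A} m(x)` of a set of vertices. -/
def mass (m : V → ℝ) (A : Set V) : ℝ := ∑' x, A.indicator m x

/-- The Laplacian `(1 / θ x) ∑_y (f(y) - f(x)) ω_{xy}`. -/
def laplacian (s : Speed) (f : V → ℝ) (x : V) : ℝ :=
  (Γ.θ s x)⁻¹ * ∑' y, (f y - f x) * Γ.ω x y

/-- `f` is harmonic on `A`. Only its values on `A` and on the neighbours of `A` matter. -/
def HarmonicOn (s : Speed) (f : V → ℝ) (A : Set V) : Prop := ∀ x ∈ A, Γ.laplacian s f x = 0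

/-- The set `A` together with all neighbours of its points. -/
def withBoundary (A : Set V) : Set V := A ∪ {y | ∃ x ∈ A, 0 < Γ.ω x y}

theorem finite_neighbors (x : V) : {y | 0 < Γ.ω x y}.Finite := by
  obtain ⟨M, hM⟩ := Γ.bounded_degree
  exact Set.finite_of_encard_le_coe (hM x)

theorem summable_ω (x : V) : Summable (Γ.ω x) := by
  refine summable_of_hasFiniteSupport ((Γ.finite_neighbors x).subset fun y hy => ?_)
  exact lt_of_le_of_ne (Γ.nonneg x y) (Ne.symm hy)

section Walk

variable [MeasurableSpace V]

open Classical in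
/-- The law of one jump from `x`: it leads to `y` with probability `ω_{xy} / π(x)`. (On the
one-point graph without conductances, where `π(x) = 0`, the walk stays at `x`.) -/
def jumpLaw (x : V) : Measure V :=
  if 0 < Γ.π x then Measure.sum fun y => ENNReal.ofReal (Γ.ω x y / Γ.π x) • Measure.dirac y
  else Measure.dirac x

instance isProbabilityMeasure_jumpLaw (x : V) : IsProbabilityMeasure (Γ.jumpLaw x) := by
  unfold jumpLaw
  split_ifs with h
  · constructor
    rw [Measure.sum_apply _ MeasurableSet.univ]
    simp only [Measure.smul_apply, measure_univ, smul_eq_mul, mul_one]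
    rw [← ENNReal.ofReal_tsum_of_nonneg (fun y => div_nonneg (Γ.nonneg x y) h.le)
      ((Γ.summable_ω x).div_const _), tsum_div_const]
    change ENNReal.ofReal (Γ.π x / Γ.π x) = 1
    rw [div_self h.ne', ENNReal.ofReal_one]
  · infer_instance

variable [Countable V] [MeasurableSingletonClass V]

/-- The transition kernel of the embedded discrete time chain. -/
def jumpKernel : Kernel V V := Kernel.ofFunOfCountable Γ.jumpLaw

instance isMarkovKernel_jumpKernel : IsMarkovKernel Γ.jumpKernel :=
  ⟨fun x => Γ.isProbabilityMeasure_jumpLaw x⟩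

/-- The same kernel, as a function of the whole past of the chain up to time `n`. -/
def jumpKernelPast (n : ℕ) : Kernel (Π _ : Finset.Iic n, V) V :=
  Γ.jumpKernel.comap (fun h => h ⟨n, Finset.mem_Iic.2 le_rfl⟩) (measurable_pi_apply _)

instance isMarkovKernel_jumpKernelPast (n : ℕ) : IsMarkovKernel (Γ.jumpKernelPast n) := by
  unfold jumpKernelPast
  infer_instance

/-- The law `P^x` on the sample space of pairs `(Y, e)`: `Y` is the embedded discrete time Markov
chain started at `x`, and, independently of it, `e` is a sequence of independent exponential
variables of mean `1`. -/
def P (x : V) : Measure ((ℕ → V) × (ℕ → ℝ)) :=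
  (Kernel.traj (X := fun _ => V) Γ.jumpKernelPast 0 fun _ => x).prod
    (Measure.infinitePi fun _ : ℕ => expMeasure 1)

instance isProbabilityMeasure_P (x : V) : IsProbabilityMeasure (Γ.P x) := by
  have : IsProbabilityMeasure (expMeasure 1) := isProbabilityMeasure_expMeasure one_pos
  unfold P
  infer_instance

end Walk

/-- The time `∑_{i < n} e_i θ(Y_i) / π(Y_i)` of the `n`-th jump. Given `Y`, the holding times at
`Y_i` are independent and exponential, with mean `1` for the constant speed walk and with mean
`1 / π(Y_i)` for the variable speed walk. -/
def jumpTime (s : Speed) (n : ℕ) (w : (ℕ → V) × (ℕ → ℝ)) : ℝ :=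
  ∑ i ∈ Finset.range n, w.2 i * (Γ.θ s (w.1 i) / Γ.π (w.1 i))

open Classical in
/-- The position `X_t` of the continuous time walk: `Y_n` between the `n`-th and the `(n+1)`-st
jump, and `none` (a cemetery) if infinitely many jumps happen before time `t`. -/
def X (s : Speed) (t : ℝ) (w : (ℕ → V) × (ℕ → ℝ)) : Option V :=
  if h : ∃ n, Γ.jumpTime s n w ≤ t ∧ t < Γ.jumpTime s (n + 1) w then some (w.1 (Nat.find h))
  else none

/-- The exit time `τ_A = inf {t ≥ 0 : X_t ∉ A}`. -/
def exitTime (s : Speed) (A : Set V) (w : (ℕ → V) × (ℕ → ℝ)) : ℝ≥0∞ :=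
  ⨅ (t : ℝ≥0) (_ : Γ.X s t w ∉ some '' A), (t : ℝ≥0∞)

/-- Elliptic Harnack inequality for large balls centred at `x₀`: every function that is positive on
the ball and its neighbours and harmonic on the ball satisfies `sup h ≤ C inf h` on the ball of half
the radius. -/
def EllipticHarnack (s : Speed) (x₀ : V) : Prop :=
  ∃ C > (0 : ℝ), ∃ R₁ ≥ (1 : ℝ), ∀ R ≥ R₁, ∀ h : V → ℝ,
    (∀ x ∈ Γ.withBoundary (Γ.ball x₀ R), 0 < h x) → Γ.HarmonicOn s h (Γ.ball x₀ R) →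
      ∀ x ∈ Γ.ball x₀ (R / 2), ∀ y ∈ Γ.ball x₀ (R / 2), h x ≤ C * h y

/-- Volume bounds `c R^d ≤ θ(B(x₀, R)) ≤ sup_{x ∈ B(x₀, R^(1+δ))} θ(B(x, R)) ≤ C R^d`. -/
def VolumeRegular (s : Speed) (x₀ : V) (d : ℕ) : Prop :=
  ∃ δ > (0 : ℝ), ∃ c > (0 : ℝ), ∃ C > (0 : ℝ), ∃ R₂ ≥ (1 : ℝ), ∀ R ≥ R₂,
    c * R ^ d ≤ mass (Γ.θ s) (Γ.ball x₀ R) ∧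
      ∀ x ∈ Γ.ball x₀ (R ^ (1 + δ)), mass (Γ.θ s) (Γ.ball x R) ≤ C * R ^ d

/-- For the constant speed walk: polynomial lower bound for `π`. For the variable speed walk:
comparison of `d̃` with the graph distance on large scales, for base points `x ∈ B(x₀, R^(1+δ))`. -/
def NonDegenerate (x₀ : V) : Speed → Prop
  | .constant => ∃ κ > (0 : ℝ), ∃ R₃ ≥ (1 : ℝ), ∀ R ≥ R₃, ∀ x ∈ Γ.ball x₀ R, R ^ (-κ) ≤ Γ.π x
  | .variable => ∃ δ > (0 : ℝ), ∃ c > (0 : ℝ), ∃ R₄ ≥ (1 : ℝ), ∀ R ≥ R₄,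
      ∀ x ∈ Γ.ball x₀ (R ^ (1 + δ)), ∀ y, R ≤ Γ.graph.dist x y →
        c * Γ.graph.dist x y ≤ Γ.chemDist x y

variable [MeasurableSpace V] [Countable V] [MeasurableSingletonClass V]

/-- The expected exit time `E^x[τ_A]`. -/
def meanExitTime (s : Speed) (x : V) (A : Set V) : ℝ≥0∞ := ∫⁻ w, Γ.exitTime s A w ∂(Γ.P x)

/-- The heat kernel `p_t(x, y) = P^x(X_t = y) / θ(y)`. -/
def heatKernel (s : Speed) (t : ℝ) (x y : V) : ℝ :=
  (Γ.P x).real {w | Γ.X s t w = some y} / Γ.θ s y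

/-- On-diagonal type upper bound for the heat kernel, near `x₀`. -/
def HeatKernelUpper (s : Speed) (x₀ : V) (d : ℕ) : Prop :=
  ∃ δ > (0 : ℝ), ∃ c > (0 : ℝ), ∃ T₀ ≥ (1 : ℝ), ∀ t ≥ T₀,
    ∀ x ∈ Γ.ball x₀ (t ^ ((1 + δ) / 2)), ∀ y ∈ Γ.ball x₀ (t ^ ((1 + δ) / 2)),
      Γ.heatKernel s t x y ≤ c * t ^ (-(d : ℝ) / 2)

/-- Lower bound for mean exit times from balls: balls of the graph distance for the constant speed
walk, balls of `d̃` for the variable speed walk. -/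
def ExitTimeLower (x₀ : V) : Speed → Prop
  | .constant => ∃ δ > (0 : ℝ), ∃ c > (0 : ℝ), ∃ R₀ ≥ (1 : ℝ), ∀ r ≥ R₀,
      ∀ x ∈ Γ.ball x₀ (r ^ (1 + δ)),
        ENNReal.ofReal (c * r ^ 2) ≤ Γ.meanExitTime .constant x (Γ.ball x r)
  | .variable => ∃ δ > (0 : ℝ), ∃ c > (0 : ℝ), ∃ R₀ ≥ (1 : ℝ), ∀ r ≥ R₀,
      ∀ x ∈ Γ.chemBall x₀ (r ^ (1 + δ)),
        ENNReal.ofReal (c * r ^ 2) ≤ Γ.meanExitTime .variable x (Γ.chemBall x r)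

/-- The standing assumption on the weighted graph, the walk `s` and the base point `x₀`. -/
structure StandingAssumption (s : Speed) (x₀ : V) (d : ℕ) : Prop where
  heatKernelUpper : Γ.HeatKernelUpper s x₀ d
  exitTimeLower : Γ.ExitTimeLower x₀ s
  ellipticHarnack : Γ.EllipticHarnack s x₀
  volumeRegular : Γ.VolumeRegular s x₀ d
  nonDegenerate : Γ.NonDegenerate x₀ s

end WeightedGraph

/-- The weighted graph is the lattice `ℤ^d`: the neighbours of `x` are the `2d` points at Euclidean
distance `1` from it. -/
def IsLattice {d : ℕ} (Γ : WeightedGraph (Fin d → ℤ)) : Prop :=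
  ∀ x y, 0 < Γ.ω x y ↔ ∑ i, |x i - y i| = 1

/-- The Gaussian heat kernel `k_t` with covariance matrix `S`. -/
def gaussianKernel {d : ℕ} (S : Matrix (Fin d) (Fin d) ℝ) (t : ℝ) (x : Fin d → ℝ) : ℝ :=
  (√((2 * Real.pi * t) ^ d * S.det))⁻¹ * Real.exp (-(x ⬝ᵥ (S⁻¹ *ᵥ x)) / (2 * t))

/-- The cube `H(y, R) = y + [-R, R]^d`. -/
def cube {d : ℕ} (y : Fin d → ℝ) (R : ℝ) : Set (Fin d → ℝ) := {z | ∀ i, |z i - y i| ≤ R}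

/-- The convergence `P^0(n^{-1/2} X_{⌊nt⌋} ∈ H(y, R)) → ∫_{H(y, R)} k_t` for all cubes and all
`t > 0`. -/
def InvariancePrinciple {d : ℕ} (Γ : WeightedGraph (Fin d → ℤ)) (s : Speed)
    (S : Matrix (Fin d) (Fin d) ℝ) : Prop :=
  ∀ (y : Fin d → ℝ), ∀ R > (0 : ℝ), ∀ t > (0 : ℝ),
    Tendsto (fun n : ℕ => (Γ.P 0).real
        {w | ∃ z : Fin d → ℤ, Γ.X s (⌊(n : ℝ) * t⌋₊ : ℝ) w = some z ∧
          (fun i => (√(n : ℝ))⁻¹ * (z i : ℝ)) ∈ cube y R})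
      atTop (𝓝 (∫ z in cube y R, gaussianKernel S t z))

end

set_option linter.unusedSectionVars false

noncomputable section

/-! ### Exponential clocks -/

/-! The invariance principle gives the law of the walk at time `N²t` on cubes of side of order `N`.
To reach single points, regularity of `p_t(0, ·)` at the origin is combined with reversibility and
with confinement of the walk over short times.

Killing the walk outside a finite set makes its generator a symmetric matrix in `ℓ²(θ)`. The forward
equation identifies the killed kernel with the spectral sum (`exists_spectral`). Exhausting the
graph by finite sets yields symmetry, Chapman-Kolmogorov, monotonicity of `p_t(x, x)`, and bounds
for `p_t - p_r` and for `L p_t` by on-diagonal values. Solutions of the Dirichlet problem `L v = -1`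
convert the exit time hypothesis into confinement: from `y`, the walk stays near `y` for a short
diffusive time (`le_sum_heatKernel_ball`).

At time `r²`, `p(0, ·)` satisfies a Poisson equation with right-hand side of order `r^(-2-d)`. On a
ball of radius `κr` it is close to a harmonic function, whose oscillation is controlled by the
elliptic Harnack inequality. Hence `p(0, z)` is close to `p(0, 0)` for `|z| ≤ ηr`
(`abs_heatKernel_sub_zero_le`), and near the origin the law of the walk is almost a multiple of `θ`.
For large `t` the window `η√t` contains any given compact set. Comparison with the nearly constant
Gaussian shows that rescaled `θ` converges vaguely to `a⁻¹` times Lebesgue measure, the volume limit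
fixing the constant (`exists_tendsto_scaledMass`). Small windows at fixed `t` then give `N^d p(0, 0)
→ a k_t(0)`.

By reversibility, the sum of `p_t(0, z)² θ(z)` is `p_{2t}(0, 0)`, whose limit is known, and `∫ k_t²
= k_{2t}(0)`. So weak convergence improves to `L²` convergence (`exists_sum_sq_heatKernel_sub_le`).
Writing `p_t(0, y)` as the average of `p_{t-u}(0, ·)` under the law of the walk started at `y` and
run for a short time `u`, Cauchy-Schwarz replaces `p_{t-u}(0, ·)` by the Gaussian. Confinement near
`y` evaluates the remaining average (`eventually_abs_heatKernel_sub_le`). Equicontinuity in time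
makes the estimate uniform on compact time intervals. -/

theorem expMeasure_one_Iic_of_nonneg {u : ℝ} (hu : 0 ≤ u) :
    expMeasure 1 (Iic u) = ENNReal.ofReal (1 - Real.exp (-u)) := by
  have : IsProbabilityMeasure (expMeasure 1) := isProbabilityMeasure_expMeasure one_pos
  have h := cdf_expMeasure_eq one_pos u
  rw [if_pos hu, one_mul] at h
  rw [← h, ofReal_cdf]

theorem expMeasure_one_Iic_of_nonpos {u : ℝ} (hu : u ≤ 0) : expMeasure 1 (Iic u) = 0 := by
  have h0 : expMeasure 1 (Iic 0) = 0 := by simp [expMeasure_one_Iic_of_nonneg le_rfl]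
  exact measure_mono_null (Iic_subset_Iic.2 hu) h0

theorem expMeasure_one_Ioi_of_nonneg {u : ℝ} (hu : 0 ≤ u) :
    expMeasure 1 (Ioi u) = ENNReal.ofReal (Real.exp (-u)) := by
  have : IsProbabilityMeasure (expMeasure 1) := isProbabilityMeasure_expMeasure one_pos
  rw [← compl_Iic, prob_compl_eq_one_sub measurableSet_Iic, expMeasure_one_Iic_of_nonneg hu,
    ← ENNReal.ofReal_one, ← ENNReal.ofReal_sub _ (by simpa using hu)]
  congr 1
  ring

theorem lintegral_expMeasure_one : ∫⁻ e, ENNReal.ofReal e ∂(expMeasure 1) = 1 := by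
  have : IsProbabilityMeasure (expMeasure 1) := isProbabilityMeasure_expMeasure one_pos
  have h0 : ∀ᵐ e ∂(expMeasure 1), 0 ≤ e := by
    rw [ae_iff]
    refine measure_mono_null (t := Iic 0) (fun e he => ?_) (expMeasure_one_Iic_of_nonpos le_rfl)
    exact (not_le.1 he).le
  have h1 := lintegral_eq_lintegral_meas_lt (expMeasure 1) h0 aemeasurable_id
  rw [show (∫⁻ e, ENNReal.ofReal e ∂(expMeasure 1)) = _ from h1]
  have h2 : ∫⁻ t in Ioi (0 : ℝ), (expMeasure 1) {a | t < a} =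
      ∫⁻ t in Ioi (0 : ℝ), ENNReal.ofReal (Real.exp (-t)) :=
    setLIntegral_congr_fun measurableSet_Ioi fun t ht => expMeasure_one_Ioi_of_nonneg (le_of_lt ht)
  rw [h2, ← ofReal_integral_eq_lintegral_ofReal (integrableOn_exp_neg_Ioi 0)
    (ae_of_all _ fun t => (Real.exp_pos _).le), integral_exp_neg_Ioi_zero, ENNReal.ofReal_one]

/-- The law of a sequence of independent exponential clocks. -/
abbrev clockLaw : Measure (ℕ → ℝ) := Measure.infinitePi fun _ : ℕ => expMeasure 1

instance isProbabilityMeasure_clockLaw : IsProbabilityMeasure clockLaw := by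
  have : IsProbabilityMeasure (expMeasure 1) := isProbabilityMeasure_expMeasure one_pos
  unfold clockLaw
  infer_instance

theorem clockLaw_map_eval (i : ℕ) : clockLaw.map (fun e => e i) = expMeasure 1 := by
  have : IsProbabilityMeasure (expMeasure 1) := isProbabilityMeasure_expMeasure one_pos
  exact Measure.infinitePi_map_eval (fun _ : ℕ => expMeasure 1) i

theorem ae_clockLaw_pos : ∀ᵐ e ∂clockLaw, ∀ i, 0 < e i := by
  rw [ae_all_iff]
  intro i
  have h : ∀ᵐ u ∂(clockLaw.map (fun e => e i)), 0 < u := by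
    rw [clockLaw_map_eval, ae_iff]
    refine measure_mono_null (t := Iic 0) (fun e he => ?_) (expMeasure_one_Iic_of_nonpos le_rfl)
    exact not_lt.1 he
  exact ae_of_ae_map (measurable_pi_apply i).aemeasurable h

/-- The exponential holding time after an independent time `τ ≥ 0`. -/
theorem expMeasure_holding {a τ t : ℝ} (ha : 0 < a) (hτ : 0 ≤ τ) :
    expMeasure 1 {e | τ + e * a ≤ t} =
      ENNReal.ofReal a⁻¹ * ∫⁻ r in Icc 0 t, expMeasure 1 {e | τ ≤ r ∧ r < τ + e * a} := by
  have hset : {e | τ + e * a ≤ t} = Iic ((t - τ) / a) := by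
    ext e; simp only [mem_ofPred_eq, mem_Iic, le_div_iff₀ ha]; constructor <;> intro h <;> linarith
  -- Once `τ` has passed, the clock is still running at `r` with probability `exp (-(r - τ) / a)`.
  -- Integrating this over `[τ, t]` and dividing by `a` gives the probability of ringing by `t`.
  have hI : ∀ r ∈ Icc 0 t, expMeasure 1 {e | τ ≤ r ∧ r < τ + e * a} =
      (Icc τ t).indicator (fun r => ENNReal.ofReal (Real.exp (-((r - τ) / a)))) r := by
    intro r hr
    by_cases h : τ ≤ r
    · rw [indicator_of_mem (mem_Icc.2 ⟨h, hr.2⟩), ← expMeasure_one_Ioi_of_nonneg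
        (div_nonneg (sub_nonneg.2 h) ha.le)]
      congr 1
      ext e
      simp only [mem_ofPred_eq, mem_Ioi, div_lt_iff₀ ha, h, true_and]
      constructor <;> intro h <;> linarith
    · rw [indicator_of_notMem (fun h' => h h'.1)]
      simp [h]
  rw [setLIntegral_congr_fun measurableSet_Icc hI, setLIntegral_indicator measurableSet_Icc, hset]
  have hsub : Icc τ t ∩ Icc 0 t = Icc τ t := inter_eq_left.2 (Icc_subset_Icc_left hτ)
  rw [hsub]
  rcases lt_or_ge t τ with h | h
  · rw [Icc_eq_empty (not_le.2 h), expMeasure_one_Iic_of_nonpos]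
    · simp
    · exact div_nonpos_of_nonpos_of_nonneg (by linarith) ha.le
  rw [expMeasure_one_Iic_of_nonneg (div_nonneg (sub_nonneg.2 h) ha.le),
    ← ofReal_integral_eq_lintegral_ofReal ((by fun_prop :
      Continuous fun r => Real.exp (-((r - τ) / a))).integrableOn_Icc)
      (ae_of_all _ fun r => (Real.exp_pos _).le), integral_Icc_eq_integral_Ioc,
    ← intervalIntegral.integral_of_le h, ← ENNReal.ofReal_mul (inv_nonneg.2 ha.le)]
  congr 1
  have hd : ∀ r ∈ uIcc τ t, HasDerivAt (fun r => -a * Real.exp (-((r - τ) / a)))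
      (Real.exp (-((r - τ) / a))) r := by
    intro r _
    have h1 : HasDerivAt (fun r => -((r - τ) / a)) (-(1 / a)) r :=
      (((hasDerivAt_id r).sub_const τ).div_const a).neg
    have h2 := (h1.exp).const_mul (-a)
    have h3 : ∀ E : ℝ, -a * (E * -(1 / a)) = E := fun E => by field_simp
    rwa [h3] at h2
  rw [intervalIntegral.integral_eq_sub_of_hasDerivAt hd
    ((by fun_prop : Continuous fun r => Real.exp (-((r - τ) / a))).intervalIntegrable _ _)]
  simp only [sub_self, zero_div, neg_zero, Real.exp_zero]
  field_simp
  ring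

/-- The probability that the jump has occurred is the jump rate times the expected time spent
waiting for it. The first `n` clocks are independent of clock `n`, so `expMeasure_holding` can be
integrated over the law of their weighted sum. -/
theorem clockLaw_jump (a : ℕ → ℝ) (ha : ∀ i, 0 < a i) (n : ℕ) (t : ℝ) :
    clockLaw {e | ∑ i ∈ Finset.range (n + 1), e i * a i ≤ t} =
      ENNReal.ofReal (a n)⁻¹ * ∫⁻ r in Icc 0 t,
        clockLaw {e | ∑ i ∈ Finset.range n, e i * a i ≤ r ∧
          r < ∑ i ∈ Finset.range (n + 1), e i * a i} := by
  have : IsProbabilityMeasure (expMeasure 1) := isProbabilityMeasure_expMeasure one_pos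
  set T : (ℕ → ℝ) → ℝ := fun e => ∑ i ∈ Finset.range n, e i * a i with hT
  have hTm : Measurable T := by fun_prop
  have hind : IndepFun T (fun e : ℕ → ℝ => e n) clockLaw := by
    have h1 : iIndepFun (fun (i : ℕ) (e : ℕ → ℝ) => e i) clockLaw :=
      iIndepFun_infinitePi (X := fun _ u => u) (fun _ => measurable_id)
    have h2 := h1.indepFun_finset (Finset.range n) {n} (by simp) (fun i => measurable_pi_apply i)
    have hφ : Measurable fun g : Finset.range n → ℝ => ∑ i : Finset.range n, g i * a i := by
      fun_prop
    have hψ : Measurable fun g : ({n} : Finset ℕ) → ℝ => g ⟨n, by simp⟩ := measurable_pi_apply _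
    have h3 := h2.comp hφ hψ
    convert h3 using 1
    · ext e
      simp only [hT, Function.comp]
      rw [← Finset.sum_coe_sort (Finset.range n)]
    · rfl
  have hmap : clockLaw.map (fun e => (T e, e n)) = (clockLaw.map T).prod (expMeasure 1) := by
    rw [(indepFun_iff_map_prod_eq_prod_map_map hTm.aemeasurable
      (measurable_pi_apply n).aemeasurable).1 hind, clockLaw_map_eval]
  have hprob : IsProbabilityMeasure (clockLaw.map T) :=
    Measure.isProbabilityMeasure_map hTm.aemeasurable
  have hnn : ∀ᵐ τ ∂(clockLaw.map T), 0 ≤ τ := by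
    rw [ae_map_iff hTm.aemeasurable measurableSet_Ici]
    filter_upwards [ae_clockLaw_pos] with e he
    exact Finset.sum_nonneg fun i _ => mul_nonneg (he i).le (ha i).le
  have hpull : ∀ S : Set (ℝ × ℝ), MeasurableSet S → clockLaw {e | (T e, e n) ∈ S} =
      ∫⁻ τ, expMeasure 1 {u | (τ, u) ∈ S} ∂(clockLaw.map T) := by
    intro S hS
    have := Measure.map_apply (μ := clockLaw) (f := fun e => (T e, e n))
      (hTm.prodMk (measurable_pi_apply n)) hS
    rw [hmap, Measure.prod_apply hS] at this
    exact this.symm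
  have hL : {e : ℕ → ℝ | ∑ i ∈ Finset.range (n + 1), e i * a i ≤ t} =
      {e | (T e, e n) ∈ {q : ℝ × ℝ | q.1 + q.2 * a n ≤ t}} := by
    ext e; simp [hT, Finset.sum_range_succ]
  have hR : ∀ r, {e : ℕ → ℝ | ∑ i ∈ Finset.range n, e i * a i ≤ r ∧
      r < ∑ i ∈ Finset.range (n + 1), e i * a i} =
      {e | (T e, e n) ∈ {q : ℝ × ℝ | q.1 ≤ r ∧ r < q.1 + q.2 * a n}} := by
    intro r; ext e; simp [hT, Finset.sum_range_succ]
  rw [hL, hpull _ (measurableSet_le (by fun_prop) (by fun_prop))]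
  have hR' : ∀ r, clockLaw {e : ℕ → ℝ | ∑ i ∈ Finset.range n, e i * a i ≤ r ∧
      r < ∑ i ∈ Finset.range (n + 1), e i * a i} =
      ∫⁻ τ, expMeasure 1 {u | τ ≤ r ∧ r < τ + u * a n} ∂(clockLaw.map T) := by
    intro r
    rw [hR r, hpull]
    · simp only [mem_ofPred_eq]
    · measurability
  simp_rw [hR']
  have hmeas : Measurable fun q : ℝ × ℝ =>
      expMeasure 1 {u | q.2 ≤ q.1 ∧ q.1 < q.2 + u * a n} := by
    have : MeasurableSet {q : (ℝ × ℝ) × ℝ | q.1.2 ≤ q.1.1 ∧ q.1.1 < q.1.2 + q.2 * a n} := by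
      measurability
    exact measurable_measure_prodMk_left this
  rw [lintegral_lintegral_swap (f := fun r τ => expMeasure 1 {u | τ ≤ r ∧ r < τ + u * a n})
      hmeas.aemeasurable,
    ← lintegral_const_mul' _ _ ENNReal.ofReal_ne_top]
  refine lintegral_congr_ae ?_
  filter_upwards [hnn] with τ hτ
  exact expMeasure_holding (ha n) hτ

/-! ### The embedded chain and its holding times. -/

namespace WeightedGraph

variable {V : Type*} (Γ : WeightedGraph V)

section Chain

variable [MeasurableSpace V] [Countable V] [MeasurableSingletonClass V]

/-- The law of the embedded discrete time chain started at `x`. -/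
def chainLaw (x : V) : Measure (ℕ → V) :=
  Kernel.traj (X := fun _ => V) Γ.jumpKernelPast 0 fun _ => x

instance isProbabilityMeasure_chainLaw (x : V) : IsProbabilityMeasure (Γ.chainLaw x) := by
  unfold chainLaw
  infer_instance

theorem P_eq_prod (x : V) : Γ.P x = (Γ.chainLaw x).prod clockLaw := rfl

/-- The space of finite prefixes is countable and discrete, so any event that depends only on a
prefix is measurable without further argument. -/
theorem measurableSet_of_prefix {V : Type*} [MeasurableSpace V] [Countable V]
    [MeasurableSingletonClass V] {n : ℕ} {p : (ℕ → V) → Prop}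
    (hp : ∀ Y Y' : ℕ → V, (∀ i ≤ n, Y i = Y' i) → (p Y ↔ p Y')) :
    ∃ E : Set (Π _ : Finset.Iic n, V), {Y | p Y} = Preorder.frestrictLe n ⁻¹' E := by
  refine ⟨Preorder.frestrictLe n '' {Y | p Y}, Subset.antisymm (subset_preimage_image _ _) ?_⟩
  rintro Y ⟨Y', hY', h⟩
  refine (hp Y' Y fun i hi => ?_).1 hY'
  exact congrFun h ⟨i, Finset.mem_Iic.2 hi⟩

/-- The Markov property of the embedded chain at a fixed time. -/
theorem chainLaw_step (x z y : V) (n : ℕ) {p : (ℕ → V) → Prop}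
    (hp : ∀ Y Y' : ℕ → V, (∀ i ≤ n, Y i = Y' i) → (p Y ↔ p Y')) :
    Γ.chainLaw x {Y | p Y ∧ Y n = z ∧ Y (n + 1) = y} =
      Γ.chainLaw x {Y | p Y ∧ Y n = z} * Γ.jumpLaw z {y} := by
  obtain ⟨E, hE⟩ := measurableSet_of_prefix hp
  set E' : Set (Π _ : Finset.Iic n, V) := E ∩ {h | h ⟨n, Finset.mem_Iic.2 le_rfl⟩ = z} with hE'
  have h1 := Kernel.partialTraj_compProd_eq_map_traj (X := fun _ => V) (κ := Γ.jumpKernelPast)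
    (Nat.zero_le n) (x₀ := fun _ => x)
  have hmem : ∀ Y : ℕ → V, p Y ↔ Preorder.frestrictLe n Y ∈ E := fun Y => by
    rw [← mem_preimage, ← hE]; rfl
  have hmE' : MeasurableSet E' := MeasurableSet.of_discrete
  have h2 : Γ.chainLaw x {Y | p Y ∧ Y n = z ∧ Y (n + 1) = y} =
      (Γ.chainLaw x).map (fun Y => (Preorder.frestrictLe n Y, Y (n + 1))) (E' ×ˢ {y}) := by
    rw [Measure.map_apply (by fun_prop) (hmE'.prod (measurableSet_singleton y))]
    congr 1
    ext Y
    simp only [mem_ofPred_eq, hmem, mem_preimage, mem_prod, hE', mem_inter_iff, mem_singleton_iff,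
      and_assoc]
    rfl
  have h3 : Γ.chainLaw x {Y | p Y ∧ Y n = z} =
      Kernel.partialTraj (X := fun _ => V) Γ.jumpKernelPast 0 n (fun _ => x) E' := by
    rw [← Kernel.traj_map_frestrictLe_apply, Measure.map_apply (by fun_prop) hmE']
    change Γ.chainLaw x _ = Γ.chainLaw x _
    congr 1
    ext Y
    simp only [mem_ofPred_eq, hmem, mem_preimage, hE', mem_inter_iff]
    rfl
  rw [h2, h3]
  unfold chainLaw
  rw [← h1, Measure.compProd_apply_prod hmE' (measurableSet_singleton y)]
  have h4 : ∀ h ∈ E', Γ.jumpKernelPast n h {y} = Γ.jumpLaw z {y} := by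
    intro h hh
    have : h ⟨n, Finset.mem_Iic.2 le_rfl⟩ = z := hh.2
    rw [jumpKernelPast, Kernel.comap_apply, this]
    rfl
  rw [setLIntegral_congr_fun hmE' h4, setLIntegral_const, mul_comm]

theorem chainLaw_zero (x : V) : ∀ᵐ Y ∂(Γ.chainLaw x), Y 0 = x := by
  have h : (Γ.chainLaw x).map (Preorder.frestrictLe 0) =
      Measure.dirac (fun _ : Finset.Iic 0 => x) := by
    unfold chainLaw
    rw [Kernel.traj_map_frestrictLe_apply, Kernel.partialTraj_self]
    simp [Kernel.id_apply]
  have h2 : ∀ᵐ g ∂((Γ.chainLaw x).map (Preorder.frestrictLe 0)),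
      g ⟨0, Finset.mem_Iic.2 le_rfl⟩ = x := by
    rw [h, ae_dirac_eq]
    rfl
  exact ae_of_ae_map (by fun_prop) h2

theorem jumpLaw_singleton {z : V} (hz : 0 < Γ.π z) (y : V) :
    Γ.jumpLaw z {y} = ENNReal.ofReal (Γ.ω z y / Γ.π z) := by
  classical
  rw [jumpLaw, if_pos hz, Measure.sum_apply _ (measurableSet_singleton y), tsum_eq_single y]
  · simp
  · intro b hb
    simp [hb]

end Chain

/-- The rate `π(x) / θ(x)` at which the walk leaves `x`. -/
def rate (s : Speed) (x : V) : ℝ := Γ.π x / Γ.θ s x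

theorem θ_pos {s : Speed} (hπ : ∀ x, 0 < Γ.π x) (x : V) : 0 < Γ.θ s x := by
  cases s
  · exact hπ x
  · exact one_pos

theorem rate_pos {s : Speed} (hπ : ∀ x, 0 < Γ.π x) (x : V) : 0 < Γ.rate s x :=
  div_pos (hπ x) (Γ.θ_pos hπ x)

variable [MeasurableSpace V] [Countable V] [MeasurableSingletonClass V]

theorem measurable_jumpTime (s : Speed) (n : ℕ) : Measurable (Γ.jumpTime s n) := by
  unfold jumpTime
  refine Finset.measurable_sum _ fun i _ => Measurable.mul (by fun_prop) ?_
  exact (Measurable.of_discrete (f := fun z : V => Γ.θ s z / Γ.π z)).comp (by fun_prop)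

theorem ae_P_clock_pos (x : V) : ∀ᵐ w ∂(Γ.P x), ∀ i, 0 < w.2 i := by
  have h : Measure.QuasiMeasurePreserving (Prod.snd : (ℕ → V) × (ℕ → ℝ) → _) (Γ.P x) clockLaw := by
    rw [P_eq_prod]
    exact Measure.quasiMeasurePreserving_snd
  exact h.ae ae_clockLaw_pos

theorem ae_P_start (x : V) : ∀ᵐ w ∂(Γ.P x), w.1 0 = x := by
  have h : Measure.QuasiMeasurePreserving (Prod.fst : (ℕ → V) × (ℕ → ℝ) → _) (Γ.P x)
      (Γ.chainLaw x) := by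
    rw [P_eq_prod]
    exact Measure.quasiMeasurePreserving_fst
  exact h.ae (Γ.chainLaw_zero x)

/-- After `n` jumps the walk is at `y`, has not left `A`, and at time `t` it waits for the next
jump. -/
def waitsAt (s : Speed) (A : Set V) (n : ℕ) (t : ℝ) (y : V) : Set ((ℕ → V) × (ℕ → ℝ)) :=
  {w | Γ.jumpTime s n w ≤ t ∧ t < Γ.jumpTime s (n + 1) w ∧ (∀ i ≤ n, w.1 i ∈ A) ∧ w.1 n = y}

/-- The `n`-th jump has happened at time `t` and leads to `y`, the walk not having left `A`. -/
def arrivesAt (s : Speed) (A : Set V) (n : ℕ) (t : ℝ) (y : V) : Set ((ℕ → V) × (ℕ → ℝ)) :=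
  {w | Γ.jumpTime s n w ≤ t ∧ (∀ i ≤ n, w.1 i ∈ A) ∧ w.1 n = y}

/-- The walk has made its `n`-th jump to `y` and left `y` before time `t`, not having left `A`
before. -/
def leaves (s : Speed) (A : Set V) (n : ℕ) (t : ℝ) (y : V) : Set ((ℕ → V) × (ℕ → ℝ)) :=
  {w | Γ.jumpTime s (n + 1) w ≤ t ∧ (∀ i ≤ n, w.1 i ∈ A) ∧ w.1 n = y}

theorem measurableSet_stay (A : Set V) (n : ℕ) (y : V) :
    MeasurableSet {Y : ℕ → V | (∀ i ≤ n, Y i ∈ A) ∧ Y n = y} := by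
  have h : {Y : ℕ → V | (∀ i ≤ n, Y i ∈ A) ∧ Y n = y} =
      (⋂ i ∈ Finset.range (n + 1), (fun Y => Y i) ⁻¹' A) ∩ (fun Y => Y n) ⁻¹' {y} := by
    ext Y; simp
  rw [h]
  exact (Finset.measurableSet_biInter _ fun i _ => measurable_pi_apply i .of_discrete).inter
    (measurable_pi_apply n .of_discrete)

theorem measurableSet_leaves (s : Speed) (A : Set V) (n : ℕ) (t : ℝ) (y : V) :
    MeasurableSet (Γ.leaves s A n t y) :=
  (measurableSet_le (Γ.measurable_jumpTime s (n + 1)) measurable_const).inter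
    (measurable_fst (measurableSet_stay A n y))

theorem measurableSet_waitsAt (s : Speed) (A : Set V) (n : ℕ) (t : ℝ) (y : V) :
    MeasurableSet (Γ.waitsAt s A n t y) :=
  (measurableSet_le (Γ.measurable_jumpTime s n) measurable_const).inter
    ((measurableSet_lt measurable_const (Γ.measurable_jumpTime s (n + 1))).inter
      (measurable_fst (measurableSet_stay A n y)))

theorem jumpTime_le_succ {s : Speed} (hπ : ∀ x, 0 < Γ.π x) {w : (ℕ → V) × (ℕ → ℝ)}
    (hw : ∀ i, 0 < w.2 i) (n : ℕ) : Γ.jumpTime s n w < Γ.jumpTime s (n + 1) w := by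
  rw [jumpTime, jumpTime, Finset.sum_range_succ]
  exact lt_add_of_pos_right _ (mul_pos (hw n) (div_pos (Γ.θ_pos hπ _) (hπ _)))

theorem strictMono_jumpTime {s : Speed} (hπ : ∀ x, 0 < Γ.π x) {w : (ℕ → V) × (ℕ → ℝ)}
    (hw : ∀ i, 0 < w.2 i) : StrictMono fun n => Γ.jumpTime s n w :=
  strictMono_nat_of_lt_succ fun n => Γ.jumpTime_le_succ hπ hw n

theorem measure_waitsAt_add_leaves {s : Speed} (hπ : ∀ x, 0 < Γ.π x) (A : Set V) (x : V) (n : ℕ)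
    (t : ℝ) (y : V) :
    Γ.P x (Γ.waitsAt s A n t y) + Γ.P x (Γ.leaves s A n t y) = Γ.P x (Γ.arrivesAt s A n t y) := by
  rw [← measure_union _ (Γ.measurableSet_leaves s A n t y)]
  · refine measure_congr (eventuallyEq_set.2 ?_)
    filter_upwards [Γ.ae_P_clock_pos x] with w hw
    have h := Γ.jumpTime_le_succ (s := s) hπ hw n
    simp only [waitsAt, leaves, arrivesAt, mem_union, mem_ofPred_eq]
    constructor
    · rintro (⟨h1, -, h2⟩ | ⟨h1, h2⟩)
      · exact ⟨h1, h2⟩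
      · exact ⟨h.le.trans h1, h2⟩
    · rintro ⟨h1, h2⟩
      rcases lt_or_ge t (Γ.jumpTime s (n + 1) w) with h3 | h3
      · exact Or.inl ⟨h1, h3, h2⟩
      · exact Or.inr ⟨h3, h2⟩
  · rw [Set.disjoint_left]
    rintro w ⟨-, h1, -⟩ ⟨h2, -⟩
    exact absurd h2 (not_le.2 h1)

/-- For a frozen path of the embedded chain the holding times are fixed multiples of the clocks, so
`clockLaw_jump` applies path by path. Tonelli then moves the time integral outside. -/
theorem measure_leaves {s : Speed} (hπ : ∀ x, 0 < Γ.π x) (A : Set V) (x : V) (n : ℕ)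
    (t : ℝ) (y : V) :
    Γ.P x (Γ.leaves s A n t y) =
      ENNReal.ofReal (Γ.rate s y) * ∫⁻ r in Icc 0 t, Γ.P x (Γ.waitsAt s A n r y) := by
  set E : Set (ℕ → V) := {Y | (∀ i ≤ n, Y i ∈ A) ∧ Y n = y} with hE
  have hEm : MeasurableSet E := measurableSet_stay A n y
  have ha : ∀ z, 0 < Γ.θ s z / Γ.π z := fun z => div_pos (Γ.θ_pos hπ _) (hπ _)
  have h1 : ∀ Y, clockLaw (Prod.mk Y ⁻¹' Γ.leaves s A n t y) = E.indicator (fun Y =>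
      clockLaw {e | ∑ i ∈ Finset.range (n + 1), e i * (Γ.θ s (Y i) / Γ.π (Y i)) ≤ t}) Y := by
    intro Y
    by_cases hY : Y ∈ E
    · rw [indicator_of_mem hY]
      congr 1
      ext e
      exact ⟨fun h => h.1, fun h => ⟨h, hY⟩⟩
    · rw [indicator_of_notMem hY]
      convert! measure_empty (μ := clockLaw)
      exact eq_empty_of_forall_notMem fun e h => hY h.2
  have h2 : ∀ r Y, clockLaw (Prod.mk Y ⁻¹' Γ.waitsAt s A n r y) = E.indicator (fun Y =>
      clockLaw {e | ∑ i ∈ Finset.range n, e i * (Γ.θ s (Y i) / Γ.π (Y i)) ≤ r ∧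
        r < ∑ i ∈ Finset.range (n + 1), e i * (Γ.θ s (Y i) / Γ.π (Y i))}) Y := by
    intro r Y
    by_cases hY : Y ∈ E
    · rw [indicator_of_mem hY]
      congr 1
      ext e
      exact ⟨fun h => ⟨h.1, h.2.1⟩, fun h => ⟨h.1, h.2, hY⟩⟩
    · rw [indicator_of_notMem hY]
      convert! measure_empty (μ := clockLaw)
      exact eq_empty_of_forall_notMem fun e h => hY h.2.2
  rw [P_eq_prod, Measure.prod_apply (Γ.measurableSet_leaves s A n t y)]
  simp_rw [fun r => Measure.prod_apply (μ := Γ.chainLaw x) (ν := clockLaw)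
    (Γ.measurableSet_waitsAt s A n r y)]
  rw [lintegral_lintegral_swap, ← lintegral_const_mul' _ _ ENNReal.ofReal_ne_top]
  · refine lintegral_congr fun Y => ?_
    simp_rw [h1, h2]
    by_cases hY : Y ∈ E
    · simp only [indicator_of_mem hY]
      rw [clockLaw_jump (fun i => Γ.θ s (Y i) / Γ.π (Y i)) (fun i => ha (Y i)) n t, hY.2, inv_div]
      rfl
    · simp [indicator_of_notMem hY]
  · have hm : MeasurableSet {q : (ℝ × (ℕ → V)) × (ℕ → ℝ) |
        (q.1.2, q.2) ∈ Γ.waitsAt s A n q.1.1 y} := by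
      have hj : ∀ m, Measurable fun q : (ℝ × (ℕ → V)) × (ℕ → ℝ) =>
          Γ.jumpTime s m (q.1.2, q.2) := fun m => (Γ.measurable_jumpTime s m).comp (by fun_prop)
      exact (measurableSet_le (hj n) (by fun_prop)).inter
        ((measurableSet_lt (by fun_prop) (hj (n + 1))).inter
          ((by fun_prop : Measurable fun q : (ℝ × (ℕ → V)) × (ℕ → ℝ) => q.1.2) hEm))
    exact (measurable_measure_prodMk_left (ν := clockLaw) hm).aemeasurable

theorem measure_arrivesAt_zero {s : Speed} (A : Set V) {x : V} (hx : x ∈ A)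
    {t : ℝ} (ht : 0 ≤ t) (y : V) [Decidable (x = y)] :
    Γ.P x (Γ.arrivesAt s A 0 t y) = if x = y then 1 else 0 := by
  have h : Γ.P x (Γ.arrivesAt s A 0 t y) = Γ.P x {_w | x = y} := by
    refine measure_congr (eventuallyEq_set.2 ?_)
    filter_upwards [Γ.ae_P_start x] with w hw
    simp only [arrivesAt, jumpTime, mem_ofPred_eq, Finset.range_zero, Finset.sum_empty,
      Nat.le_zero, forall_eq, hw]
    exact ⟨fun h => h.2.2, fun h => ⟨ht, hx, h⟩⟩
  rw [h]
  split_ifs with hxy <;> simp [hxy]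

/-- With the clocks frozen, the time of jump `n + 1` depends on the chain only through its positions
up to index `n`. It therefore belongs to the past in the Markov property `chainLaw_step`. -/
theorem measure_arrivesAt_succ {s : Speed} (hπ : ∀ x, 0 < Γ.π x) (A : Finset V) (x : V) (n : ℕ)
    (t : ℝ) {y : V} (hy : y ∈ A) :
    Γ.P x (Γ.arrivesAt s A (n + 1) t y) =
      ∑ z ∈ A, Γ.P x (Γ.leaves s A n t z) * ENNReal.ofReal (Γ.ω z y / Γ.π z) := by
  have h0 : Γ.arrivesAt s A (n + 1) t y =
      ⋃ z ∈ A, Γ.leaves s A n t z ∩ {w | w.1 (n + 1) = y} := by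
    ext w
    simp only [arrivesAt, leaves, mem_ofPred_eq, mem_iUnion, mem_inter_iff, exists_prop,
      Finset.mem_coe]
    constructor
    · rintro ⟨h1, h2, h3⟩
      exact ⟨w.1 n, h2 n (Nat.le_succ n), ⟨h1, fun i hi => h2 i (hi.trans (Nat.le_succ n)), rfl⟩, h3⟩
    · rintro ⟨z, hz, ⟨h1, h2, h3⟩, h4⟩
      refine ⟨h1, fun i hi => ?_, h4⟩
      rcases Nat.of_le_succ hi with hi | hi
      · exact h2 i hi
      · rw [hi, h4]; exact hy
  have hm : MeasurableSet {w : (ℕ → V) × (ℕ → ℝ) | w.1 (n + 1) = y} :=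
    (by fun_prop : Measurable fun w : (ℕ → V) × (ℕ → ℝ) => w.1 (n + 1)) (measurableSet_singleton y)
  rw [h0, measure_biUnion_finset]
  · refine Finset.sum_congr rfl fun z hz => ?_
    rw [P_eq_prod, Measure.prod_apply_symm ((Γ.measurableSet_leaves s A n t z).inter hm),
      Measure.prod_apply_symm (Γ.measurableSet_leaves s A n t z),
      ← lintegral_mul_const' _ _ ENNReal.ofReal_ne_top]
    refine lintegral_congr fun e => ?_
    rw [← Γ.jumpLaw_singleton (hπ z)]
    have := Γ.chainLaw_step x z y n (p := fun Y =>
      Γ.jumpTime s (n + 1) (Y, e) ≤ t ∧ ∀ i ≤ n, Y i ∈ (A : Set V)) ?_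
    · convert! this using 2
      · ext Y
        simp only [leaves, mem_preimage, mem_inter_iff, mem_ofPred_eq, and_assoc]
      · congr 1
        ext Y
        simp only [leaves, mem_preimage, mem_ofPred_eq, and_assoc]
    · intro Y Y' hY
      have h1 : Γ.jumpTime s (n + 1) (Y, e) = Γ.jumpTime s (n + 1) (Y', e) := by
        refine Finset.sum_congr rfl fun i hi => ?_
        simp only [hY i (Nat.lt_succ_iff.1 (Finset.mem_range.1 hi))]
      rw [h1]
      refine and_congr Iff.rfl (forall₂_congr fun i hi => ?_)
      rw [hY i hi]
  · intro z _ z' _ hzz'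
    rw [Function.onFun, Set.disjoint_left]
    rintro w ⟨h1, -⟩ ⟨h2, -⟩
    exact hzz' (h1.2.2.symm.trans h2.2.2)
  · exact fun z _ => (Γ.measurableSet_leaves s A n t z).inter hm

end WeightedGraph

/-! ### Linear integral equations. -/

theorem intervalIntegrable_finsetSum {ι : Type*} (s : Finset ι) {f : ι → ℝ → ℝ} {a b : ℝ}
    (h : ∀ i ∈ s, IntervalIntegrable (f i) volume a b) :
    IntervalIntegrable (fun r => ∑ i ∈ s, f i r) volume a b := by
  have := IntervalIntegrable.sum s h
  rwa [Finset.sum_fn] at this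

/-- The product of `exp (l t)` with the right-hand side has zero right derivative. Right derivatives
are the natural ones, the equation being given only for `t ≥ 0`. -/
theorem eq_mul_exp_of_eq_sub_integral {c : ℝ → ℝ} {b l : ℝ} (hm : Measurable c)
    (hi : ∀ t, 0 ≤ t → IntervalIntegrable c volume 0 t)
    (hc : ∀ t, 0 ≤ t → c t = b - l * ∫ r in (0 : ℝ)..t, c r) {t : ℝ} (ht : 0 ≤ t) :
    c t = b * Real.exp (-l * t) := by
  have hC : ContinuousOn (fun r => ∫ q in (0 : ℝ)..r, c q) (Icc 0 t) := by
    have := intervalIntegral.continuousOn_primitive_interval' (hi t ht) left_mem_uIcc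
    rwa [uIcc_of_le ht] at this
  -- Continuity of `c` comes from the equation itself, its right-hand side being a primitive.
  have hcont : ∀ T, 0 ≤ T → ContinuousOn c (Icc 0 T) := by
    intro T hT
    have h1 := intervalIntegral.continuousOn_primitive_interval' (hi T hT) left_mem_uIcc
    rw [uIcc_of_le hT] at h1
    exact (continuousOn_const.sub (continuousOn_const.mul h1)).congr fun r hr => hc r hr.1
  have hd : ∀ r ∈ Ico 0 t, HasDerivWithinAt
      (fun r => Real.exp (l * r) * (b - l * ∫ q in (0 : ℝ)..r, c q)) 0 (Ici r) r := by
    intro r hr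
    have hcr : ContinuousWithinAt c (Ici r) r := by
      have h1 : ContinuousWithinAt c (Icc 0 t) r := hcont t ht r ⟨hr.1, hr.2.le⟩
      refine h1.mono_of_mem_nhdsWithin ?_
      exact mem_of_superset (Icc_mem_nhdsGE hr.2) (Icc_subset_Icc_left hr.1)
    have h1 : HasDerivWithinAt (fun r => ∫ q in (0 : ℝ)..r, c q) (c r) (Ici r) r :=
      intervalIntegral.integral_hasDerivWithinAt_right (hi r hr.1)
        (hm.stronglyMeasurable.stronglyMeasurableAtFilter) (hcr.mono Ioi_subset_Ici_self)
    have h2 : HasDerivWithinAt (fun r => Real.exp (l * r)) (Real.exp (l * r) * l) (Ici r) r := by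
      have := ((hasDerivAt_id r).const_mul l).exp
      simpa using this.hasDerivWithinAt
    have h3 := h2.mul ((h1.const_mul l).const_sub b)
    convert! h3 using 1
    rw [hc r hr.1]
    ring
  have h := constant_of_has_deriv_right_zero (a := 0) (b := t)
    ((by fun_prop : ContinuousOn (fun r => Real.exp (l * r)) (Icc 0 t)).mul
      (continuousOn_const.sub (continuousOn_const.mul hC))) hd t ⟨ht, le_rfl⟩
  simp only [Pi.mul_apply, Pi.sub_apply] at h
  rw [← hc t ht] at h
  simp only [mul_zero, Real.exp_zero, intervalIntegral.integral_same, sub_zero, one_mul] at h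
  rw [← h, mul_comm, ← mul_assoc, ← Real.exp_add]
  simp

/-- In an orthonormal eigenbasis of `H` the system decouples: each coefficient solves the scalar
equation with its own eigenvalue. -/
theorem eq_sum_exp_of_eq_sub_integral {ι : Type*} [Fintype ι] [DecidableEq ι] {H : Matrix ι ι ℝ}
    (hH : H.IsHermitian) (x : ι) {U : ℝ → ι → ℝ} (hm : ∀ y, Measurable fun t => U t y)
    (hi : ∀ t, 0 ≤ t → ∀ y, IntervalIntegrable (fun t => U t y) volume 0 t)
    (hU : ∀ t, 0 ≤ t → ∀ y, U t y =
      (if x = y then 1 else 0) - ∫ r in (0 : ℝ)..t, ∑ z, U r z * H z y) {t : ℝ} (ht : 0 ≤ t)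
    (y : ι) :
    U t y = ∑ i, Real.exp (-hH.eigenvalues i * t) * hH.eigenvectorBasis i x *
      hH.eigenvectorBasis i y := by
  set ψ := hH.eigenvectorBasis with hψ
  have hc : ∀ i, ∀ t, 0 ≤ t → ∑ y, U t y * ψ i y = ψ i x * Real.exp (-hH.eigenvalues i * t) := by
    intro i t ht
    refine eq_mul_exp_of_eq_sub_integral (c := fun t => ∑ y, U t y * ψ i y)
      (Finset.measurable_sum _ fun y _ => (hm y).mul_const _) (fun t ht => ?_) (fun t ht => ?_) ht
    · exact (intervalIntegrable_finsetSum _ fun y _ => (hi t ht y).mul_const _)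
    · have hI : ∀ y, IntervalIntegrable (fun r => ∑ z, U r z * H z y) volume 0 t := fun y =>
        intervalIntegrable_finsetSum _ fun z _ => (hi t ht z).mul_const _
      have h1 : ∀ y, U t y * ψ i y = (if x = y then ψ i y else 0) -
          ∫ r in (0 : ℝ)..t, (∑ z, U r z * H z y) * ψ i y := by
        intro y
        rw [hU t ht y, intervalIntegral.integral_mul_const, sub_mul]
        congr 1
        split_ifs <;> simp
      simp_rw [h1]
      rw [Finset.sum_sub_distrib, Finset.sum_ite_eq, if_pos (Finset.mem_univ x),
        ← intervalIntegral.integral_finsetSum fun y _ => (hI y).mul_const _,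
        ← intervalIntegral.integral_const_mul]
      congr 2
      ext r
      have h2 : ∀ z, ∑ y, H z y * ψ i y = hH.eigenvalues i * ψ i z := by
        intro z
        have := congrFun (hH.mulVec_eigenvectorBasis i) z
        simpa [Matrix.mulVec, dotProduct] using this
      simp_rw [Finset.sum_mul, Finset.mul_sum]
      rw [Finset.sum_comm]
      refine Finset.sum_congr rfl fun z _ => ?_
      simp_rw [mul_assoc]
      rw [← Finset.mul_sum, h2 z]
      ring
  have h1 := congrArg (fun v : EuclideanSpace ℝ ι => v y) (ψ.sum_repr (WithLp.toLp 2 (U t)))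
  simp only [WithLp.ofLp_sum, Finset.sum_apply, WithLp.ofLp_smul, Pi.smul_apply, smul_eq_mul] at h1
  rw [← h1]
  refine Finset.sum_congr rfl fun i _ => ?_
  rw [OrthonormalBasis.repr_apply_apply, EuclideanSpace.inner_eq_star_dotProduct]
  have h2 : (U t) ⬝ᵥ star (ψ i).ofLp = ∑ y, U t y * ψ i y := by simp [dotProduct]
  rw [h2, hc i t ht]
  ring

/-! ### The forward equation of the killed walk. -/

namespace WeightedGraph

variable {V : Type*} (Γ : WeightedGraph V) [MeasurableSpace V] [Countable V]
  [MeasurableSingletonClass V]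

/-- The probability that the walk started at `x` is at `y` at time `t` without having left `A`. -/
def killedProb (s : Speed) (A : Set V) (t : ℝ) (x y : V) : ℝ≥0∞ :=
  Γ.P x (⋃ n, Γ.waitsAt s A n t y)

theorem killedProb_le_one (s : Speed) (A : Set V) (t : ℝ) (x y : V) :
    Γ.killedProb s A t x y ≤ 1 := prob_le_one

theorem killedProb_eq_tsum {s : Speed} (hπ : ∀ x, 0 < Γ.π x) (A : Set V) (t : ℝ) (x y : V) :
    Γ.killedProb s A t x y = ∑' n, Γ.P x (Γ.waitsAt s A n t y) := by
  refine measure_iUnion₀ (fun m n hmn => ?_)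
    fun n => (Γ.measurableSet_waitsAt s A n t y).nullMeasurableSet
  have key : ∀ m n : ℕ, m < n → ∀ᵐ w ∂(Γ.P x),
      w ∉ Γ.waitsAt s A m t y ∩ Γ.waitsAt s A n t y := by
    intro m n hmn
    filter_upwards [Γ.ae_P_clock_pos x] with w hw
    rintro ⟨⟨-, h1, -⟩, h2, -⟩
    have := (Γ.strictMono_jumpTime (s := s) hπ hw).monotone (Nat.succ_le_of_lt hmn)
    exact absurd (h1.trans_le this) (not_lt.2 h2)
  rcases lt_or_gt_of_ne hmn with h | h
  · exact measure_eq_zero_iff_ae_notMem.2 (key m n h)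
  · rw [Function.onFun, AEDisjoint, inter_comm]
    exact measure_eq_zero_iff_ae_notMem.2 (key n m h)

theorem measurable_P_waitsAt (s : Speed) (A : Set V) (n : ℕ) (x y : V) :
    Measurable fun t => Γ.P x (Γ.waitsAt s A n t y) := by
  have hm : MeasurableSet {q : ℝ × ((ℕ → V) × (ℕ → ℝ)) | q.2 ∈ Γ.waitsAt s A n q.1 y} := by
    have hj : ∀ m, Measurable fun q : ℝ × ((ℕ → V) × (ℕ → ℝ)) => Γ.jumpTime s m q.2 :=
      fun m => (Γ.measurable_jumpTime s m).comp (by fun_prop)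
    exact (measurableSet_le (hj n) (by fun_prop)).inter
      ((measurableSet_lt (by fun_prop) (hj (n + 1))).inter
        ((by fun_prop : Measurable fun q : ℝ × ((ℕ → V) × (ℕ → ℝ)) => q.2.1)
          (measurableSet_stay A n y)))
  exact measurable_measure_prodMk_left (ν := Γ.P x) hm

theorem measurable_killedProb {s : Speed} (hπ : ∀ x, 0 < Γ.π x) (A : Set V) (x y : V) :
    Measurable fun t => Γ.killedProb s A t x y := by
  simp_rw [Γ.killedProb_eq_tsum hπ]
  exact Measurable.tsum fun n => Γ.measurable_P_waitsAt s A n x y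

/-- The forward equation of the walk killed outside `A`. -/
theorem killedProb_forward {s : Speed} (hπ : ∀ x, 0 < Γ.π x) (A : Finset V) {x : V} (hx : x ∈ A)
    {t : ℝ} (ht : 0 ≤ t) {y : V} (hy : y ∈ A) [Decidable (x = y)] :
    Γ.killedProb s A t x y +
        ENNReal.ofReal (Γ.rate s y) * ∫⁻ r in Icc 0 t, Γ.killedProb s A r x y =
      (if x = y then 1 else 0) + ∑ z ∈ A, (ENNReal.ofReal (Γ.rate s z) *
        ∫⁻ r in Icc 0 t, Γ.killedProb s A r x z) * ENNReal.ofReal (Γ.ω z y / Γ.π z) := by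
  have hleave : ∀ z, ENNReal.ofReal (Γ.rate s z) * ∫⁻ r in Icc 0 t, Γ.killedProb s A r x z =
      ∑' n, Γ.P x (Γ.leaves s A n t z) := by
    intro z
    simp_rw [Γ.killedProb_eq_tsum hπ]
    rw [lintegral_tsum fun n => (Γ.measurable_P_waitsAt s A n x z).aemeasurable,
      ← ENNReal.tsum_mul_left]
    exact tsum_congr fun n => (Γ.measure_leaves hπ A x n t z).symm
  simp_rw [hleave]
  rw [Γ.killedProb_eq_tsum hπ, ← ENNReal.tsum_add]
  simp_rw [Γ.measure_waitsAt_add_leaves hπ]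
  -- Arrival number `0` is the start and gives the Kronecker delta. Arrival number `n + 1` is a
  -- departure from some `z` after `n` jumps, followed by a jump to `y`.
  rw [tsum_eq_zero_add' ENNReal.summable, Γ.measure_arrivesAt_zero (s := s) (A : Set V)
    (by simpa using hx) ht y]
  congr 1
  simp_rw [Γ.measure_arrivesAt_succ hπ A x _ t hy, ← ENNReal.tsum_mul_right]
  exact Summable.tsum_finsetSum fun z _ => ENNReal.summable

theorem intervalIntegrable_killedProb {s : Speed} (hπ : ∀ x, 0 < Γ.π x) (A : Set V) (x y : V)
    (a b : ℝ) : IntervalIntegrable (fun r => (Γ.killedProb s A r x y).toReal) volume a b := by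
  rw [intervalIntegrable_iff]
  refine Measure.integrableOn_of_bounded (M := 1) (by simp)
    (Γ.measurable_killedProb hπ A x y).ennreal_toReal.aestronglyMeasurable
    (ae_of_all _ fun r => ?_)
  rw [Real.norm_of_nonneg ENNReal.toReal_nonneg]
  exact ENNReal.toReal_le_of_le_ofReal zero_le_one (by simpa using Γ.killedProb_le_one s A r x y)

theorem toReal_lintegral_killedProb {s : Speed} (hπ : ∀ x, 0 < Γ.π x) (A : Set V) (x y : V)
    {t : ℝ} (ht : 0 ≤ t) :
    (∫⁻ r in Icc 0 t, Γ.killedProb s A r x y).toReal =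
      ∫ r in (0 : ℝ)..t, (Γ.killedProb s A r x y).toReal := by
  rw [intervalIntegral.integral_of_le ht, ← integral_Icc_eq_integral_Ioc, integral_toReal]
  · exact (Γ.measurable_killedProb hπ A x y).aemeasurable
  · exact ae_of_all _ fun r => (Γ.killedProb_le_one s A r x y).trans_lt ENNReal.one_lt_top

/-- Over a bounded time interval every term of `killedProb_forward` is finite, so the equation may
be subtracted in `ℝ`. The product of the rate at `z` and the jump probability is `ω z y / θ z`. -/
theorem toReal_killedProb_forward {s : Speed} (hπ : ∀ x, 0 < Γ.π x) (A : Finset V) {x : V}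
    (hx : x ∈ A) {t : ℝ} (ht : 0 ≤ t) {y : V} (hy : y ∈ A) [Decidable (x = y)] :
    (Γ.killedProb s A t x y).toReal = (if x = y then 1 else 0) +
      ∫ r in (0 : ℝ)..t, ((∑ z ∈ A, (Γ.killedProb s A r x z).toReal * (Γ.ω z y / Γ.θ s z)) -
        Γ.rate s y * (Γ.killedProb s A r x y).toReal) := by
  have hfin : ∀ z, (∫⁻ r in Icc 0 t, Γ.killedProb s A r x z) ≠ ⊤ := by
    intro z
    refine ne_top_of_le_ne_top (b := ∫⁻ r in Icc 0 t, 1) (by simp) ?_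
    exact lintegral_mono fun r => Γ.killedProb_le_one s A r x z
  have h := congrArg ENNReal.toReal (Γ.killedProb_forward (s := s) hπ A hx ht hy)
  have hterm : ∀ z, (ENNReal.ofReal (Γ.rate s z) * ∫⁻ r in Icc 0 t, Γ.killedProb s A r x z) *
      ENNReal.ofReal (Γ.ω z y / Γ.π z) ≠ ⊤ := fun z =>
    ENNReal.mul_ne_top (ENNReal.mul_ne_top ENNReal.ofReal_ne_top (hfin z)) ENNReal.ofReal_ne_top
  rw [ENNReal.toReal_add (ne_top_of_le_ne_top ENNReal.one_ne_top (Γ.killedProb_le_one s A t x y))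
      (ENNReal.mul_ne_top ENNReal.ofReal_ne_top (hfin y)),
    ENNReal.toReal_add (by split_ifs <;> simp) (ENNReal.sum_ne_top.2 fun z _ => hterm z),
    ENNReal.toReal_sum fun z _ => hterm z] at h
  simp only [ENNReal.toReal_mul, ENNReal.toReal_ofReal (Γ.rate_pos (s := s) hπ _).le,
    ENNReal.toReal_ofReal (div_nonneg (Γ.nonneg _ _) (hπ _).le),
    Γ.toReal_lintegral_killedProb hπ _ _ _ ht] at h
  rw [eq_sub_of_add_eq h, intervalIntegral.integral_sub
    (intervalIntegrable_finsetSum _ fun z _ => (Γ.intervalIntegrable_killedProb hπ A x z 0 t).mul_const _)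
    ((Γ.intervalIntegrable_killedProb hπ A x y 0 t).const_mul _),
    intervalIntegral.integral_finsetSum
      fun z _ => (Γ.intervalIntegrable_killedProb hπ A x z 0 t).mul_const _,
    intervalIntegral.integral_const_mul, ← add_sub_assoc]
  congr 2
  · split_ifs <;> simp
  · refine Finset.sum_congr rfl fun z _ => ?_
    rw [intervalIntegral.integral_mul_const, rate]
    have := (hπ z).ne'
    field_simp

end WeightedGraph

/-! ### Spectral representation on finite sets. -/

namespace WeightedGraph

variable {V : Type*} (Γ : WeightedGraph V)

theorem sum_ω_le_π (A : Finset V) (x : V) : ∑ z ∈ A, Γ.ω x z ≤ Γ.π x :=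
  (Γ.summable_ω x).sum_le_tsum A fun z _ => Γ.nonneg x z

/-- Non-negativity of the Dirichlet form of the killed walk, which makes the eigenvalues
non-negative: bound `f y * f z` by the mean of the squares and use the symmetry of `ω`. -/
theorem sum_ω_mul_le (A : Finset V) (f : V → ℝ) :
    ∑ y ∈ A, f y * ∑ z ∈ A, Γ.ω y z * f z ≤ ∑ y ∈ A, Γ.π y * f y ^ 2 := by
  have h1 : ∑ y ∈ A, f y * ∑ z ∈ A, Γ.ω y z * f z ≤
      ∑ y ∈ A, ∑ z ∈ A, (Γ.ω y z * f y ^ 2 / 2 + Γ.ω y z * f z ^ 2 / 2) := by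
    refine Finset.sum_le_sum fun y _ => ?_
    rw [Finset.mul_sum]
    refine Finset.sum_le_sum fun z _ => ?_
    nlinarith [Γ.nonneg y z, mul_nonneg (Γ.nonneg y z) (sq_nonneg (f y - f z))]
  have h2 : ∑ y ∈ A, ∑ z ∈ A, Γ.ω y z * f z ^ 2 / 2 = ∑ y ∈ A, ∑ z ∈ A, Γ.ω y z * f y ^ 2 / 2 := by
    rw [Finset.sum_comm]
    refine Finset.sum_congr rfl fun y _ => Finset.sum_congr rfl fun z _ => ?_
    rw [Γ.symm]
  refine h1.trans ?_
  simp_rw [Finset.sum_add_distrib]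
  rw [h2, ← Finset.sum_add_distrib]
  refine Finset.sum_le_sum fun y _ => ?_
  rw [← Finset.sum_div, ← Finset.sum_mul]
  nlinarith [mul_le_mul_of_nonneg_right (Γ.sum_ω_le_π A y) (sq_nonneg (f y))]

variable [MeasurableSpace V] [Countable V] [MeasurableSingletonClass V]

/-- When all clocks are positive the jump times increase strictly, so the waiting intervals are
disjoint. One null set serves all times and all sets `A` at once. -/
theorem ae_waits_unique {s : Speed} (hπ : ∀ x, 0 < Γ.π x) (x : V) :
    ∀ᵐ w ∂(Γ.P x), ∀ (t : ℝ) (A A' : Set V) (n n' : ℕ) (y y' : V),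
      w ∈ Γ.waitsAt s A n t y → w ∈ Γ.waitsAt s A' n' t y' → n = n' ∧ y = y' := by
  filter_upwards [Γ.ae_P_clock_pos x] with w hw
  rintro t A A' n n' y y' ⟨h1, h2, -, h3⟩ ⟨h1', h2', -, h3'⟩
  have hmono := (Γ.strictMono_jumpTime (s := s) hπ hw).monotone
  have hn : n = n' := by
    by_contra hne
    rcases lt_or_gt_of_ne hne with h | h
    · exact absurd (h2.trans_le ((hmono (Nat.succ_le_of_lt h)).trans h1')) (lt_irrefl _)
    · exact absurd (h2'.trans_le ((hmono (Nat.succ_le_of_lt h)).trans h1)) (lt_irrefl _)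
  subst hn
  exact ⟨rfl, h3.symm.trans h3'⟩

theorem measurableSet_iUnion_waitsAt (s : Speed) (A : Set V) (t : ℝ) (y : V) :
    MeasurableSet (⋃ n, Γ.waitsAt s A n t y) :=
  MeasurableSet.iUnion fun n => Γ.measurableSet_waitsAt s A n t y

theorem aedisjoint_waitsAt {s : Speed} (hπ : ∀ x, 0 < Γ.π x) (A : Set V) (t : ℝ) (x : V)
    {y y' : V} (h : y ≠ y') :
    AEDisjoint (Γ.P x) (⋃ n, Γ.waitsAt s A n t y) (⋃ n, Γ.waitsAt s A n t y') := by
  refine measure_eq_zero_iff_ae_notMem.2 ?_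
  filter_upwards [Γ.ae_waits_unique (s := s) hπ x] with w hw
  rintro ⟨h1, h2⟩
  obtain ⟨n, h1⟩ := mem_iUnion.1 h1
  obtain ⟨n', h2⟩ := mem_iUnion.1 h2
  exact h (hw t A A n n' y y' h1 h2).2

theorem measure_biUnion_waitsAt {s : Speed} (hπ : ∀ x, 0 < Γ.π x) (A : Set V) (t : ℝ) (x : V)
    (F : Finset V) : Γ.P x (⋃ y ∈ F, ⋃ n, Γ.waitsAt s A n t y) =
      ∑ y ∈ F, Γ.killedProb s A t x y :=
  measure_biUnion_finset₀ (fun _ _ _ _ h => Γ.aedisjoint_waitsAt hπ A t x h)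
    fun y _ => (Γ.measurableSet_iUnion_waitsAt s A t y).nullMeasurableSet

theorem killedProb_ne_top (s : Speed) (A : Set V) (t : ℝ) (x y : V) :
    Γ.killedProb s A t x y ≠ ⊤ :=
  ne_top_of_le_ne_top ENNReal.one_ne_top (Γ.killedProb_le_one s A t x y)

theorem sum_killedProb_le_one {s : Speed} (hπ : ∀ x, 0 < Γ.π x) (A : Set V) (t : ℝ) (x : V)
    (F : Finset V) : ∑ y ∈ F, (Γ.killedProb s A t x y).toReal ≤ 1 := by
  rw [← ENNReal.toReal_sum fun y _ => Γ.killedProb_ne_top s A t x y,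
    ← Γ.measure_biUnion_waitsAt hπ]
  exact ENNReal.toReal_le_of_le_ofReal zero_le_one (by simpa using prob_le_one)

theorem killedProb_of_notMem_right (s : Speed) (A : Set V) (t : ℝ) (x : V) {y : V} (hy : y ∉ A) :
    Γ.killedProb s A t x y = 0 := by
  rw [killedProb]
  convert! measure_empty (μ := Γ.P x)
  refine eq_empty_of_forall_notMem fun w hw => ?_
  obtain ⟨n, -, -, h1, h2⟩ := mem_iUnion.1 hw
  exact hy (h2 ▸ h1 n le_rfl)

theorem killedProb_of_notMem_left (s : Speed) (A : Set V) (t : ℝ) {x : V} (y : V) (hx : x ∉ A) :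
    Γ.killedProb s A t x y = 0 := by
  refine measure_eq_zero_iff_ae_notMem.2 ?_
  filter_upwards [Γ.ae_P_start x] with w hw h
  obtain ⟨n, -, -, h1, -⟩ := mem_iUnion.1 h
  exact hx (hw ▸ h1 0 (Nat.zero_le _))

/-- The heat kernel of the walk killed outside `A`. -/
def killedKernel (s : Speed) (A : Set V) (t : ℝ) (x y : V) : ℝ :=
  (Γ.killedProb s A t x y).toReal / Γ.θ s y

-- Conjugation by `√θ` turns the negative of the killed generator into a real symmetric matrix. Its
-- eigenvectors divided by `√θ` are orthonormal in `ℓ²(θ)`. The forward equation, conjugated in the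
-- same way, has the spectral sum as its only solution.
open Classical in
theorem exists_spectral {s : Speed} (hπ : ∀ x, 0 < Γ.π x) (A : Finset V) :
    ∃ (lam : A → ℝ) (φ : A → V → ℝ), (∀ i, 0 ≤ lam i) ∧
      (∀ i j, ∑ z ∈ A, φ i z * φ j z * Γ.θ s z = if i = j then 1 else 0) ∧
      (∀ i, ∀ y ∈ A, (∑ z ∈ A, Γ.ω y z * φ i z) - Γ.π y * φ i y = -lam i * Γ.θ s y * φ i y) ∧
      ∀ t, 0 ≤ t → ∀ x y, Γ.killedKernel s A t x y =
        ∑ i, Real.exp (-lam i * t) * φ i x * φ i y := by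
  have hθ : ∀ x, 0 < Γ.θ s x := Γ.θ_pos hπ
  obtain ⟨q, hq, hqq⟩ : ∃ q : V → ℝ, (∀ x, 0 < q x) ∧ ∀ x, q x * q x = Γ.θ s x :=
    ⟨fun x => √(Γ.θ s x), fun x => Real.sqrt_pos.2 (hθ x), fun x => Real.mul_self_sqrt (hθ x).le⟩
  set H : Matrix A A ℝ := fun x y =>
    ((if x = y then Γ.π x else 0) - Γ.ω x y) / (q x * q y) with hHdef
  have hH : H.IsHermitian := by
    refine Matrix.IsHermitian.ext fun x y => ?_
    simp only [hHdef, star_trivial]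
    rw [Γ.symm y x, mul_comm]
    congr 2
    by_cases h : x = y
    · subst h; rfl
    · rw [if_neg h, if_neg (Ne.symm h)]
  set ψ := hH.eigenvectorBasis with hψ
  -- Extension by zero matches the killed kernel, which vanishes when either argument is outside
  -- `A`.
  set φ : A → V → ℝ := fun i x => if h : x ∈ A then ψ i ⟨x, h⟩ / q x else 0 with hφ
  have hφA : ∀ i (x : A), φ i x = ψ i x / q x := fun i x => by
    simp only [hφ, x.2, dif_pos]
  have hφ0 : ∀ i, ∀ x ∉ A, φ i x = 0 := fun i x hx => by simp only [hφ, hx, dif_neg, not_false_eq_true]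
  have horth : ∀ i j, ∑ z ∈ A, φ i z * φ j z * Γ.θ s z = if i = j then 1 else 0 := by
    intro i j
    rw [← Finset.sum_coe_sort A, ← OrthonormalBasis.inner_eq_ite ψ i j,
      EuclideanSpace.inner_eq_star_dotProduct]
    refine Finset.sum_congr rfl fun z _ => ?_
    rw [hφA, hφA, ← hqq z]
    have := (hq z).ne'
    simp only [Pi.star_apply, star_trivial]
    field_simp
  have heig : ∀ i, ∀ y ∈ A, (∑ z ∈ A, Γ.ω y z * φ i z) - Γ.π y * φ i y =
      -hH.eigenvalues i * Γ.θ s y * φ i y := by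
    intro i y hy
    have h1 := congrFun (hH.mulVec_eigenvectorBasis i) ⟨y, hy⟩
    simp only [Matrix.mulVec, dotProduct, Pi.smul_apply, smul_eq_mul] at h1
    have h2 : ∀ z : A, H ⟨y, hy⟩ z * ψ i z =
        ((if (⟨y, hy⟩ : A) = z then Γ.π y * φ i y else 0) - Γ.ω y z * φ i z) / q y := by
      intro z
      rw [hφA]
      have hz := (hq z).ne'
      have hy' := (hq y).ne'
      simp only [hHdef]
      split_ifs with h
      · subst h
        have := hφA i ⟨y, hy⟩
        rw [this]
        field_simp
      · field_simp
        ring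
    simp_rw [← hψ, h2] at h1
    rw [← Finset.sum_div, Finset.sum_sub_distrib, Finset.sum_ite_eq, if_pos (Finset.mem_univ _),
      Finset.sum_coe_sort A (fun z => Γ.ω y z * φ i z), div_eq_iff (hq y).ne'] at h1
    have h3 : φ i y = ψ i ⟨y, hy⟩ / q y := hφA i ⟨y, hy⟩
    have h4 : ψ i ⟨y, hy⟩ = φ i y * q y := by
      rw [h3, div_mul_cancel₀ _ (hq y).ne']
    rw [h4, mul_assoc, mul_assoc, hqq] at h1
    linarith
  refine ⟨hH.eigenvalues, φ, fun i => ?_, horth, heig, fun t ht x y => ?_⟩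
  · have h1 : hH.eigenvalues i = ∑ y ∈ A, Γ.π y * φ i y ^ 2 -
        ∑ y ∈ A, φ i y * ∑ z ∈ A, Γ.ω y z * φ i z := by
      have h2 := horth i i
      rw [if_pos rfl] at h2
      rw [← mul_one (hH.eigenvalues i), ← h2, Finset.mul_sum, ← Finset.sum_sub_distrib]
      refine Finset.sum_congr rfl fun y hy => ?_
      have := heig i y hy
      linear_combination (φ i y) * this
    rw [h1]
    exact sub_nonneg.2 (Γ.sum_ω_mul_le A (φ i))
  · by_cases hx : x ∈ A
    · by_cases hy : y ∈ A
      -- This is the kernel multiplied by `√θ` at both arguments, hence the solution of the equation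
      -- with matrix `H`.
      · set U : ℝ → A → ℝ := fun t z =>
          (Γ.killedProb s A t x z).toReal * (q x / q z) with hUdef
        have hU := eq_sum_exp_of_eq_sub_integral hH ⟨x, hx⟩ (U := U)
          (fun z => (Γ.measurable_killedProb hπ A x z).ennreal_toReal.mul_const _)
          (fun t _ z => (Γ.intervalIntegrable_killedProb hπ A x z 0 t).mul_const _)
          (fun t ht z => ?_) ht ⟨y, hy⟩
        · have h3 : ∀ i, Real.exp (-hH.eigenvalues i * t) * φ i x * φ i y =
              (Real.exp (-hH.eigenvalues i * t) * ψ i ⟨x, hx⟩ * ψ i ⟨y, hy⟩) /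
                (q x * q y) := by
            intro i
            rw [show φ i x = _ from hφA i ⟨x, hx⟩, show φ i y = _ from hφA i ⟨y, hy⟩]
            have hx' := (hq x).ne'
            have hy' := (hq y).ne'
            field_simp
          simp_rw [h3]
          rw [← Finset.sum_div, ← hU, killedKernel, hUdef, ← hqq y]
          have hx' := (hq x).ne'
          have hy' := (hq y).ne'
          simp only
          field_simp
        · simp only [hUdef]
          rw [Γ.toReal_killedProb_forward hπ A hx ht z.2, add_mul,
            ← intervalIntegral.integral_mul_const, sub_eq_add_neg,
            ← intervalIntegral.integral_neg]
          congr 1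
          · by_cases h : x = z
            · have h' : (⟨x, hx⟩ : A) = z := Subtype.ext h
              rw [if_pos h, if_pos h', ← h, div_self (hq x).ne', one_mul]
            · have h' : ¬ (⟨x, hx⟩ : A) = z := fun hh => h (congrArg Subtype.val hh)
              rw [if_neg h, if_neg h', zero_mul]
          · congr 1
            ext r
            have h5 : ∀ z' : A, (Γ.killedProb s A r x z').toReal *
                (q x / q z') * H z' z =
                (if z' = z then Γ.rate s z * (Γ.killedProb s A r x z).toReal *
                  (q x / q z) else 0) -
                (Γ.killedProb s A r x z').toReal * (Γ.ω z' z / Γ.θ s z') *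
                  (q x / q z) := by
              intro z'
              have hz := (hq z).ne'
              have hz' := (hq z').ne'
              have hzt := (hθ z).ne'
              simp only [hHdef]
              split_ifs with h
              · subst h
                rw [rate, ← hqq z']
                field_simp
              · rw [← hqq z']
                field_simp
                ring
            simp_rw [h5]
            rw [Finset.sum_sub_distrib, Finset.sum_ite_eq', if_pos (Finset.mem_univ _),
              ← Finset.sum_mul, Finset.sum_coe_sort A (fun z' =>
                (Γ.killedProb s A r x z').toReal * (Γ.ω z' z / Γ.θ s z'))]
            ring
      · rw [killedKernel, Γ.killedProb_of_notMem_right s A t x (by simpa using hy)]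
        simp [hφ0 _ y hy]
    · rw [killedKernel, Γ.killedProb_of_notMem_left s A t y (by simpa using hx)]
      simp [hφ0 _ x hx]

end WeightedGraph

/-! ### The heat kernel as a limit of killed kernels. -/

namespace WeightedGraph

variable {V : Type*} (Γ : WeightedGraph V)

theorem θ_mul_laplacian {s : Speed} (hπ : ∀ x, 0 < Γ.π x) (f : V → ℝ) (x : V) (A : Finset V)
    (hA : ∀ y ∉ A, Γ.ω x y * f y = 0) :
    Γ.θ s x * Γ.laplacian s f x = (∑ y ∈ A, Γ.ω x y * f y) - Γ.π x * f x := by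
  rw [laplacian, mul_inv_cancel_left₀ (Γ.θ_pos hπ x).ne']
  have h1 : HasSum (fun y => Γ.ω x y * f y) (∑ y ∈ A, Γ.ω x y * f y) :=
    hasSum_sum_of_ne_finset_zero hA
  have h2 : HasSum (fun y => Γ.ω x y * f x) (Γ.π x * f x) := (Γ.summable_ω x).hasSum.mul_right _
  rw [← (h1.sub h2).tsum_eq]
  exact tsum_congr fun y => by ring

/-- The finite set of neighbours of a vertex. -/
def nbrs (x : V) : Finset V := (Γ.finite_neighbors x).toFinset

theorem mem_nbrs {x y : V} : y ∈ Γ.nbrs x ↔ 0 < Γ.ω x y := by simp [nbrs]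

theorem ω_eq_zero_of_notMem_nbrs {x y : V} (h : y ∉ Γ.nbrs x) : Γ.ω x y = 0 :=
  le_antisymm (not_lt.1 fun h' => h (Γ.mem_nbrs.2 h')) (Γ.nonneg x y)

variable [MeasurableSpace V] [Countable V] [MeasurableSingletonClass V]

/-- The index chosen in the definition of `X` is almost surely the only possible one. So the heat
kernel is the killed kernel with `A = univ`. -/
theorem ae_X_eq_some_iff {s : Speed} (hπ : ∀ x, 0 < Γ.π x) (t : ℝ) (x : V) :
    ∀ᵐ w ∂(Γ.P x), ∀ y, Γ.X s t w = some y ↔ w ∈ ⋃ n, Γ.waitsAt s univ n t y := by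
  filter_upwards [Γ.ae_waits_unique (s := s) hπ x] with w hw y
  rw [X]
  split_ifs with h
  · rw [Option.some_inj, mem_iUnion]
    constructor
    · intro hy
      exact ⟨Nat.find h, (Nat.find_spec h).1, (Nat.find_spec h).2, fun _ _ => mem_univ _, hy⟩
    · rintro ⟨n, hn⟩
      have h1 : w ∈ Γ.waitsAt s univ (Nat.find h) t (w.1 (Nat.find h)) :=
        ⟨(Nat.find_spec h).1, (Nat.find_spec h).2, fun _ _ => mem_univ _, rfl⟩
      exact (hw t univ univ _ _ _ _ h1 hn).2
  · simp only [false_iff, mem_iUnion, not_exists]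
    exact fun n hn => h ⟨n, hn.1, hn.2.1⟩

theorem measure_X_eq_some {s : Speed} (hπ : ∀ x, 0 < Γ.π x) (t : ℝ) (x y : V) :
    Γ.P x {w | Γ.X s t w = some y} = Γ.killedProb s univ t x y := by
  refine measure_congr (eventuallyEq_set.2 ?_)
  filter_upwards [Γ.ae_X_eq_some_iff (s := s) hπ t x] with w hw
  exact hw y

theorem heatKernel_eq_killedKernel {s : Speed} (hπ : ∀ x, 0 < Γ.π x) (t : ℝ) (x y : V) :
    Γ.heatKernel s t x y = Γ.killedKernel s univ t x y := by
  rw [heatKernel, Measure.real, Γ.measure_X_eq_some hπ, killedKernel]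

theorem measure_X_mem {s : Speed} (hπ : ∀ x, 0 < Γ.π x) (t : ℝ) (x : V) (F : Finset V) :
    (Γ.P x).real {w | ∃ y ∈ F, Γ.X s t w = some y} = ∑ y ∈ F, Γ.heatKernel s t x y * Γ.θ s y := by
  have h1 : Γ.P x {w | ∃ y ∈ F, Γ.X s t w = some y} = ∑ y ∈ F, Γ.killedProb s univ t x y := by
    rw [← Γ.measure_biUnion_waitsAt hπ]
    refine measure_congr (eventuallyEq_set.2 ?_)
    filter_upwards [Γ.ae_X_eq_some_iff (s := s) hπ t x] with w hw
    simp only [hw, mem_iUnion, exists_prop]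
  rw [Measure.real, h1, ENNReal.toReal_sum fun y _ => Γ.killedProb_ne_top s univ t x y]
  refine Finset.sum_congr rfl fun y _ => ?_
  rw [Γ.heatKernel_eq_killedKernel hπ, killedKernel, div_mul_cancel₀ _ (Γ.θ_pos hπ y).ne']

theorem waitsAt_mono (s : Speed) {A A' : Set V} (h : A ⊆ A') (n : ℕ) (t : ℝ) (y : V) :
    Γ.waitsAt s A n t y ⊆ Γ.waitsAt s A' n t y :=
  fun _ hw => ⟨hw.1, hw.2.1, fun i hi => h (hw.2.2.1 i hi), hw.2.2.2⟩

theorem killedProb_mono (s : Speed) {A A' : Set V} (h : A ⊆ A') (t : ℝ) (x y : V) :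
    Γ.killedProb s A t x y ≤ Γ.killedProb s A' t x y :=
  measure_mono (iUnion_mono fun n => Γ.waitsAt_mono s h n t y)

theorem killedKernel_le_heatKernel {s : Speed} (hπ : ∀ x, 0 < Γ.π x) (A : Set V) (t : ℝ) (x y : V) :
    Γ.killedKernel s A t x y ≤ Γ.heatKernel s t x y := by
  rw [Γ.heatKernel_eq_killedKernel hπ]
  exact div_le_div_of_nonneg_right (ENNReal.toReal_mono (Γ.killedProb_ne_top _ _ _ _ _)
    (Γ.killedProb_mono s (subset_univ A) t x y)) (Γ.θ_pos hπ y).le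

theorem killedKernel_nonneg {s : Speed} (hπ : ∀ x, 0 < Γ.π x) (A : Set V) (t : ℝ) (x y : V) :
    0 ≤ Γ.killedKernel s A t x y :=
  div_nonneg ENNReal.toReal_nonneg (Γ.θ_pos hπ y).le

theorem heatKernel_nonneg {s : Speed} (hπ : ∀ x, 0 < Γ.π x) (t : ℝ) (x y : V) :
    0 ≤ Γ.heatKernel s t x y := by
  rw [Γ.heatKernel_eq_killedKernel hπ]
  exact Γ.killedKernel_nonneg hπ _ t x y

/-- Up to a given jump the path visits finitely many vertices, so it stays in some finite `A`;
continuity of the measure from below concludes. This carries the spectral identities to the whole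
graph and needs no assumption against explosion. -/
theorem tendsto_killedKernel {s : Speed} (hπ : ∀ x, 0 < Γ.π x) (t : ℝ) (x y : V) :
    Tendsto (fun A : Finset V => Γ.killedKernel s A t x y) atTop (𝓝 (Γ.heatKernel s t x y)) := by
  rw [Γ.heatKernel_eq_killedKernel hπ]
  refine Tendsto.div_const ?_ _
  refine (ENNReal.tendsto_toReal (Γ.killedProb_ne_top _ _ _ _ _)).comp ?_
  have h1 : (⋃ n, Γ.waitsAt s univ n t y) = ⋃ A : Finset V, ⋃ n, Γ.waitsAt s A n t y := by
    classical
    refine Subset.antisymm (fun w hw => ?_)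
      (iUnion_subset fun A => iUnion_mono fun n => Γ.waitsAt_mono s (subset_univ _) n t y)
    obtain ⟨n, h1, h2, -, h3⟩ := mem_iUnion.1 hw
    refine mem_iUnion.2 ⟨(Finset.range (n + 1)).image w.1, mem_iUnion.2 ⟨n, h1, h2, fun i hi => ?_, h3⟩⟩
    exact Finset.mem_coe.2 (Finset.mem_image_of_mem _ (Finset.mem_range.2 (Nat.lt_succ_of_le hi)))
  rw [killedProb, h1]
  exact tendsto_measure_iUnion_atTop fun A A' h =>
    iUnion_mono fun n => Γ.waitsAt_mono s (Finset.coe_subset.2 h) n t y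

theorem sum_heatKernel_le_one {s : Speed} (hπ : ∀ x, 0 < Γ.π x) (t : ℝ) (x : V) (F : Finset V) :
    ∑ y ∈ F, Γ.heatKernel s t x y * Γ.θ s y ≤ 1 := by
  rw [← Γ.measure_X_mem hπ]
  exact measureReal_le_one

/-! ### The semigroup -/

theorem killedKernel_symm {s : Speed} (hπ : ∀ x, 0 < Γ.π x) (A : Finset V) {t : ℝ} (ht : 0 ≤ t)
    (x y : V) : Γ.killedKernel s A t x y = Γ.killedKernel s A t y x := by
  obtain ⟨lam, φ, -, -, -, h⟩ := Γ.exists_spectral (s := s) hπ A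
  rw [h t ht, h t ht]
  exact Finset.sum_congr rfl fun i _ => by ring

/-- Orthonormality in `ℓ²(θ)` keeps only the diagonal terms of the product of the two spectral sums.
-/
theorem killedKernel_add {s : Speed} (hπ : ∀ x, 0 < Γ.π x) (A : Finset V) {t r : ℝ} (ht : 0 ≤ t)
    (hr : 0 ≤ r) (x y : V) : Γ.killedKernel s A (t + r) x y =
      ∑ z ∈ A, Γ.killedKernel s A t x z * Γ.killedKernel s A r z y * Γ.θ s z := by
  classical
  obtain ⟨lam, φ, -, ho, -, h⟩ := Γ.exists_spectral (s := s) hπ A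
  simp_rw [h t ht, h r hr, h (t + r) (add_nonneg ht hr), Finset.sum_mul_sum, Finset.sum_mul]
  rw [Finset.sum_comm]
  refine Finset.sum_congr rfl fun i _ => ?_
  rw [Finset.sum_comm]
  have h1 : ∀ j, ∑ z ∈ A, Real.exp (-lam i * t) * φ i x * φ i z *
      (Real.exp (-lam j * r) * φ j z * φ j y) * Γ.θ s z =
      if i = j then Real.exp (-lam i * (t + r)) * φ i x * φ i y else 0 := by
    intro j
    have h2 : ∀ z, Real.exp (-lam i * t) * φ i x * φ i z *
        (Real.exp (-lam j * r) * φ j z * φ j y) * Γ.θ s z = (Real.exp (-lam i * t) *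
        Real.exp (-lam j * r) * φ i x * φ j y) * (φ i z * φ j z * Γ.θ s z) := fun z => by ring
    simp_rw [h2]
    rw [← Finset.mul_sum, ho]
    split_ifs with hij
    · subst hij
      rw [← Real.exp_add]
      ring_nf
    · simp
  simp_rw [h1]
  rw [Finset.sum_ite_eq, if_pos (Finset.mem_univ _)]

theorem mul_exp_neg_le {l t : ℝ} (ht : 0 < t) : l * Real.exp (-l * (t / 2)) ≤ 2 / t := by
  have h1 : l * (t / 2) ≤ Real.exp (l * (t / 2)) :=
    (by linarith : l * (t / 2) ≤ l * (t / 2) + 1).trans (Real.add_one_le_exp _)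
  have h2 : Real.exp (-l * (t / 2)) * Real.exp (l * (t / 2)) = 1 := by
    rw [← Real.exp_add]; simp
  rw [le_div_iff₀ ht]
  nlinarith [mul_le_mul_of_nonneg_left h1 (Real.exp_pos (-l * (t / 2))).le]

/-- Half of the exponent absorbs the eigenvalue: `λ exp (-λ r / 2) ≤ 2 / r`. The other half,
together with `|φ x * φ y| ≤ (φ x ^ 2 + φ y ^ 2) / 2`, sums to the on-diagonal kernels at time `r /
2`. -/
theorem abs_killedKernel_sub_le {s : Speed} (hπ : ∀ x, 0 < Γ.π x) (A : Finset V) {t r : ℝ}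
    (hr : 0 < r) (hrt : r ≤ t) (x y : V) :
    |Γ.killedKernel s A t x y - Γ.killedKernel s A r x y| ≤
      (t - r) / r * (Γ.killedKernel s A (r / 2) x x + Γ.killedKernel s A (r / 2) y y) := by
  obtain ⟨lam, φ, hl, -, -, h⟩ := Γ.exists_spectral (s := s) hπ A
  rw [h t (hr.le.trans hrt), h r hr.le, h (r / 2) (by linarith), h (r / 2) (by linarith),
    ← Finset.sum_sub_distrib, ← Finset.sum_add_distrib, Finset.mul_sum]
  refine (Finset.abs_sum_le_sum_abs _ _).trans (Finset.sum_le_sum fun i _ => ?_)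
  set E := Real.exp (-lam i * (r / 2)) with hE
  have hE0 : 0 < E := Real.exp_pos _
  have hEE : Real.exp (-lam i * r) = E * E := by rw [hE, ← Real.exp_add]; ring_nf
  have ht' : Real.exp (-lam i * t) = E * E * Real.exp (-lam i * (t - r)) := by
    rw [← hEE, ← Real.exp_add]; ring_nf
  have h1 : lam i * E ≤ 2 / r := mul_exp_neg_le hr
  have h2 : 1 - Real.exp (-lam i * (t - r)) ≤ lam i * (t - r) := by
    linarith [Real.add_one_le_exp (-lam i * (t - r))]
  have h3 : Real.exp (-lam i * (t - r)) ≤ 1 := by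
    rw [Real.exp_le_one_iff]
    nlinarith [hl i, mul_nonneg (hl i) (sub_nonneg.2 hrt)]
  have h4 : |φ i x * φ i y| ≤ (φ i x * φ i x + φ i y * φ i y) / 2 := by
    rw [abs_le]; constructor <;> nlinarith [sq_nonneg (φ i x + φ i y), sq_nonneg (φ i x - φ i y)]
  have h5 : E * E * (1 - Real.exp (-lam i * (t - r))) ≤ E * (2 / r * (t - r)) := by
    rw [mul_assoc]
    refine mul_le_mul_of_nonneg_left ?_ hE0.le
    calc E * (1 - Real.exp (-lam i * (t - r))) ≤ E * (lam i * (t - r)) :=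
          mul_le_mul_of_nonneg_left h2 hE0.le
      _ = lam i * E * (t - r) := by ring
      _ ≤ 2 / r * (t - r) := mul_le_mul_of_nonneg_right h1 (sub_nonneg.2 hrt)
  rw [ht', hEE, show E * E * Real.exp (-lam i * (t - r)) * φ i x * φ i y - E * E * φ i x * φ i y =
    -(E * E * (1 - Real.exp (-lam i * (t - r)))) * (φ i x * φ i y) by ring, abs_mul, abs_neg,
    abs_of_nonneg (mul_nonneg (mul_nonneg hE0.le hE0.le) (sub_nonneg.2 h3))]
  calc _ ≤ E * (2 / r * (t - r)) * ((φ i x * φ i x + φ i y * φ i y) / 2) :=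
        mul_le_mul h5 h4 (abs_nonneg _) (mul_nonneg hE0.le
          (mul_nonneg (div_nonneg zero_le_two hr.le) (sub_nonneg.2 hrt)))
    _ = _ := by ring

/-- The argument of `abs_killedKernel_sub_le` with `λ exp (-λ t)` in place of the difference of
exponentials. -/
theorem abs_laplacian_killedKernel_le {s : Speed} (hπ : ∀ x, 0 < Γ.π x) (A : Finset V) {t : ℝ}
    (ht : 0 < t) (x : V) {y : V} (hy : y ∈ A) :
    |(∑ z ∈ A, Γ.ω y z * Γ.killedKernel s A t x z) - Γ.π y * Γ.killedKernel s A t x y| ≤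
      Γ.θ s y * (t⁻¹ * (Γ.killedKernel s A (t / 2) x x + Γ.killedKernel s A (t / 2) y y)) := by
  obtain ⟨lam, φ, hl, -, he, h⟩ := Γ.exists_spectral (s := s) hπ A
  have hθ := Γ.θ_pos (s := s) hπ y
  have h1 : (∑ z ∈ A, Γ.ω y z * Γ.killedKernel s A t x z) - Γ.π y * Γ.killedKernel s A t x y =
      ∑ i, Γ.θ s y * (-lam i * Real.exp (-lam i * t) * (φ i x * φ i y)) := by
    simp_rw [h t ht.le, Finset.mul_sum]
    rw [Finset.sum_comm, ← Finset.sum_sub_distrib]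
    refine Finset.sum_congr rfl fun i _ => ?_
    have h2 : ∑ z ∈ A, Γ.ω y z * (Real.exp (-lam i * t) * φ i x * φ i z) =
        Real.exp (-lam i * t) * φ i x * ∑ z ∈ A, Γ.ω y z * φ i z := by
      rw [Finset.mul_sum]
      exact Finset.sum_congr rfl fun z _ => by ring
    rw [h2]
    linear_combination (Real.exp (-lam i * t) * φ i x) * he i y hy
  rw [h1, h (t / 2) (by linarith), h (t / 2) (by linarith), ← Finset.mul_sum, abs_mul,
    abs_of_pos hθ, ← Finset.sum_add_distrib, Finset.mul_sum]
  refine mul_le_mul_of_nonneg_left ?_ hθ.le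
  refine (Finset.abs_sum_le_sum_abs _ _).trans (Finset.sum_le_sum fun i _ => ?_)
  set E := Real.exp (-lam i * (t / 2)) with hE
  have hE0 : 0 < E := Real.exp_pos _
  have hEE : Real.exp (-lam i * t) = E * E := by rw [hE, ← Real.exp_add]; ring_nf
  have h1 : lam i * E ≤ 2 / t := mul_exp_neg_le ht
  have h4 : |φ i x * φ i y| ≤ (φ i x * φ i x + φ i y * φ i y) / 2 := by
    rw [abs_le]; constructor <;> nlinarith [sq_nonneg (φ i x + φ i y), sq_nonneg (φ i x - φ i y)]
  rw [hEE, abs_mul, neg_mul, abs_neg, ← mul_assoc,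
    abs_of_nonneg (mul_nonneg (mul_nonneg (hl i) hE0.le) hE0.le)]
  calc _ ≤ 2 / t * E * ((φ i x * φ i x + φ i y * φ i y) / 2) :=
        mul_le_mul (mul_le_mul_of_nonneg_right h1 hE0.le) h4 (abs_nonneg _)
          (mul_nonneg (div_nonneg zero_le_two ht.le) hE0.le)
    _ = _ := by ring

theorem heatKernel_symm {s : Speed} (hπ : ∀ x, 0 < Γ.π x) {t : ℝ} (ht : 0 ≤ t) (x y : V) :
    Γ.heatKernel s t x y = Γ.heatKernel s t y x := by
  refine tendsto_nhds_unique (Γ.tendsto_killedKernel hπ t x y) ?_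
  simp_rw [fun A : Finset V => Γ.killedKernel_symm (s := s) hπ A ht x y]
  exact Γ.tendsto_killedKernel hπ t y x

/-- The Chapman-Kolmogorov equation. -/
theorem hasSum_heatKernel_mul {s : Speed} (hπ : ∀ x, 0 < Γ.π x) {t r : ℝ} (ht : 0 ≤ t)
    (hr : 0 ≤ r) (x y : V) :
    HasSum (fun z => Γ.heatKernel s t x z * Γ.heatKernel s r z y * Γ.θ s z)
      (Γ.heatKernel s (t + r) x y) := by
  have h0 : ∀ z, 0 ≤ Γ.heatKernel s t x z * Γ.heatKernel s r z y * Γ.θ s z := fun z =>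
    mul_nonneg (mul_nonneg (Γ.heatKernel_nonneg hπ _ _ _) (Γ.heatKernel_nonneg hπ _ _ _))
      (Γ.θ_pos hπ z).le
  -- The killed semigroup identity gives both halves of the supremum: a finite sum is the limit of
  -- its killed versions, and any upper bound dominates every killed kernel at time `t + r`.
  refine hasSum_of_isLUB_of_nonneg _ h0 ⟨?_, ?_⟩
  · rintro _ ⟨F, rfl⟩
    have h1 : Tendsto (fun A : Finset V => ∑ z ∈ F, Γ.killedKernel s A t x z *
        Γ.killedKernel s A r z y * Γ.θ s z) atTop
        (𝓝 (∑ z ∈ F, Γ.heatKernel s t x z * Γ.heatKernel s r z y * Γ.θ s z)) :=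
      tendsto_finsetSum _ fun z _ => ((Γ.tendsto_killedKernel hπ t x z).mul
        (Γ.tendsto_killedKernel hπ r z y)).mul_const _
    refine le_of_tendsto h1 ?_
    filter_upwards [eventually_ge_atTop F] with A hA
    refine le_trans ?_ (Γ.killedKernel_le_heatKernel hπ A (t + r) x y)
    rw [Γ.killedKernel_add hπ A ht hr]
    exact Finset.sum_le_sum_of_subset_of_nonneg hA fun z _ _ => mul_nonneg (mul_nonneg
      (Γ.killedKernel_nonneg hπ _ _ _ _) (Γ.killedKernel_nonneg hπ _ _ _ _)) (Γ.θ_pos hπ z).le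
  · intro b hb
    refine le_of_tendsto' (Γ.tendsto_killedKernel hπ (t + r) x y) fun A => ?_
    refine le_trans ?_ (hb ⟨A, rfl⟩)
    rw [Γ.killedKernel_add hπ A ht hr]
    refine Finset.sum_le_sum fun z _ => mul_le_mul_of_nonneg_right ?_ (Γ.θ_pos hπ z).le
    exact mul_le_mul (Γ.killedKernel_le_heatKernel hπ _ _ _ _)
      (Γ.killedKernel_le_heatKernel hπ _ _ _ _) (Γ.killedKernel_nonneg hπ _ _ _ _)
      (Γ.heatKernel_nonneg hπ _ _ _)

theorem abs_heatKernel_sub_le {s : Speed} (hπ : ∀ x, 0 < Γ.π x) {t r : ℝ}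
    (hr : 0 < r) (hrt : r ≤ t) (x y : V) :
    |Γ.heatKernel s t x y - Γ.heatKernel s r x y| ≤
      (t - r) / r * (Γ.heatKernel s (r / 2) x x + Γ.heatKernel s (r / 2) y y) :=
  le_of_tendsto_of_tendsto'
    ((Γ.tendsto_killedKernel hπ t x y).sub (Γ.tendsto_killedKernel hπ r x y)).abs
    (((Γ.tendsto_killedKernel hπ (r / 2) x x).add
      (Γ.tendsto_killedKernel hπ (r / 2) y y)).const_mul _)
    fun A => Γ.abs_killedKernel_sub_le hπ A hr hrt x y

theorem abs_laplacian_heatKernel_le {s : Speed} (hπ : ∀ x, 0 < Γ.π x) {t : ℝ}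
    (ht : 0 < t) (x y : V) :
    |Γ.laplacian s (Γ.heatKernel s t x) y| ≤
      t⁻¹ * (Γ.heatKernel s (t / 2) x x + Γ.heatKernel s (t / 2) y y) := by
  classical
  have hθ := Γ.θ_pos (s := s) hπ y
  rw [← mul_le_mul_iff_right₀ hθ]
  nth_rewrite 1 [← abs_of_pos hθ]
  rw [← abs_mul, Γ.θ_mul_laplacian hπ _ y (Γ.nbrs y)
    fun z hz => by rw [Γ.ω_eq_zero_of_notMem_nbrs hz, zero_mul]]
  have h1 : Tendsto (fun A : Finset V => |(∑ z ∈ Γ.nbrs y, Γ.ω y z * Γ.killedKernel s A t x z) -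
      Γ.π y * Γ.killedKernel s A t x y|) atTop (𝓝 |(∑ z ∈ Γ.nbrs y, Γ.ω y z *
        Γ.heatKernel s t x z) - Γ.π y * Γ.heatKernel s t x y|) :=
    ((tendsto_finsetSum _ fun z _ => (Γ.tendsto_killedKernel hπ t x z).const_mul _).sub
      ((Γ.tendsto_killedKernel hπ t x y).const_mul _)).abs
  refine le_of_tendsto_of_tendsto h1 ((((Γ.tendsto_killedKernel hπ (t / 2) x x).add
      (Γ.tendsto_killedKernel hπ (t / 2) y y)).const_mul _).const_mul _) ?_
  -- Once `A` contains `y` and its neighbours, the sum over `A` is the sum over the neighbours.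
  filter_upwards [eventually_ge_atTop (insert y (Γ.nbrs y))] with A hA
  have h2 := Γ.abs_laplacian_killedKernel_le (s := s) hπ A ht x (hA (Finset.mem_insert_self _ _))
  rwa [← Finset.sum_subset ((Finset.subset_insert _ _).trans hA)
    fun z _ hz => by rw [Γ.ω_eq_zero_of_notMem_nbrs hz, zero_mul]] at h2

/-- On the diagonal the spectral coefficients are squares, so every term decreases in time. -/
theorem heatKernel_self_antitone {s : Speed} (hπ : ∀ x, 0 < Γ.π x) {t r : ℝ} (hr : 0 ≤ r)
    (hrt : r ≤ t) (x : V) : Γ.heatKernel s t x x ≤ Γ.heatKernel s r x x := by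
  refine le_of_tendsto_of_tendsto' (Γ.tendsto_killedKernel hπ t x x)
    (Γ.tendsto_killedKernel hπ r x x) fun A => ?_
  obtain ⟨lam, φ, hl, -, -, h⟩ := Γ.exists_spectral (s := s) hπ A
  rw [h t (hr.trans hrt), h r hr]
  refine Finset.sum_le_sum fun i _ => ?_
  rw [mul_assoc, mul_assoc]
  refine mul_le_mul_of_nonneg_right (Real.exp_le_exp.2 ?_) (mul_self_nonneg _)
  nlinarith [hl i]

/-- A supersolution bound: if `v ≥ 0` has finite support and `L v ≥ -b`, then `P_t v ≥ v - b t`. -/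
theorem le_sum_heatKernel_mul {s : Speed} (hπ : ∀ x, 0 < Γ.π x) {v : V → ℝ} (hv : ∀ y, 0 ≤ v y)
    (F : Finset V) (hF : ∀ y ∉ F, v y = 0) {b : ℝ} (hb : 0 ≤ b)
    (hL : ∀ y, -b ≤ Γ.laplacian s v y) {t : ℝ} (ht : 0 ≤ t) (x : V) :
    v x ≤ ∑ y ∈ F, Γ.heatKernel s t x y * Γ.θ s y * v y + b * t := by
  classical
  -- Since `v` vanishes off `A`, the generator applied to `v` at points of `A` only sees values in
  -- `A`, and killing outside `A` creates no boundary term.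
  set A := insert x F with hA
  have hxA : x ∈ A := Finset.mem_insert_self _ _
  have hFA : F ⊆ A := Finset.subset_insert _ _
  have hvA : ∀ y ∉ A, v y = 0 := fun y hy => hF y fun h => hy (hFA h)
  set u : ℝ → V → ℝ := fun r y => (Γ.killedProb s A r x y).toReal with hu
  have hui : ∀ y, IntervalIntegrable (fun r => u r y) volume 0 t := fun y =>
    Γ.intervalIntegrable_killedProb hπ A x y 0 t
  -- Dynkin's formula: the forward equation summed against `v`, with the generator moved onto `v`.
  have h1 : ∑ y ∈ A, u t y * v y = v x +
      ∫ r in (0 : ℝ)..t, ∑ z ∈ A, u r z * Γ.laplacian s v z := by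
    have hI : ∀ y, IntervalIntegrable (fun r => ((∑ z ∈ A, u r z * (Γ.ω z y / Γ.θ s z)) -
        Γ.rate s y * u r y) * v y) volume 0 t := fun y =>
      ((intervalIntegrable_finsetSum _ fun z _ => (hui z).mul_const _).sub
        ((hui y).const_mul _)).mul_const _
    have h2 : ∀ y ∈ A, u t y * v y = (if x = y then v y else 0) +
        ∫ r in (0 : ℝ)..t, ((∑ z ∈ A, u r z * (Γ.ω z y / Γ.θ s z)) - Γ.rate s y * u r y) * v y := by
      intro y hy
      rw [hu]
      simp only
      rw [Γ.toReal_killedProb_forward hπ A hxA ht hy, add_mul, intervalIntegral.integral_mul_const]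
      congr 1
      split_ifs <;> simp
    rw [Finset.sum_congr rfl h2, Finset.sum_add_distrib, Finset.sum_ite_eq, if_pos hxA,
      ← intervalIntegral.integral_finsetSum fun y _ => hI y]
    congr 2
    ext r
    have h3 : ∀ z ∈ A, u r z * Γ.laplacian s v z =
        (∑ y ∈ A, u r z * (Γ.ω z y / Γ.θ s z) * v y) - Γ.rate s z * u r z * v z := by
      intro z _
      have hθ := (Γ.θ_pos (s := s) hπ z).ne'
      have h4 := Γ.θ_mul_laplacian (s := s) hπ v z A fun y hy => by rw [hvA y hy, mul_zero]
      have h5 : Γ.laplacian s v z = ((∑ y ∈ A, Γ.ω z y * v y) - Γ.π z * v z) / Γ.θ s z := by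
        rw [← h4, mul_div_cancel_left₀ _ hθ]
      rw [h5, sub_div, mul_sub, Finset.sum_div, Finset.mul_sum, rate]
      congr 1
      · exact Finset.sum_congr rfl fun y _ => by ring
      · ring
    rw [Finset.sum_congr rfl h3, Finset.sum_sub_distrib, Finset.sum_comm]
    simp_rw [sub_mul, Finset.sum_mul]
    rw [Finset.sum_sub_distrib]
  -- The killed law has mass at most `1`, so the lower bound `-b` survives averaging because `b ≥
  -- 0`.
  have h2 : -(b * t) ≤ ∫ r in (0 : ℝ)..t, ∑ z ∈ A, u r z * Γ.laplacian s v z := by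
    have h3 : -(b * t) = ∫ r in (0 : ℝ)..t, -b := by
      rw [intervalIntegral.integral_const, smul_eq_mul]; ring
    rw [h3]
    refine intervalIntegral.integral_mono_on ht (by simp)
      (intervalIntegrable_finsetSum _ fun z _ => (hui z).mul_const _) fun r _ => ?_
    have h4 : ∑ z ∈ A, u r z * (-b) ≤ ∑ z ∈ A, u r z * Γ.laplacian s v z :=
      Finset.sum_le_sum fun z _ => mul_le_mul_of_nonneg_left (hL z) ENNReal.toReal_nonneg
    rw [← Finset.sum_mul] at h4
    have h5 := Γ.sum_killedProb_le_one (s := s) hπ A r x A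
    refine le_trans ?_ h4
    have h6 : (∑ z ∈ A, u r z) * b ≤ 1 * b := mul_le_mul_of_nonneg_right h5 hb
    linarith
  have h3 : ∑ y ∈ A, u t y * v y ≤ ∑ y ∈ F, Γ.heatKernel s t x y * Γ.θ s y * v y := by
    rw [← Finset.sum_subset hFA fun y _ hy => by rw [hF y hy, mul_zero]]
    refine Finset.sum_le_sum fun y _ => mul_le_mul_of_nonneg_right ?_ (hv y)
    have h4 := Γ.killedKernel_le_heatKernel (s := s) hπ A t x y
    rwa [killedKernel, div_le_iff₀ (Γ.θ_pos hπ y)] at h4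
  linarith

end WeightedGraph

/-! ### Exit times and superharmonic functions. -/

namespace WeightedGraph

variable {V : Type*} (Γ : WeightedGraph V) [MeasurableSpace V] [Countable V]
  [MeasurableSingletonClass V]

theorem exitTime_le_of_notMem (s : Speed) (A : Set V) (w : (ℕ → V) × (ℕ → ℝ)) {t : ℝ} (ht : 0 ≤ t)
    (h : Γ.X s t w ∉ some '' A) : Γ.exitTime s A w ≤ ENNReal.ofReal t :=
  iInf₂_le (⟨t, ht⟩ : ℝ≥0) h |>.trans_eq (ENNReal.ofReal_eq_coe_nnreal ht).symm

open Classical in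
/-- The exit time is at most the sum of the holding times before the exit. -/
theorem exitTime_le_tsum {s : Speed} (hπ : ∀ x, 0 < Γ.π x) (A : Finset V)
    {w : (ℕ → V) × (ℕ → ℝ)} (hw : ∀ i, 0 < w.2 i) :
    Γ.exitTime s A w ≤ ∑' n, ∑ z ∈ A, {Y : ℕ → V | (∀ i ≤ n, Y i ∈ (A : Set V)) ∧ Y n = z}.indicator
      (fun _ => ENNReal.ofReal (Γ.θ s z / Γ.π z)) w.1 * ENNReal.ofReal (w.2 n) := by
  set a : ℕ → ℝ≥0∞ := fun n => ∑ z ∈ A,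
    {Y : ℕ → V | (∀ i ≤ n, Y i ∈ (A : Set V)) ∧ Y n = z}.indicator
      (fun _ => ENNReal.ofReal (Γ.θ s z / Γ.π z)) w.1 * ENNReal.ofReal (w.2 n) with ha
  have hh : ∀ z, 0 < Γ.θ s z / Γ.π z := fun z => div_pos (Γ.θ_pos hπ z) (hπ z)
  have ha' : ∀ n, (∀ i ≤ n, w.1 i ∈ (A : Set V)) →
      a n = ENNReal.ofReal (w.2 n * (Γ.θ s (w.1 n) / Γ.π (w.1 n))) := by
    intro n hn
    rw [ha]
    simp only
    rw [Finset.sum_eq_single (w.1 n)]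
    · rw [indicator_of_mem (show w.1 ∈ {Y : ℕ → V | (∀ i ≤ n, Y i ∈ (A : Set V)) ∧ Y n = w.1 n} from
        ⟨hn, rfl⟩), ← ENNReal.ofReal_mul (hh _).le, mul_comm]
    · intro z _ hz
      rw [indicator_of_notMem (fun h => hz h.2.symm), zero_mul]
    · intro h
      exact absurd (hn n le_rfl) (by simpa using h)
  have hmono := Γ.strictMono_jumpTime (s := s) hπ hw
  have hT0 : ∀ n, 0 ≤ Γ.jumpTime s n w := fun n => by
    have := hmono.monotone (Nat.zero_le n)
    simpa [jumpTime] using this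
  have hT : ∀ n, (∀ i < n, w.1 i ∈ (A : Set V)) →
      ENNReal.ofReal (Γ.jumpTime s n w) = ∑ i ∈ Finset.range n, a i := by
    intro n hn
    rw [jumpTime, ENNReal.ofReal_sum_of_nonneg fun i _ => mul_nonneg (hw i).le (hh _).le]
    refine Finset.sum_congr rfl fun i hi => (ha' i fun j hj => hn j ?_).symm
    exact hj.trans_lt (Finset.mem_range.1 hi)
  by_cases hex : ∃ n, w.1 n ∉ (A : Set V)
  · set N := Nat.find hex with hN
    have hN1 : w.1 N ∉ (A : Set V) := Nat.find_spec hex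
    have hN2 : ∀ i < N, w.1 i ∈ (A : Set V) := fun i hi => not_not.1 (Nat.find_min hex hi)
    refine (Γ.exitTime_le_of_notMem s A w (hT0 N) ?_).trans
      ((hT N hN2).le.trans (ENNReal.sum_le_tsum _))
    have hX : Γ.X s (Γ.jumpTime s N w) w = some (w.1 N) := by
      have h : ∃ n, Γ.jumpTime s n w ≤ Γ.jumpTime s N w ∧
          Γ.jumpTime s N w < Γ.jumpTime s (n + 1) w :=
        ⟨N, le_rfl, hmono (Nat.lt_succ_self N)⟩
      rw [X, dif_pos h]
      have h1 := Nat.find_spec h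
      have h2 := hmono.le_iff_le.1 h1.1
      have h3 := hmono.lt_iff_lt.1 h1.2
      rw [show Nat.find h = N by omega]
    rw [hX]
    rintro ⟨z, hz, hzN⟩
    exact hN1 (Option.some_injective _ hzN ▸ hz)
  · push Not at hex
    by_cases htop : ∑' n, a n = ⊤
    · rw [htop]; exact le_top
    -- The chain never leaves `A`, but the holding times have a finite sum. At that time `X` is
    -- `none`, so the cemetery counts as an exit.
    · rw [← ENNReal.ofReal_toReal htop]
      refine Γ.exitTime_le_of_notMem s A w ENNReal.toReal_nonneg ?_
      have hX : Γ.X s (∑' n, a n).toReal w = none := by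
        rw [X, dif_neg]
        rintro ⟨n, -, h2⟩
        refine absurd h2 (not_lt.2 ?_)
        rw [← ENNReal.ofReal_le_iff_le_toReal htop, hT (n + 1) fun i _ => hex i]
        exact ENNReal.sum_le_tsum _
      rw [hX]
      rintro ⟨z, -, hz⟩
      exact absurd hz (by simp)

/-- The mean exit time from a finite set is bounded by every non-negative function `v` with
`L v ≤ -1` on the set. -/
theorem meanExitTime_le {s : Speed} (hπ : ∀ x, 0 < Γ.π x) (A : Finset V) {v : V → ℝ}
    (hv : ∀ y, 0 ≤ v y) (hL : ∀ y ∈ A, Γ.laplacian s v y ≤ -1) {x : V} (hx : x ∈ A) :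
    Γ.meanExitTime s x A ≤ ENNReal.ofReal (v x) := by
  classical
  set S : ℕ → V → Set (ℕ → V) := fun n z => {Y | (∀ i ≤ n, Y i ∈ (A : Set V)) ∧ Y n = z} with hS
  have hSm : ∀ n z, MeasurableSet (S n z) := fun n z => measurableSet_stay (A : Set V) n z
  set m : ℕ → V → ℝ≥0∞ := fun n z => Γ.chainLaw x (S n z) with hm
  set h : V → ℝ := fun z => Γ.θ s z / Γ.π z with hh
  have hh0 : ∀ z, 0 < h z := fun z => div_pos (Γ.θ_pos hπ z) (hπ z)
  have hterm : ∀ n, ∫⁻ w, ∑ z ∈ A, (S n z).indicator (fun _ => ENNReal.ofReal (h z)) w.1 *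
      ENNReal.ofReal (w.2 n) ∂(Γ.P x) = ∑ z ∈ A, m n z * ENNReal.ofReal (h z) := by
    intro n
    have hmeas : ∀ z, Measurable fun w : (ℕ → V) × (ℕ → ℝ) =>
        (S n z).indicator (fun _ => ENNReal.ofReal (h z)) w.1 * ENNReal.ofReal (w.2 n) := fun z =>
      ((measurable_const.indicator (hSm n z)).comp measurable_fst).mul
        (ENNReal.measurable_ofReal.comp (by fun_prop))
    rw [lintegral_finsetSum _ fun z _ => hmeas z]
    refine Finset.sum_congr rfl fun z _ => ?_
    have he : Measurable fun e : ℕ → ℝ => ENNReal.ofReal (e n) :=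
      ENNReal.measurable_ofReal.comp (measurable_pi_apply n)
    rw [P_eq_prod, lintegral_prod_mul (measurable_const.indicator (hSm n z)).aemeasurable
      he.aemeasurable, lintegral_indicator_const (hSm n z)]
    have h1 : ∫⁻ e, ENNReal.ofReal (e n) ∂clockLaw = 1 := by
      rw [← lintegral_map (f := fun u => ENNReal.ofReal u) ENNReal.measurable_ofReal
        (measurable_pi_apply n), clockLaw_map_eval, lintegral_expMeasure_one]
    rw [show (∫⁻ e : ℕ → ℝ, ENNReal.ofReal (e n) ∂clockLaw) = 1 from h1, mul_one, mul_comm]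
  have hstep : ∀ n, ∀ y ∈ A, m (n + 1) y = ∑ z ∈ A, m n z * ENNReal.ofReal (Γ.ω z y / Γ.π z) := by
    intro n y hy
    have h0 : S (n + 1) y = ⋃ z ∈ A, {Y | (∀ i ≤ n, Y i ∈ (A : Set V)) ∧ Y n = z ∧
        Y (n + 1) = y} := by
      ext Y
      simp only [hS, mem_ofPred_eq, mem_iUnion, exists_prop]
      constructor
      · rintro ⟨h1, h2⟩
        exact ⟨Y n, h1 n (Nat.le_succ n), fun i hi => h1 i (hi.trans (Nat.le_succ n)), rfl, h2⟩
      · rintro ⟨z, hz, h1, h2, h3⟩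
        refine ⟨fun i hi => ?_, h3⟩
        rcases Nat.of_le_succ hi with hi | hi
        · exact h1 i hi
        · rw [hi, h3]; exact hy
    simp only [hm]
    rw [h0, measure_biUnion_finset]
    · refine Finset.sum_congr rfl fun z _ => ?_
      rw [Γ.chainLaw_step x z y n (p := fun Y => ∀ i ≤ n, Y i ∈ (A : Set V)) fun Y Y' hY =>
        forall₂_congr fun i hi => by rw [hY i hi], Γ.jumpLaw_singleton (hπ z)]
    · intro z _ z' _ hzz'
      rw [Function.onFun, Set.disjoint_left]
      rintro Y ⟨-, h1, -⟩ ⟨-, h2, -⟩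
      exact hzz' (h1.symm.trans h2)
    · intro z _
      have : {Y : ℕ → V | (∀ i ≤ n, Y i ∈ (A : Set V)) ∧ Y n = z ∧ Y (n + 1) = y} =
          S n z ∩ (fun Y => Y (n + 1)) ⁻¹' {y} := by
        ext Y; simp [hS, and_assoc]
      rw [this]
      exact (hSm n z).inter (measurable_pi_apply (n + 1) (measurableSet_singleton y))
  -- The mean of `v` at the `n`-th position of the chain, on the event that it has not left `A`. By
  -- `L v ≤ -1` it falls at each step by at least the mean holding time, and the telescoped total is
  -- at most `M 0 = v x`.
  set M : ℕ → ℝ≥0∞ := fun n => ∑ z ∈ A, m n z * ENNReal.ofReal (v z) with hM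
  have hsuper : ∀ z ∈ A, ENNReal.ofReal (h z) +
      ∑ y ∈ A, ENNReal.ofReal (Γ.ω z y / Γ.π z) * ENNReal.ofReal (v y) ≤ ENNReal.ofReal (v z) := by
    intro z hz
    have h1 := Γ.θ_mul_laplacian (s := s) hπ v z (A ∪ Γ.nbrs z) fun y hy => by
      rw [Γ.ω_eq_zero_of_notMem_nbrs fun h => hy (Finset.mem_union_right _ h), zero_mul]
    have h2 : ∑ y ∈ A, Γ.ω z y * v y ≤ ∑ y ∈ A ∪ Γ.nbrs z, Γ.ω z y * v y :=
      Finset.sum_le_sum_of_subset_of_nonneg Finset.subset_union_left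
        fun y _ _ => mul_nonneg (Γ.nonneg z y) (hv y)
    have h3 := mul_le_mul_of_nonneg_left (hL z hz) (Γ.θ_pos (s := s) hπ z).le
    simp_rw [← fun y => ENNReal.ofReal_mul (q := v y) (div_nonneg (Γ.nonneg z y) (hπ z).le)]
    rw [← ENNReal.ofReal_sum_of_nonneg fun y _ =>
      mul_nonneg (div_nonneg (Γ.nonneg z y) (hπ z).le) (hv y),
      ← ENNReal.ofReal_add (hh0 z).le (Finset.sum_nonneg fun y _ =>
      mul_nonneg (div_nonneg (Γ.nonneg z y) (hπ z).le) (hv y))]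
    refine ENNReal.ofReal_le_ofReal ?_
    have h4 : ∑ y ∈ A, Γ.ω z y / Γ.π z * v y = (∑ y ∈ A, Γ.ω z y * v y) / Γ.π z := by
      rw [Finset.sum_div]
      exact Finset.sum_congr rfl fun y _ => by ring
    rw [h4, hh, ← add_div, div_le_iff₀ (hπ z)]
    linarith
  have hrec : ∀ n, (∑ z ∈ A, m n z * ENNReal.ofReal (h z)) + M (n + 1) ≤ M n := by
    intro n
    have h1 : M (n + 1) = ∑ z ∈ A, m n z *
        ∑ y ∈ A, ENNReal.ofReal (Γ.ω z y / Γ.π z) * ENNReal.ofReal (v y) := by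
      simp only [hM]
      rw [Finset.sum_congr rfl fun y hy => by rw [hstep n y hy, Finset.sum_mul], Finset.sum_comm]
      refine Finset.sum_congr rfl fun z _ => ?_
      rw [Finset.mul_sum]
      exact Finset.sum_congr rfl fun y _ => by rw [mul_assoc]
    rw [h1, ← Finset.sum_add_distrib]
    refine Finset.sum_le_sum fun z hz => ?_
    rw [← mul_add]
    exact mul_le_mul_right (hsuper z hz) _
  have hsum : ∀ N, (∑ n ∈ Finset.range N, ∑ z ∈ A, m n z * ENNReal.ofReal (h z)) + M N ≤ M 0 := by
    intro N
    induction N with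
    | zero => simp
    | succ N ih =>
      rw [Finset.sum_range_succ, add_assoc]
      exact (add_le_add_right (hrec N) _).trans ih
  have hM0 : M 0 = ENNReal.ofReal (v x) := by
    have h1 : ∀ z, m 0 z = if z = x then 1 else 0 := by
      intro z
      have h2 : Γ.chainLaw x (S 0 z) = Γ.chainLaw x {_Y | z = x} := by
        refine measure_congr (eventuallyEq_set.2 ?_)
        filter_upwards [Γ.chainLaw_zero x] with Y hY
        simp only [hS, mem_ofPred_eq, Nat.le_zero, forall_eq, hY]
        exact ⟨fun h => h.2.symm, fun h => ⟨hx, h.symm⟩⟩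
      simp only [hm]
      rw [h2]
      split_ifs with hzx <;> simp [hzx]
    simp only [hM, h1, ite_mul, one_mul, zero_mul]
    rw [Finset.sum_ite_eq', if_pos hx]
  calc Γ.meanExitTime s x A
      ≤ ∫⁻ w, ∑' n, ∑ z ∈ A, (S n z).indicator (fun _ => ENNReal.ofReal (h z)) w.1 *
        ENNReal.ofReal (w.2 n) ∂(Γ.P x) := by
        refine lintegral_mono_ae ?_
        filter_upwards [Γ.ae_P_clock_pos x] with w hw
        exact Γ.exitTime_le_tsum hπ A hw
    _ = ∑' n, ∑ z ∈ A, m n z * ENNReal.ofReal (h z) := by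
        rw [lintegral_tsum fun n => ?_]
        · exact tsum_congr hterm
        · exact (Finset.measurable_sum _ fun z _ =>
            ((measurable_const.indicator (hSm n z)).comp measurable_fst).mul
              (ENNReal.measurable_ofReal.comp (by fun_prop))).aemeasurable
    _ ≤ ENNReal.ofReal (v x) := by
        rw [← hM0]
        exact ENNReal.tsum_le_of_sum_range_le fun N => le_self_add.trans (hsum N)

end WeightedGraph

/-! ### Algebra of the Laplacian. -/

namespace WeightedGraph

section Laplacian

variable {V : Type*} (Γ : WeightedGraph V)

theorem laplacian_eq_sum (s : Speed) (f : V → ℝ) (x : V) :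
    Γ.laplacian s f x = (Γ.θ s x)⁻¹ * ∑ y ∈ Γ.nbrs x, (f y - f x) * Γ.ω x y := by
  rw [laplacian, tsum_eq_sum fun y hy => by rw [Γ.ω_eq_zero_of_notMem_nbrs hy, mul_zero]]

theorem laplacian_add (s : Speed) (f g : V → ℝ) (x : V) :
    Γ.laplacian s (fun y => f y + g y) x = Γ.laplacian s f x + Γ.laplacian s g x := by
  simp_rw [laplacian_eq_sum]
  rw [← mul_add, ← Finset.sum_add_distrib]
  congr 1
  exact Finset.sum_congr rfl fun y _ => by ring

theorem laplacian_const_mul (s : Speed) (c : ℝ) (f : V → ℝ) (x : V) :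
    Γ.laplacian s (fun y => c * f y) x = c * Γ.laplacian s f x := by
  simp_rw [laplacian_eq_sum]
  rw [mul_left_comm c, Finset.mul_sum (a := c)]
  congr 1
  exact Finset.sum_congr rfl fun y _ => by ring

theorem laplacian_const (s : Speed) (c : ℝ) (x : V) : Γ.laplacian s (fun _ => c) x = 0 := by
  simp [laplacian_eq_sum]

theorem laplacian_sub (s : Speed) (f g : V → ℝ) (x : V) :
    Γ.laplacian s (fun y => f y - g y) x = Γ.laplacian s f x - Γ.laplacian s g x := by
  have h := Γ.laplacian_add s f (fun y => -1 * g y) x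
  rw [laplacian_const_mul] at h
  simp only [neg_mul, one_mul, ← sub_eq_add_neg] at h
  exact h

theorem laplacian_nonneg_of_min {s : Speed} (hπ : ∀ x, 0 < Γ.π x) {f : V → ℝ} {x : V}
    (h : ∀ y, f x ≤ f y) : 0 ≤ Γ.laplacian s f x := by
  rw [laplacian_eq_sum]
  exact mul_nonneg (inv_nonneg.2 (Γ.θ_pos hπ x).le)
    (Finset.sum_nonneg fun y _ => mul_nonneg (sub_nonneg.2 (h y)) (Γ.nonneg x y))

end Laplacian

end WeightedGraph

/-! ### Geometry of the lattice. -/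

/-- The `ℓ¹` distance on the lattice. -/
def latticeDist {d : ℕ} (x y : Fin d → ℤ) : ℤ := ∑ i, |x i - y i|

namespace IsLattice

open WeightedGraph

variable {d : ℕ} {Γ : WeightedGraph (Fin d → ℤ)} (hΓ : IsLattice Γ)

include hΓ

theorem ω_pos_iff {x y : Fin d → ℤ} : 0 < Γ.ω x y ↔ latticeDist x y = 1 := hΓ x y

theorem adj_iff {x y : Fin d → ℤ} : Γ.graph.Adj x y ↔ latticeDist x y = 1 := by
  rw [WeightedGraph.graph, SimpleGraph.fromRel_adj, hΓ.ω_pos_iff, hΓ.ω_pos_iff]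
  have hs : latticeDist y x = latticeDist x y :=
    Finset.sum_congr rfl fun _ _ => abs_sub_comm _ _
  rw [hs, or_self]
  constructor
  · exact fun h => h.2
  · intro h
    refine ⟨?_, h⟩
    rintro rfl
    simp [latticeDist] at h

theorem connected : Γ.graph.Connected := Γ.connected

end IsLattice

theorem latticeDist_self {d : ℕ} (x : Fin d → ℤ) : latticeDist x x = 0 := by simp [latticeDist]

theorem latticeDist_triangle {d : ℕ} (x y z : Fin d → ℤ) :
    latticeDist x z ≤ latticeDist x y + latticeDist y z := by
  rw [latticeDist, latticeDist, latticeDist, ← Finset.sum_add_distrib]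
  exact Finset.sum_le_sum fun i _ => abs_sub_le _ _ _

theorem latticeDist_comm {d : ℕ} (x y : Fin d → ℤ) : latticeDist x y = latticeDist y x :=
  Finset.sum_congr rfl fun _ _ => abs_sub_comm _ _

theorem latticeDist_nonneg {d : ℕ} (x y : Fin d → ℤ) : 0 ≤ latticeDist x y :=
  Finset.sum_nonneg fun _ _ => abs_nonneg _

theorem abs_sub_le_latticeDist {d : ℕ} (x y : Fin d → ℤ) (i : Fin d) :
    |x i - y i| ≤ latticeDist x y :=
  Finset.single_le_sum (f := fun i => |x i - y i|) (fun _ _ => abs_nonneg _) (Finset.mem_univ i)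

/-- Move one coordinate in which the two points differ by one unit towards its target. -/
theorem exists_latticeDist_step {d : ℕ} {x y : Fin d → ℤ} {n : ℕ}
    (h : latticeDist x y = n + 1) :
    ∃ z, latticeDist x z = 1 ∧ latticeDist z y = n := by
  classical
  obtain ⟨i, hi⟩ : ∃ i, x i ≠ y i := by
    by_contra! hc
    rw [funext hc, latticeDist_self] at h
    omega
  set ε : ℤ := if x i < y i then 1 else -1 with hε
  have h1 : ∀ g : Fin d → ℤ, ∑ j, |Function.update x i (x i + ε) j - g j| =
      |x i + ε - g i| + ∑ j ∈ Finset.univ.erase i, |x j - g j| := by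
    intro g
    rw [← Finset.add_sum_erase _ _ (Finset.mem_univ i)]
    congr 1
    · simp
    · refine Finset.sum_congr rfl fun j hj => ?_
      rw [Function.update_of_ne (Finset.ne_of_mem_erase hj)]
  have h2 : ∀ g : Fin d → ℤ, latticeDist x g =
      |x i - g i| + ∑ j ∈ Finset.univ.erase i, |x j - g j| := by
    intro g
    rw [latticeDist, ← Finset.add_sum_erase _ _ (Finset.mem_univ i)]
  refine ⟨Function.update x i (x i + ε), ?_, ?_⟩
  · rw [latticeDist_comm, latticeDist, h1 x]
    have : |x i + ε - x i| = 1 := by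
      rw [add_sub_cancel_left, hε]
      split_ifs <;> simp
    rw [this, Finset.sum_eq_zero fun j _ => by simp, add_zero]
  · rw [latticeDist, h1 y]
    rw [h2 y] at h
    have : |x i + ε - y i| = |x i - y i| - 1 := by
      rw [hε]
      split_ifs with hlt
      · rw [abs_of_nonpos (by omega), abs_of_nonpos (by omega)]; ring
      · rw [abs_of_nonneg (by omega), abs_of_nonneg (by omega)]; ring
    omega

namespace IsLattice

open WeightedGraph

variable {d : ℕ} {Γ : WeightedGraph (Fin d → ℤ)} (hΓ : IsLattice Γ)

include hΓ

/-- Unit coordinate moves build a path of length equal to the `ℓ¹` distance, and the triangle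
inequality along any walk shows that none is shorter. -/
theorem dist_eq (x y : Fin d → ℤ) : (Γ.graph.dist x y : ℤ) = latticeDist x y := by
  apply le_antisymm
  · have h : ∀ (n : ℕ) (x : Fin d → ℤ), latticeDist x y = n → Γ.graph.dist x y ≤ n := by
      intro n
      induction n with
      | zero =>
        intro x hx
        have : x = y := by
          funext i
          have := abs_sub_le_latticeDist x y i
          rw [hx] at this
          have := abs_nonpos_iff.1 (this.trans_eq (by simp))
          omega
        simp [this]
      | succ n ih =>
        intro x hx
        obtain ⟨z, h1, h2⟩ := exists_latticeDist_step (by simpa using hx)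
        have h3 := hΓ.connected.dist_triangle (u := x) (v := z) (w := y)
        rw [SimpleGraph.dist_eq_one_iff_adj.2 (hΓ.adj_iff.2 h1)] at h3
        have := ih z h2
        omega
    have h2 := latticeDist_nonneg x y
    have := h (latticeDist x y).toNat x (by omega)
    omega
  · have h : ∀ (x : Fin d → ℤ) (p : Γ.graph.Walk x y), latticeDist x y ≤ p.length := by
      intro x p
      induction p with
      | nil => simp [latticeDist_self]
      | @cons a b c hadj p ih =>
        have h1 := hΓ.adj_iff.1 hadj
        rw [SimpleGraph.Walk.length_cons]
        push_cast
        linarith [latticeDist_triangle a b c]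
    obtain ⟨p, hp⟩ := hΓ.connected.exists_walk_length_eq_dist x y
    rw [← hp]
    exact h x p

theorem mem_ball {x y : Fin d → ℤ} {R : ℝ} : y ∈ Γ.ball x R ↔ (latticeDist x y : ℝ) < R := by
  rw [← hΓ.dist_eq]
  simp [WeightedGraph.ball]

theorem mem_ball_trans {x y z : Fin d → ℤ} {R R' : ℝ} (h : y ∈ Γ.ball x R) (h' : z ∈ Γ.ball y R') :
    z ∈ Γ.ball x (R + R') := by
  rw [hΓ.mem_ball] at *
  have : (latticeDist x z : ℝ) ≤ latticeDist x y + latticeDist y z := by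
    exact_mod_cast latticeDist_triangle x y z
  linarith

theorem ball_mono {x : Fin d → ℤ} {R R' : ℝ} (h : R ≤ R') : Γ.ball x R ⊆ Γ.ball x R' :=
  fun _ hy => lt_of_lt_of_le hy h

theorem mem_ball_self {x : Fin d → ℤ} {R : ℝ} (h : 0 < R) : x ∈ Γ.ball x R := by
  rw [hΓ.mem_ball, latticeDist_self]; simpa using h

theorem finite_ball (x : Fin d → ℤ) (R : ℝ) : (Γ.ball x R).Finite := by
  refine (Set.finite_Icc (fun i => x i - ⌈R⌉) (fun i => x i + ⌈R⌉)).subset fun y hy => ?_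
  rw [hΓ.mem_ball] at hy
  have h : ∀ i, |x i - y i| ≤ ⌈R⌉ := by
    intro i
    have h1 := abs_sub_le_latticeDist x y i
    have h2 : latticeDist x y ≤ ⌈R⌉ := by
      exact_mod_cast hy.le.trans (Int.le_ceil R)
    omega
  exact ⟨fun i => by have := abs_le.1 (h i); simp only; omega,
    fun i => by have := abs_le.1 (h i); simp only; omega⟩

theorem ω_single (hd : 0 < d) (x : Fin d → ℤ) :
    0 < Γ.ω x (x + Pi.single ⟨0, hd⟩ 1) := by
  rw [hΓ.ω_pos_iff, latticeDist, Finset.sum_eq_single ⟨0, hd⟩]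
  · simp
  · intro j _ hj
    simp [Pi.single_eq_of_ne hj]
  · simp

theorem π_pos (hd : 0 < d) (x : Fin d → ℤ) : 0 < Γ.π x := by
  refine (hΓ.ω_single hd x).trans_le ?_
  exact (Γ.summable_ω x).le_tsum _ fun z _ => Γ.nonneg x z

theorem withBoundary_ball_subset (x : Fin d → ℤ) (R : ℝ) :
    Γ.withBoundary (Γ.ball x R) ⊆ Γ.ball x (R + 1) := by
  rintro y (hy | ⟨z, hz, hzy⟩)
  · exact hΓ.ball_mono (by linarith) hy
  · rw [hΓ.mem_ball] at *
    have h1 := hΓ.ω_pos_iff.1 hzy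
    have : (latticeDist x y : ℝ) ≤ latticeDist x z + latticeDist z y := by
      exact_mod_cast latticeDist_triangle x z y
    rw [h1] at this
    push_cast at this
    linarith

/-! ### Maximum principle and Dirichlet problem. -/

/-- The maximum principle for `L - l` on a finite subset of the lattice. -/
theorem nonpos_of_laplacian {s : Speed} (hd : 0 < d) (B : Finset (Fin d → ℤ)) {l : ℝ} (hl : 0 ≤ l)
    {u : (Fin d → ℤ) → ℝ} (hL : ∀ x ∈ B, l * u x ≤ Γ.laplacian s u x)
    (hB : ∀ x ∉ B, (∃ z ∈ B, 0 < Γ.ω z x) → u x ≤ 0) : ∀ x ∈ B, u x ≤ 0 := by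
  intro x₁ hx₁
  by_contra! hpos
  obtain ⟨x₂, hx₂, hmax₂⟩ := B.exists_max_image u ⟨x₁, hx₁⟩
  -- Among the maximisers, take one with the largest coordinate `0`. Its neighbour in that direction
  -- has a strictly smaller value: inside `B` it is not a maximiser, outside `B` it is at most `0`.
  -- So `L u < 0` there, and no connectedness of `B` is needed.
  set C := B.filter fun y => u y = u x₂ with hC
  obtain ⟨x, hx, hmax⟩ := C.exists_max_image (fun y => y ⟨0, hd⟩)
    ⟨x₂, Finset.mem_filter.2 ⟨hx₂, rfl⟩⟩
  obtain ⟨hxB, hux⟩ := Finset.mem_filter.1 hx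
  have hux0 : 0 < u x := by rw [hux]; exact hpos.trans_le (hmax₂ x₁ hx₁)
  have hle : ∀ y ∈ Γ.nbrs x, u y ≤ u x := by
    intro y hy
    by_cases hyB : y ∈ B
    · rw [hux]; exact hmax₂ y hyB
    · exact (hB y hyB ⟨x, hxB, Γ.mem_nbrs.1 hy⟩).trans hux0.le
  set y := x + Pi.single ⟨0, hd⟩ 1 with hy
  have hyn : y ∈ Γ.nbrs x := Γ.mem_nbrs.2 (hΓ.ω_single hd x)
  have hlt : u y < u x := by
    refine lt_of_le_of_ne (hle y hyn) fun heq => ?_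
    by_cases hyB : y ∈ B
    · have := hmax y (Finset.mem_filter.2 ⟨hyB, heq.trans hux⟩)
      simp [hy] at this
    · have := hB y hyB ⟨x, hxB, Γ.mem_nbrs.1 hyn⟩
      linarith
  have hneg : Γ.laplacian s u x < 0 := by
    rw [laplacian_eq_sum]
    refine mul_neg_of_pos_of_neg (inv_pos.2 (Γ.θ_pos (hΓ.π_pos hd) x)) ?_
    refine Finset.sum_neg' (fun z hz => ?_) ⟨y, hyn, ?_⟩
    · exact mul_nonpos_of_nonpos_of_nonneg (sub_nonpos.2 (hle z hz)) (Γ.nonneg x z)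
    · exact mul_neg_of_neg_of_pos (sub_neg.2 hlt) (Γ.mem_nbrs.1 hyn)
  have := hL x hxB
  have := mul_nonneg hl hux0.le
  linarith

/-- Solvability of the Dirichlet problem for `L - l` on a finite subset of the lattice. -/
theorem exists_dirichlet (s : Speed) (hd : 0 < d) (B : Finset (Fin d → ℤ)) {l : ℝ} (hl : 0 ≤ l)
    (f g : (Fin d → ℤ) → ℝ) : ∃ u : (Fin d → ℤ) → ℝ,
      (∀ x ∈ B, Γ.laplacian s u x - l * u x = g x) ∧ ∀ x ∉ B, u x = f x := by
  classical
  set E : (B → ℝ) → (Fin d → ℤ) → ℝ := fun w x => if h : x ∈ B then w ⟨x, h⟩ else 0 with hE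
  have hEB : ∀ w (x : B), E w x = w x := fun w x => by simp [hE]
  have hE0 : ∀ w, ∀ x ∉ B, E w x = 0 := fun w x hx => by simp [hE, hx]
  let T : (B → ℝ) →ₗ[ℝ] (B → ℝ) :=
    { toFun := fun w x => Γ.laplacian s (E w) x - l * w x
      map_add' := fun w w' => by
        ext x
        have : E (w + w') = fun y => E w y + E w' y := by
          ext y; simp only [hE]; split_ifs <;> simp
        simp only [this, laplacian_add, Pi.add_apply]
        ring
      map_smul' := fun c w => by
        ext x
        have : E (c • w) = fun y => c * E w y := by
          ext y; simp only [hE]; split_ifs <;> simp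
        simp only [this, laplacian_const_mul, Pi.smul_apply, smul_eq_mul, RingHom.id_apply]
        ring }
  have hTw : ∀ w (x : B), T w x = Γ.laplacian s (E w) x - l * w x := fun w x => rfl
  -- The maximum principle for `±E w` gives uniqueness; in finite dimension uniqueness is existence.
  have hinj : Function.Injective T := by
    rw [injective_iff_map_eq_zero]
    intro w hw
    have h1 : ∀ x (hx : x ∈ B), Γ.laplacian s (E w) x = l * E w x := by
      intro x hx
      have := congrFun hw ⟨x, hx⟩
      rw [hTw, Pi.zero_apply, sub_eq_zero] at this
      rw [show E w x = w ⟨x, hx⟩ from hEB w ⟨x, hx⟩]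
      exact this
    have h2 := hΓ.nonpos_of_laplacian (s := s) hd B hl (u := E w) (fun x hx => (h1 x hx).ge)
      fun x hx _ => (hE0 w x hx).le
    have h3 := hΓ.nonpos_of_laplacian (s := s) hd B hl (u := fun x => -1 * E w x)
      (fun x hx => by rw [laplacian_const_mul, h1 x hx]; linarith)
      fun x hx _ => by simp [hE0 w x hx]
    ext x
    have h4 := h2 x x.2
    have h5 := h3 x x.2
    rw [hEB] at h4 h5
    simp only [Pi.zero_apply]
    linarith
  -- The boundary data, extended by zero into `B`, are moved to the right-hand side.
  obtain ⟨w, hw⟩ := (LinearMap.injective_iff_surjective.1 hinj)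
    fun x => g x - Γ.laplacian s (fun y => if y ∈ B then 0 else f y) x
  refine ⟨fun x => E w x + if x ∈ B then 0 else f x, fun x hx => ?_, fun x hx => ?_⟩
  · have := congrFun hw ⟨x, hx⟩
    rw [hTw, ← hEB w ⟨x, hx⟩] at this
    simp only [laplacian_add, if_pos hx]
    simp only at this
    linarith
  · simp only [hE0 w x hx, if_neg hx, zero_add]

/-- The solution of `L v = -1` on `B` with `v = 0` outside `B`: the mean exit time. -/
theorem exists_exitPotential (s : Speed) (hd : 0 < d) (B : Finset (Fin d → ℤ)) :
    ∃ v : (Fin d → ℤ) → ℝ, (∀ x, 0 ≤ v x) ∧ (∀ x ∈ B, Γ.laplacian s v x = -1) ∧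
      (∀ x ∉ B, v x = 0) ∧ ∀ x, -1 ≤ Γ.laplacian s v x := by
  obtain ⟨v, h1, h2⟩ := hΓ.exists_dirichlet s hd B le_rfl (fun _ => 0) (fun _ => -1)
  have h3 : ∀ x ∈ B, Γ.laplacian s v x = -1 := fun x hx => by simpa using h1 x hx
  have h4 : ∀ x, 0 ≤ v x := by
    intro x
    by_cases hx : x ∈ B
    · have := hΓ.nonpos_of_laplacian (s := s) hd B le_rfl (u := fun x => -1 * v x)
        (fun x hx => by rw [laplacian_const_mul, h3 x hx]; norm_num)
        (fun x hx _ => by simp [h2 x hx]) x hx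
      linarith
    · rw [h2 x hx]
  refine ⟨v, h4, h3, h2, fun x => ?_⟩
  by_cases hx : x ∈ B
  · rw [h3 x hx]
  -- Outside `B` the value `0` is a global minimum of `v`, so `L v ≥ 0` there.
  · have := Γ.laplacian_nonneg_of_min (s := s) (hΓ.π_pos hd) (f := v) (x := x)
      fun y => by rw [h2 x hx]; exact h4 y
    linarith

end IsLattice

/-! ### Exit time estimates and confinement of the walk. -/

/-- Finite balls of the lattice. -/
def IsLattice.ballFinset {d : ℕ} {Γ : WeightedGraph (Fin d → ℤ)} (hΓ : IsLattice Γ)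
    (x : Fin d → ℤ) (R : ℝ) : Finset (Fin d → ℤ) := (hΓ.finite_ball x R).toFinset

/-- The hypotheses hold for base points within `r ^ (1 + δ)` of the origin. For large `r` this
includes every ball of radius `M * r`, the only form used later. -/
theorem exists_forall_mul_le_rpow (M : ℝ) {δ : ℝ} (hδ : 0 < δ) :
    ∃ R ≥ (1 : ℝ), ∀ r ≥ R, M * r ≤ r ^ (1 + δ) := by
  obtain ⟨R, hR⟩ := eventually_atTop.1 ((tendsto_rpow_atTop hδ).eventually_ge_atTop M)
  refine ⟨max R 1, le_max_right _ _, fun r hr => ?_⟩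
  have h0 : 0 < r := zero_lt_one.trans_le ((le_max_right _ _).trans hr)
  rw [Real.rpow_add h0, Real.rpow_one, mul_comm]
  exact mul_le_mul_of_nonneg_left (hR r ((le_max_left _ _).trans hr)) h0.le

namespace IsLattice

open WeightedGraph

variable {d : ℕ} {Γ : WeightedGraph (Fin d → ℤ)} (hΓ : IsLattice Γ)

include hΓ

theorem mem_ballFinset {x y : Fin d → ℤ} {R : ℝ} : y ∈ hΓ.ballFinset x R ↔ y ∈ Γ.ball x R := by
  simp [ballFinset]

theorem coe_ballFinset (x : Fin d → ℤ) (R : ℝ) : (hΓ.ballFinset x R : Set _) = Γ.ball x R := by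
  simp [ballFinset]

theorem mass_ball (m : (Fin d → ℤ) → ℝ) (x : Fin d → ℤ) (R : ℝ) :
    mass m (Γ.ball x R) = ∑ z ∈ hΓ.ballFinset x R, m z := by
  classical
  rw [mass, tsum_eq_sum (s := hΓ.ballFinset x R) fun z hz =>
    indicator_of_notMem (fun h => hz (hΓ.mem_ballFinset.2 h)) _]
  exact Finset.sum_congr rfl fun z hz => indicator_of_mem (hΓ.mem_ballFinset.1 hz) _

/-- The constant `c` is chosen before `M`; only the threshold depends on `M`. Later arguments
enlarge `M` after fixing constants, so this order matters here and in the companion bounds. -/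
theorem heatKernel_le {s : Speed} (h : Γ.HeatKernelUpper s 0 d) :
    ∃ c > (0 : ℝ), ∀ M > (0 : ℝ), ∃ R ≥ (1 : ℝ), ∀ r ≥ R, ∀ x ∈ Γ.ball 0 (M * r),
      ∀ y ∈ Γ.ball 0 (M * r), Γ.heatKernel s (r ^ 2) x y ≤ c / r ^ d := by
  obtain ⟨δ, hδ, c, hc, T, hT, h⟩ := h
  refine ⟨c, hc, fun M _ => ?_⟩
  obtain ⟨R, hR, hRM⟩ := exists_forall_mul_le_rpow M hδ
  refine ⟨max R T, hR.trans (le_max_left _ _), fun r hr x hx y hy => ?_⟩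
  have hr1 : 1 ≤ r := hR.trans ((le_max_left _ _).trans hr)
  have hr0 : 0 < r := zero_lt_one.trans_le hr1
  have hpow : (r ^ 2) ^ ((1 + δ) / 2) = r ^ (1 + δ) := by
    rw [← Real.rpow_natCast, ← Real.rpow_mul hr0.le]
    congr 1
    push_cast
    ring
  have hpow' : (r ^ 2) ^ (-(d : ℝ) / 2) = (r ^ d)⁻¹ := by
    rw [← Real.rpow_natCast, ← Real.rpow_mul hr0.le, ← Real.rpow_natCast r d, ← Real.rpow_neg hr0.le]
    congr 1
    push_cast
    ring
  have hsub := hΓ.ball_mono (x := 0) (hRM r ((le_max_left _ _).trans hr))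
  have h1 := h (r ^ 2) (by nlinarith [(le_max_right R T).trans hr]) x
    (by rw [hpow]; exact hsub hx) y (by rw [hpow]; exact hsub hy)
  rwa [hpow', ← div_eq_mul_inv] at h1

theorem volume_le {s : Speed} (h : Γ.VolumeRegular s 0 d) :
    ∃ C > (0 : ℝ), ∀ M > (0 : ℝ), ∃ R ≥ (1 : ℝ), ∀ r ≥ R, ∀ x ∈ Γ.ball 0 (M * r),
      ∑ z ∈ hΓ.ballFinset x r, Γ.θ s z ≤ C * r ^ d := by
  obtain ⟨δ, hδ, c, hc, C, hC, T, hT, h⟩ := h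
  refine ⟨C, hC, fun M _ => ?_⟩
  obtain ⟨R, hR, hRM⟩ := exists_forall_mul_le_rpow M hδ
  refine ⟨max R T, hR.trans (le_max_left _ _), fun r hr x hx => ?_⟩
  rw [← hΓ.mass_ball]
  exact (h r ((le_max_right _ _).trans hr)).2 x
    (hΓ.ball_mono (hRM r ((le_max_left _ _).trans hr)) hx)

theorem chemLength_le {x y : Fin d → ℤ} (p : Γ.graph.Walk x y) : Γ.chemLength p ≤ p.length := by
  rw [chemLength, ← SimpleGraph.Walk.length_darts]
  have h := List.sum_le_card_nsmul
    (p.darts.map fun e => min 1 (Γ.ω e.fst e.snd ^ (-(1 / 2) : ℝ))) 1 fun a ha => by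
      obtain ⟨e, -, rfl⟩ := List.mem_map.1 ha
      exact min_le_left _ _
  simpa using h

theorem chemDist_le (x y : Fin d → ℤ) : Γ.chemDist x y ≤ Γ.graph.dist x y := by
  obtain ⟨p, hp⟩ := hΓ.connected.exists_walk_length_eq_dist x y
  rw [← hp]
  refine (ciInf_le ⟨0, ?_⟩ p).trans (hΓ.chemLength_le p)
  rintro _ ⟨q, rfl⟩
  refine List.sum_nonneg fun a ha => ?_
  obtain ⟨e, -, rfl⟩ := List.mem_map.1 ha
  exact le_min zero_le_one (Real.rpow_nonneg (Γ.nonneg _ _) _)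

/-- Lower bound for mean exit times from balls of the graph distance, in terms of the Dirichlet
problem. -/
theorem le_exitPotential {s : Speed} (hd : 0 < d) (h : Γ.ExitTimeLower 0 s)
    (hN : Γ.NonDegenerate 0 s) :
    ∃ c > (0 : ℝ), ∀ M > (0 : ℝ), ∃ R ≥ (1 : ℝ), ∀ r ≥ R, ∀ x ∈ Γ.ball 0 (M * r),
      ∀ v : (Fin d → ℤ) → ℝ, (∀ y, 0 ≤ v y) → (∀ y ∈ Γ.ball x r, Γ.laplacian s v y ≤ -1) →
        c * r ^ 2 ≤ v x := by
  cases s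
  · obtain ⟨δ, hδ, c, hc, T, hT, h⟩ := h
    refine ⟨c, hc, fun M _ => ?_⟩
    obtain ⟨R, hR, hRM⟩ := exists_forall_mul_le_rpow M hδ
    refine ⟨max R T, hR.trans (le_max_left _ _), fun r hr x hx v hv hL => ?_⟩
    have hr0 : 0 < r := zero_lt_one.trans_le (hR.trans ((le_max_left _ _).trans hr))
    have h1 := h r ((le_max_right _ _).trans hr) x
      (hΓ.ball_mono (hRM r ((le_max_left _ _).trans hr)) hx)
    rw [← hΓ.coe_ballFinset x r] at h1
    have h2 := h1.trans (Γ.meanExitTime_le (hΓ.π_pos hd) (hΓ.ballFinset x r) hv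
      (fun y hy => hL y (hΓ.mem_ballFinset.1 hy)) (hΓ.mem_ballFinset.2 (hΓ.mem_ball_self hr0)))
    exact (ENNReal.ofReal_le_ofReal_iff (hv x)).1 h2
  · obtain ⟨δ, hδ, c, hc, T, hT, h⟩ := h
    obtain ⟨δ', hδ', c', hc', T', hT', hN⟩ := hN
    -- Chosen so that the `d̃`-ball of radius `q = r / K` lies in the graph ball of radius `r`. A
    -- point at graph distance at least `q` satisfies the comparison with constant `c'`; a nearer
    -- one is covered by `K ≥ 1`.
    set K : ℝ := max c'⁻¹ 1 with hK
    have hK1 : 1 ≤ K := le_max_right _ _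
    have hK0 : 0 < K := zero_lt_one.trans_le hK1
    refine ⟨c / K ^ 2, by positivity, fun M _ => ?_⟩
    obtain ⟨R, hR, hRM⟩ := exists_forall_mul_le_rpow (M * K) hδ
    obtain ⟨R', hR', hRM'⟩ := exists_forall_mul_le_rpow (M * K) hδ'
    set R₀ := max (max R R') (max T T') with hR₀
    have hR₀1 : 1 ≤ R₀ := hR.trans ((le_max_left _ _).trans (le_max_left _ _))
    refine ⟨K * R₀, by nlinarith, fun r hr x hx v hv hL => ?_⟩
    set q := r / K with hq
    have hqr : r = K * q := by rw [hq]; field_simp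
    have hqR : R₀ ≤ q := by rw [hq, le_div_iff₀ hK0, mul_comm]; exact hr
    have hq0 : 0 < q := by linarith
    have hxM : x ∈ Γ.ball 0 (M * K * q) := by rwa [hqr, ← mul_assoc] at hx
    have hx1 : x ∈ Γ.chemBall 0 (q ^ (1 + δ)) := by
      refine lt_of_le_of_lt (hΓ.chemDist_le 0 x) ?_
      exact hΓ.ball_mono (hRM q (((le_max_left _ _).trans (le_max_left _ _)).trans hqR)) hxM
    have hx2 : x ∈ Γ.ball 0 (q ^ (1 + δ')) :=
      hΓ.ball_mono (hRM' q (((le_max_right _ _).trans (le_max_left _ _)).trans hqR)) hxM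
    have hsub : Γ.chemBall x q ⊆ Γ.ball x r := by
      intro y hy
      change (Γ.graph.dist x y : ℝ) < r
      have hy' : Γ.chemDist x y < q := hy
      by_cases hxy : q ≤ Γ.graph.dist x y
      · have h1 := hN q (((le_max_right _ _).trans (le_max_right _ _)).trans hqR) x hx2 y hxy
        have h2 : (Γ.graph.dist x y : ℝ) < c'⁻¹ * q := by
          rw [inv_mul_eq_div, lt_div_iff₀ hc']
          linarith
        rw [hqr]
        exact h2.trans_le (mul_le_mul_of_nonneg_right (le_max_left _ _) hq0.le)
      · push Not at hxy
        rw [hqr]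
        nlinarith
    have hfin : (Γ.chemBall x q).Finite := (hΓ.finite_ball x r).subset hsub
    have h1 := h q (((le_max_left _ _).trans (le_max_right _ _)).trans hqR) x hx1
    rw [← hfin.coe_toFinset] at h1
    have h2 := h1.trans (Γ.meanExitTime_le (hΓ.π_pos hd) hfin.toFinset hv
      (fun y hy => hL y (hsub (hfin.mem_toFinset.1 hy))) (hfin.mem_toFinset.2 (by
        refine lt_of_le_of_lt (hΓ.chemDist_le x x) ?_
        simpa using hq0)))
    have h3 := (ENNReal.ofReal_le_ofReal_iff (hv x)).1 h2
    calc c / K ^ 2 * r ^ 2 = c * q ^ 2 := by rw [hq]; ring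
      _ ≤ v x := h3

/-- Upper bound for mean exit times from balls. -/
theorem exitPotential_le {s : Speed} (hd : 0 < d) (hU : Γ.HeatKernelUpper s 0 d)
    (hV : Γ.VolumeRegular s 0 d) :
    ∃ C > (0 : ℝ), ∀ M > (0 : ℝ), ∃ R ≥ (1 : ℝ), ∀ r ≥ R, ∀ x ∈ Γ.ball 0 (M * r),
      ∀ v : (Fin d → ℤ) → ℝ, (∀ y, 0 ≤ v y) → (∀ y, -1 ≤ Γ.laplacian s v y) →
        (∀ y ∉ Γ.ball x r, v y = 0) → ∀ y, v y ≤ C * r ^ 2 := by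
  have hπ := hΓ.π_pos hd
  obtain ⟨c, hc, hU⟩ := hΓ.heatKernel_le hU
  obtain ⟨C, hC, hV⟩ := hΓ.volume_le hV
  -- At time `(K * r) ^ 2` the walk is in the ball with probability at most `c * C / K ^ d ≤ 1 / 2`.
  -- At a maximum point of `v` the supersolution bound reads `v ≤ v / 2 + (K * r) ^ 2`.
  set K : ℝ := max 1 (2 * c * C) with hK
  have hK1 : 1 ≤ K := le_max_left _ _
  have hK0 : 0 < K := zero_lt_one.trans_le hK1
  refine ⟨2 * K ^ 2, by positivity, fun M hM => ?_⟩
  obtain ⟨R, hR, hU⟩ := hU (M + 1) (by linarith)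
  obtain ⟨R', hR', hV⟩ := hV M hM
  refine ⟨max R R', hR.trans (le_max_left _ _), fun r hr x hx v hv hL hv0 => ?_⟩
  have hr1 : 1 ≤ r := hR.trans ((le_max_left _ _).trans hr)
  have hr0 : 0 < r := by linarith
  set F := hΓ.ballFinset x r with hF
  have hvF : ∀ y ∉ F, v y = 0 := fun y hy => hv0 y fun h => hy (hΓ.mem_ballFinset.2 h)
  have hball : ∀ y ∈ F, y ∈ Γ.ball 0 ((M + 1) * (K * r)) := by
    intro y hy
    refine hΓ.ball_mono ?_ (hΓ.mem_ball_trans hx (hΓ.mem_ballFinset.1 hy))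
    nlinarith [mul_nonneg (by linarith : 0 ≤ M + 1) (mul_nonneg (sub_nonneg.2 hK1) hr0.le)]
  obtain ⟨y, hy, hmax⟩ := F.exists_max_image v ⟨x, hΓ.mem_ballFinset.2 (hΓ.mem_ball_self hr0)⟩
  have hmax' : ∀ z, v z ≤ v y := by
    intro z
    by_cases hz : z ∈ F
    · exact hmax z hz
    · rw [hvF z hz]; exact hv y
  refine fun z => (hmax' z).trans ?_
  have h1 := Γ.le_sum_heatKernel_mul hπ hv F hvF zero_le_one hL (t := (K * r) ^ 2) (by positivity) y
  have h2 : ∑ z ∈ F, Γ.heatKernel s ((K * r) ^ 2) y z * Γ.θ s z * v z ≤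
      ∑ z ∈ F, c / (K * r) ^ d * Γ.θ s z * v y := by
    refine Finset.sum_le_sum fun z hz => ?_
    have hθ := (Γ.θ_pos (s := s) hπ z).le
    refine mul_le_mul (mul_le_mul_of_nonneg_right ?_ hθ) (hmax' z) (hv z) (by positivity)
    exact hU (K * r) (((le_max_left _ _).trans hr).trans (by nlinarith)) y (hball y hy) z (hball z hz)
  rw [← Finset.sum_mul, ← Finset.mul_sum] at h2
  have h3 : c / (K * r) ^ d * ∑ z ∈ F, Γ.θ s z ≤ 1 / 2 := by
    have h4 := hV r ((le_max_right _ _).trans hr) x hx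
    have hKd : 2 * c * C ≤ K ^ d := by
      refine (le_max_right 1 _).trans ?_
      exact le_self_pow₀ hK1 hd.ne'
    calc c / (K * r) ^ d * ∑ z ∈ F, Γ.θ s z ≤ c / (K * r) ^ d * (C * r ^ d) :=
          mul_le_mul_of_nonneg_left h4 (by positivity)
      _ = c * C / K ^ d := by rw [mul_pow]; field_simp
      _ ≤ 1 / 2 := by rw [div_le_div_iff₀ (by positivity) two_pos]; linarith
  have h5 := mul_le_mul_of_nonneg_right h3 (hv y)
  nlinarith

/-- In a time of order `r ^ 2` the walk does not leave a ball of radius `η r` with high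
probability. -/
theorem le_sum_heatKernel_ball {s : Speed} (hd : 0 < d) (hA : Γ.StandingAssumption s 0 d)
    {ε η M : ℝ} (hε : 0 < ε) (hη : 0 < η) (hM : 0 < M) :
    ∃ s₀ > (0 : ℝ), ∃ R ≥ (1 : ℝ), ∀ r ≥ R, ∀ y ∈ Γ.ball 0 (M * r), ∀ t, 0 ≤ t → t ≤ s₀ * r ^ 2 →
      1 - ε ≤ ∑ z ∈ hΓ.ballFinset y (η * r), Γ.heatKernel s t y z * Γ.θ s z := by
  have hπ := hΓ.π_pos hd
  obtain ⟨c₀, hc₀, hlow⟩ := hΓ.le_exitPotential hd hA.exitTimeLower hA.nonDegenerate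
  obtain ⟨C, hC, hup⟩ := hΓ.exitPotential_le hd hA.heatKernelUpper hA.volumeRegular
  -- The minimum with `C` ensures `0 ≤ q`.
  set c := min c₀ C with hc
  have hc0 : 0 < c := lt_min hc₀ hC
  set q := 1 - c / (2 * C) with hq
  have hq0 : 0 ≤ q := by
    have : c / (2 * C) ≤ 1 := by
      rw [div_le_one (by positivity)]
      linarith [min_le_right c₀ C]
    linarith
  have hq1 : q < 1 := by
    have : 0 < c / (2 * C) := by positivity
    linarith
  obtain ⟨K, hK⟩ := exists_pow_lt_of_lt_one (half_pos hε) hq1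
  -- With `ρ = η * r / L`, after `K` shrinkings by `2 * ρ` a ball of radius `2 * ρ` about `y`
  -- remains.
  set L : ℝ := 2 * (K + 1) with hL
  have hL0 : 0 < L := by positivity
  obtain ⟨R, hR, hlow⟩ := hlow ((M + η) * L / η) (by positivity)
  obtain ⟨R', hR', hup⟩ := hup ((M + η) * L / η) (by positivity)
  -- This value of `s₀` makes `l * (s₀ * r ^ 2)` exactly `ε / 2`.
  refine ⟨ε * C * η ^ 2 / (2 * L ^ 2), by positivity, max 1 (L / η * max R R'), le_max_left _ _,
    fun r hr y hy t ht ht' => ?_⟩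
  have hr0 : 0 < r := zero_lt_one.trans_le ((le_max_left _ _).trans hr)
  set ρ := η * r / L with hρ
  have hρR : max R R' ≤ ρ := by
    rw [hρ, le_div_iff₀ hL0]
    have := (le_max_right _ _).trans hr
    rw [div_mul_eq_mul_div, div_le_iff₀ hη] at this
    linarith
  have hρ1 : 1 ≤ ρ := hR.trans ((le_max_left _ _).trans hρR)
  have hρ0 : 0 < ρ := by linarith
  have hρL : ρ * L = η * r := by rw [hρ]; field_simp
  set A := hΓ.ballFinset y (η * r) with hAdef
  set l := (C * ρ ^ 2)⁻¹ with hl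
  have hl0 : 0 < l := by positivity
  -- `φ` plays the role of the Laplace transform of the exit time from `A` at parameter `l`;
  -- smallness of `φ y` expresses that a quick exit is unlikely.
  obtain ⟨φ, hφ1, hφ2⟩ := hΓ.exists_dirichlet s hd A hl0.le (fun _ => 1) (fun _ => 0)
  have hφL : ∀ x ∈ A, Γ.laplacian s φ x = l * φ x := fun x hx => by linarith [hφ1 x hx]
  have hφnn : ∀ x, 0 ≤ φ x := by
    intro x
    by_cases hx : x ∈ A
    · have := hΓ.nonpos_of_laplacian (s := s) hd A hl0.le (u := fun x => -1 * φ x)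
        (fun x hx => by rw [laplacian_const_mul, hφL x hx]; linarith)
        (fun x hx _ => by rw [hφ2 x hx]; norm_num) x hx
      linarith
    · rw [hφ2 x hx]; exact zero_le_one
  have hφle : ∀ x, φ x ≤ 1 := by
    intro x
    by_cases hx : x ∈ A
    · have := hΓ.nonpos_of_laplacian (s := s) hd A hl0.le (u := fun x => φ x - 1)
        (fun x hx => by
          rw [laplacian_sub, laplacian_const, hφL x hx]
          linarith)
        (fun x hx _ => by rw [hφ2 x hx]; norm_num) x hx
      linarith
    · rw [hφ2 x hx]
  -- Every layer of width `2 * ρ` between a point and the complement of `A` costs a factor `q`.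
  have hstep : ∀ k : ℕ, ∀ x ∈ Γ.ball y (η * r - k * (2 * ρ)), φ x ≤ q ^ k := by
    intro k
    induction k with
    | zero => intro x _; simpa using hφle x
    | succ k ih =>
      intro x hx
      -- The extra `1` includes the neighbours of the ball of radius `ρ`; it fits because `ρ ≥ 1`.
      have hsub : Γ.ball x (ρ + 1) ⊆ Γ.ball y (η * r - k * (2 * ρ)) := by
        intro z hz
        refine hΓ.ball_mono ?_ (hΓ.mem_ball_trans hx hz)
        push_cast
        linarith
      have hsubA : Γ.ball y (η * r - k * (2 * ρ)) ⊆ Γ.ball y (η * r) := by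
        refine hΓ.ball_mono ?_
        have : 0 ≤ (k : ℝ) * (2 * ρ) := by positivity
        linarith
      have hx0 : x ∈ Γ.ball 0 ((M + η) * L / η * ρ) := by
        have h1 : x ∈ Γ.ball y (η * r) := hsubA (hsub (hΓ.mem_ball_self (by linarith)))
        refine hΓ.ball_mono ?_ (hΓ.mem_ball_trans hy h1)
        rw [hρ]
        apply le_of_eq
        field_simp
      set B := hΓ.ballFinset x ρ with hB
      obtain ⟨v, hv0, hvL, hvB, hvL'⟩ := hΓ.exists_exitPotential s hd B
      have hvup : ∀ z, v z ≤ C * ρ ^ 2 := hup ρ ((le_max_right _ _).trans hρR) x hx0 v hv0 hvL'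
        fun z hz => hvB z fun h => hz (hΓ.mem_ballFinset.1 h)
      have hvlow : c * ρ ^ 2 ≤ v x := by
        refine le_trans (mul_le_mul_of_nonneg_right (min_le_left _ _) (by positivity)) ?_
        exact hlow ρ ((le_max_left _ _).trans hρR) x hx0 v hv0
          fun z hz => (hvL z (hΓ.mem_ballFinset.2 hz)).le
      have hqk : 0 ≤ q ^ k := pow_nonneg hq0 k
      have hlv : ∀ z, l * v z ≤ 1 := fun z => by
        rw [hl, inv_mul_le_iff₀ (by positivity), mul_one]
        exact hvup z
      -- The barrier `q ^ k * (1 - l / 2 * v)` equals `q ^ k` off `B`. Applying `L - l` to the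
      -- difference gives `q ^ k * l / 2 * (1 - l * v) ≥ 0`. At the centre `l * v x ≥ c / C`, which
      -- produces the factor `q`.
      have hmain := hΓ.nonpos_of_laplacian (s := s) hd B hl0.le
        (u := fun z => φ z - q ^ k * (1 - l / 2 * v z)) (fun z hz => ?_) (fun z hz hz' => ?_) x
        (hΓ.mem_ballFinset.2 (hΓ.mem_ball_self hρ0))
      · have h1 : φ x ≤ q ^ k * (1 - l / 2 * v x) := by linarith
        refine h1.trans ?_
        rw [pow_succ]
        refine mul_le_mul_of_nonneg_left ?_ hqk
        have h2 : l * (c * ρ ^ 2) ≤ l * v x := mul_le_mul_of_nonneg_left hvlow hl0.le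
        have h3 : l * (c * ρ ^ 2) = c / C := by rw [hl]; field_simp
        have h4 : c / (2 * C) = c / C / 2 := by field_simp
        rw [hq, h4]
        linarith
      · rw [laplacian_sub, laplacian_const_mul, laplacian_sub, laplacian_const,
          laplacian_const_mul, hvL z hz, hφL z (hΓ.mem_ballFinset.2 (hsubA (hsub
            (hΓ.ball_mono (by linarith) (hΓ.mem_ballFinset.1 hz)))))]
        have h1 : 0 ≤ q ^ k * l * (1 - l * v z) := mul_nonneg (mul_nonneg hqk hl0.le) (by linarith [hlv z])
        nlinarith
      · rw [hvB z hz]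
        obtain ⟨z', hz', hzz'⟩ := hz'
        have := ih z (hsub (hΓ.withBoundary_ball_subset x ρ
          (Or.inr ⟨z', hΓ.mem_ballFinset.1 hz', hzz'⟩)))
        linarith
  have hφy : φ y ≤ ε / 2 := by
    refine (hstep K y (hΓ.mem_ball_self ?_)).trans hK.le
    rw [← hρL, hL]
    linarith
  -- The function `1 - φ` is supported in `A`, is at most `1`, and satisfies `L (1 - φ) ≥ -l`. So
  -- `P_t (1 - φ)` bounds the probability of being in `A` from below.
  have h1 := Γ.le_sum_heatKernel_mul (s := s) hπ (v := fun x => 1 - φ x)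
    (fun x => sub_nonneg.2 (hφle x)) A (fun x hx => by rw [hφ2 x hx, sub_self]) hl0.le
    (fun x => ?_) ht y
  · have h2 : ∑ z ∈ A, Γ.heatKernel s t y z * Γ.θ s z * (1 - φ z) ≤
        ∑ z ∈ A, Γ.heatKernel s t y z * Γ.θ s z := by
      refine Finset.sum_le_sum fun z _ => ?_
      have := mul_nonneg (Γ.heatKernel_nonneg (s := s) hπ t y z) (Γ.θ_pos (s := s) hπ z).le
      nlinarith [hφnn z]
    have h3 : l * t ≤ ε / 2 := by
      have h4 : l * t ≤ l * (ε * C * η ^ 2 / (2 * L ^ 2) * r ^ 2) :=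
        mul_le_mul_of_nonneg_left ht' hl0.le
      refine h4.trans (le_of_eq ?_)
      rw [hl, hρ]
      field_simp
    linarith
  · by_cases hx : x ∈ A
    · rw [laplacian_sub, laplacian_const, hφL x hx]
      nlinarith [hφle x]
    · have := Γ.laplacian_nonneg_of_min (s := s) hπ (f := fun x => 1 - φ x) (x := x) fun z => by
        rw [hφ2 x hx, sub_self]
        exact sub_nonneg.2 (hφle z)
      linarith

end IsLattice

/-! ### Oscillation of harmonic functions and regularity at the origin. -/

namespace IsLattice

open WeightedGraph

variable {d : ℕ} {Γ : WeightedGraph (Fin d → ℤ)} (hΓ : IsLattice Γ)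

include hΓ

/-- Reduction of the oscillation of a harmonic function, from the elliptic Harnack inequality. -/
theorem exists_oscillation_step {s : Speed} (hE : Γ.EllipticHarnack s 0) :
    ∃ γ > (0 : ℝ), γ < 1 ∧ ∃ R ≥ (1 : ℝ), ∀ ρ ≥ R, ∀ (h : (Fin d → ℤ) → ℝ) (a b : ℝ),
      (∀ x ∈ Γ.ball 0 ρ, a ≤ h x ∧ h x ≤ b) → Γ.HarmonicOn s h (Γ.ball 0 (ρ / 2)) →
        ∃ a' b', b' - a' ≤ (1 - γ) * (b - a) ∧ ∀ x ∈ Γ.ball 0 (ρ / 4), a' ≤ h x ∧ h x ≤ b' := by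
  obtain ⟨C₀, hC₀, R, hR, hE⟩ := hE
  set C := max C₀ 1 with hC
  have hC1 : 1 ≤ C := le_max_right _ _
  refine ⟨1 / (2 * C), by positivity, ?_, 2 * R, by linarith, fun ρ hρ h a b hab hharm => ?_⟩
  · rw [div_lt_one (by linarith)]; linarith
  have hρ0 : 0 < ρ := by linarith
  have h0 : (0 : Fin d → ℤ) ∈ Γ.ball 0 (ρ / 4) := hΓ.mem_ball_self (by linarith)
  have hsub : Γ.ball 0 (ρ / 4) ⊆ Γ.ball 0 ρ := hΓ.ball_mono (by linarith)
  have hbd : Γ.withBoundary (Γ.ball 0 (ρ / 2)) ⊆ Γ.ball 0 ρ :=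
    (hΓ.withBoundary_ball_subset _ _).trans (hΓ.ball_mono (by linarith))
  have key : ∀ g : (Fin d → ℤ) → ℝ, (∀ x ∈ Γ.ball 0 ρ, 0 ≤ g x) →
      Γ.HarmonicOn s g (Γ.ball 0 (ρ / 2)) → ∀ x ∈ Γ.ball 0 (ρ / 4), g 0 / C ≤ g x := by
    intro g hg hgh x hx
    rw [div_le_iff₀ (by linarith)]
    -- The Harnack hypothesis requires strict positivity, so a small constant is added and then
    -- removed.
    refine le_of_forall_pos_le_add fun ε hε => ?_
    have h1 := hE (ρ / 2) (by linarith) (fun y => g y + ε / C₀)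
      (fun y hy => add_pos_of_nonneg_of_pos (hg y (hbd hy)) (by positivity))
      (fun y hy => by rw [laplacian_add, laplacian_const, hgh y hy, add_zero])
      0 (by rwa [div_div, show (2 : ℝ) * 2 = 4 by norm_num])
      x (by rwa [div_div, show (2 : ℝ) * 2 = 4 by norm_num])
    have h2 : C₀ * (g x + ε / C₀) = C₀ * g x + ε := by field_simp
    have h3 : 0 < ε / C₀ := by positivity
    have h4 : C₀ * g x ≤ g x * C := by
      rw [mul_comm (g x)]
      exact mul_le_mul_of_nonneg_right (le_max_left _ _) (hg x (hsub hx))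
    linarith
  have hgam : (1 - 1 / (2 * C)) * (b - a) = (b - a) - (b - a) / (2 * C) := by ring
  -- If `h 0` is in the upper half of `[a, b]`, Harnack for `h - a` raises the lower bound by `(b -
  -- a) / (2 * C)`. Otherwise Harnack for `b - h` lowers the upper bound.
  rcases le_total ((a + b) / 2) (h 0) with hmid | hmid
  · have h1 := key (fun x => h x - a) (fun x hx => sub_nonneg.2 (hab x hx).1)
      (fun x hx => by rw [laplacian_sub, laplacian_const, hharm x hx, sub_zero])
    refine ⟨a + (b - a) / (2 * C), b, by rw [hgam]; linarith, fun x hx => ⟨?_, (hab x (hsub hx)).2⟩⟩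
    have h2 := h1 x hx
    have h3 : (b - a) / (2 * C) ≤ (h 0 - a) / C := by
      rw [← div_div]
      exact div_le_div_of_nonneg_right (by linarith) (by linarith)
    linarith
  · have h1 := key (fun x => b - h x) (fun x hx => sub_nonneg.2 (hab x hx).2)
      (fun x hx => by rw [laplacian_sub, laplacian_const, hharm x hx, sub_zero])
    refine ⟨a, b - (b - a) / (2 * C), by rw [hgam]; linarith, fun x hx => ⟨(hab x (hsub hx)).1, ?_⟩⟩
    have h2 := h1 x hx
    have h3 : (b - a) / (2 * C) ≤ (b - h 0) / C := by
      rw [← div_div]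
      exact div_le_div_of_nonneg_right (by linarith) (by linarith)
    linarith

/-- Iteration over the concentric radii `ρ, ρ / 4, ...`. All balls are centred at `0`, the only
centre for which the Harnack inequality is available; `R * 4 ^ k ≤ ρ` keeps each of them large
enough. -/
theorem exists_oscillation {s : Speed} (hE : Γ.EllipticHarnack s 0) :
    ∃ γ > (0 : ℝ), γ < 1 ∧ ∃ R ≥ (1 : ℝ), ∀ (k : ℕ) (ρ : ℝ), R * 4 ^ k ≤ ρ →
      ∀ (h : (Fin d → ℤ) → ℝ) (a b : ℝ), (∀ x ∈ Γ.ball 0 ρ, a ≤ h x ∧ h x ≤ b) →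
        Γ.HarmonicOn s h (Γ.ball 0 ρ) →
          ∀ x ∈ Γ.ball 0 (ρ / 4 ^ k), |h x - h 0| ≤ (1 - γ) ^ k * (b - a) := by
  obtain ⟨γ, hγ0, hγ1, R, hR, hstep⟩ := hΓ.exists_oscillation_step hE
  refine ⟨γ, hγ0, hγ1, R, hR, fun k => ?_⟩
  induction k with
  | zero =>
    intro ρ hρ h a b hab _ x hx
    simp only [pow_zero, div_one, mul_one, one_mul] at hx hρ ⊢
    have h1 := hab x hx
    have h2 := hab 0 (hΓ.mem_ball_self (by linarith))
    rw [abs_le]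
    constructor <;> linarith
  | succ k ih =>
    intro ρ hρ h a b hab hharm x hx
    have h4 : (1 : ℝ) ≤ 4 ^ k := one_le_pow₀ (by norm_num)
    rw [pow_succ] at hρ
    have hρR : R ≤ ρ := by nlinarith
    have hρ0 : 0 < ρ := by linarith
    obtain ⟨a', b', h1, h2⟩ := hstep ρ hρR h a b hab fun y hy =>
      hharm y (hΓ.ball_mono (by linarith) hy)
    have h3 := ih (ρ / 4) (by linarith) h a' b' h2
      (fun y hy => hharm y (hΓ.ball_mono (by linarith) hy)) x
      (by rwa [div_div, mul_comm, ← pow_succ])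
    refine h3.trans ?_
    rw [pow_succ, mul_assoc]
    exact mul_le_mul_of_nonneg_left h1 (pow_nonneg (by linarith) k)

/-- Regularity of the heat kernel at the origin. -/
theorem abs_heatKernel_sub_zero_le {s : Speed} (hd : 0 < d) (hA : Γ.StandingAssumption s 0 d)
    {ε : ℝ} (hε : 0 < ε) : ∃ η > (0 : ℝ), ∃ R ≥ (1 : ℝ), ∀ r ≥ R, ∀ z ∈ Γ.ball 0 (η * r),
      |Γ.heatKernel s (r ^ 2) 0 z - Γ.heatKernel s (r ^ 2) 0 0| ≤ ε / r ^ d := by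
  have hπ := hΓ.π_pos hd
  obtain ⟨c, hc, hU⟩ := hΓ.heatKernel_le hA.heatKernelUpper
  obtain ⟨C, hC, hV⟩ := hΓ.exitPotential_le hd hA.heatKernelUpper hA.volumeRegular
  obtain ⟨γ, hγ0, hγ1, R₁, hR₁, hosc⟩ := hΓ.exists_oscillation hA.ellipticHarnack
  -- The bound is also used at scale `r / 2`, where the radius `4 * (r / 2)` is `2 * r`; this is the
  -- source of the factor `2 ^ d` in `cc`.
  obtain ⟨R₂, hR₂, hU⟩ := hU 4 (by norm_num)
  obtain ⟨R₃, hR₃, hV⟩ := hV 1 one_pos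
  set cc := c * 2 ^ d with hcc
  have hcc0 : 0 < cc := by positivity
  -- `κ` makes the distance from the heat kernel to its harmonic replacement small on the ball of
  -- radius `κ * r`; `k`, chosen afterwards, makes the oscillation of the replacement small on a
  -- ball smaller by `4 ^ k`.
  obtain ⟨κ, hκ0, hκ1, hκ⟩ : ∃ κ > (0 : ℝ), κ ≤ 1 ∧ 4 * cc * C * κ ^ 2 ≤ ε / 2 := by
    refine ⟨min 1 (ε / (8 * cc * C)), by positivity, min_le_left _ _, ?_⟩
    have h1 : (min 1 (ε / (8 * cc * C))) ^ 2 ≤ ε / (8 * cc * C) := by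
      rw [sq]
      calc _ ≤ 1 * (ε / (8 * cc * C)) :=
            mul_le_mul (min_le_left _ _) (min_le_right _ _) (by positivity) zero_le_one
        _ = _ := one_mul _
    calc _ ≤ 4 * cc * C * (ε / (8 * cc * C)) := mul_le_mul_of_nonneg_left h1 (by positivity)
      _ = ε / 2 := by field_simp; norm_num
  obtain ⟨k, hk⟩ := exists_pow_lt_of_lt_one (by positivity : 0 < ε / (2 * cc))
    (by linarith : 1 - γ < 1)
  refine ⟨κ / 4 ^ k, by positivity, max (2 * R₂) (max (R₃ / κ) (R₁ * 4 ^ k / κ)),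
    by linarith [le_max_left (2 * R₂) (max (R₃ / κ) (R₁ * 4 ^ k / κ))], fun r hr z hz => ?_⟩
  have hr2 : 2 * R₂ ≤ r := (le_max_left _ _).trans hr
  have hr3 : R₃ ≤ κ * r := by
    have := ((le_max_left _ _).trans (le_max_right _ _)).trans hr
    rwa [div_le_iff₀ hκ0, mul_comm] at this
  have hr1 : R₁ * 4 ^ k ≤ κ * r := by
    have := ((le_max_right _ _).trans (le_max_right _ _)).trans hr
    rw [div_le_iff₀ hκ0] at this
    linarith
  have hr0 : 2 ≤ r := by linarith
  have hκr : κ * r ≤ r := by nlinarith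
  have hκr0 : 0 < κ * r := by positivity
  set u := Γ.heatKernel s (r ^ 2) 0 with hu
  have h2d : (1 : ℝ) ≤ 2 ^ d := one_le_pow₀ (by norm_num)
  have hu0 : ∀ y, 0 ≤ u y := fun y => Γ.heatKernel_nonneg hπ _ _ _
  have hball : Γ.ball 0 (2 * r) ⊆ Γ.ball 0 (4 * (r / 2)) := hΓ.ball_mono (by linarith)
  have huc : ∀ y ∈ Γ.ball 0 (2 * r), u y ≤ cc / r ^ d := by
    intro y hy
    refine (hU r (by linarith) 0 (hΓ.mem_ball_self (by linarith)) y
      (hΓ.ball_mono (by linarith) hy)).trans ?_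
    exact div_le_div_of_nonneg_right (by rw [hcc]; nlinarith) (by positivity)
  have hhalf : ∀ y ∈ Γ.ball 0 (2 * r), Γ.heatKernel s (r ^ 2 / 2) y y ≤ cc / r ^ d := by
    intro y hy
    have h1 : (r / 2) ^ 2 ≤ r ^ 2 / 2 := by nlinarith
    refine (Γ.heatKernel_self_antitone hπ (sq_nonneg _) h1 y).trans ?_
    refine (hU (r / 2) (by linarith) y (hball hy) y (hball hy)).trans (le_of_eq ?_)
    rw [hcc, div_pow]
    field_simp
  set b := (r ^ 2)⁻¹ * (2 * (cc / r ^ d)) with hb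
  have hb0 : 0 ≤ b := by positivity
  have hLu : ∀ y ∈ Γ.ball 0 (2 * r), |Γ.laplacian s u y| ≤ b := by
    intro y hy
    refine (Γ.abs_laplacian_heatKernel_le hπ (by positivity) 0 y).trans ?_
    refine mul_le_mul_of_nonneg_left ?_ (by positivity)
    linarith [hhalf y hy, hhalf 0 (hΓ.mem_ball_self (by linarith))]
  set B := hΓ.ballFinset 0 (κ * r) with hB
  have hBr : ∀ y ∈ B, y ∈ Γ.ball 0 (2 * r) := fun y hy =>
    hΓ.ball_mono (by linarith) (hΓ.mem_ballFinset.1 hy)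
  have hbdr : ∀ y, (∃ z ∈ B, 0 < Γ.ω z y) → y ∈ Γ.ball 0 (2 * r) := by
    rintro y ⟨z, hz, hzy⟩
    exact hΓ.ball_mono (by linarith) (hΓ.withBoundary_ball_subset 0 (κ * r)
      (Or.inr ⟨z, hΓ.mem_ballFinset.1 hz, hzy⟩))
  -- `h` is harmonic with the boundary values of `u`. As `|L u| ≤ b`, comparison with `b * v` bounds
  -- `u - h` by `b` times the exit potential.
  obtain ⟨h, hh1, hh2⟩ := hΓ.exists_dirichlet s hd B le_rfl u (fun _ => 0)
  have hharm : ∀ y ∈ B, Γ.laplacian s h y = 0 := fun y hy => by simpa using hh1 y hy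
  obtain ⟨v, hv0, hvL, hvB, hvL'⟩ := hΓ.exists_exitPotential s hd B
  have hvup : ∀ y, v y ≤ C * (κ * r) ^ 2 := hV (κ * r) hr3 0
    (hΓ.mem_ball_self (by linarith)) v hv0 hvL' fun y hy => hvB y fun h => hy (hΓ.mem_ballFinset.1 h)
  have hw : ∀ y ∈ B, |u y - h y| ≤ b * v y := by
    intro y hy
    have h1 := hΓ.nonpos_of_laplacian (s := s) hd B le_rfl (u := fun y => u y - h y - b * v y)
      (fun y hy => by
        rw [laplacian_sub, laplacian_sub, laplacian_const_mul, hharm y hy, hvL y hy]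
        linarith [(abs_le.1 (hLu y (hBr y hy))).1])
      (fun y hy _ => by rw [hh2 y hy, hvB y hy]; linarith) y hy
    have h2 := hΓ.nonpos_of_laplacian (s := s) hd B le_rfl (u := fun y => h y - u y - b * v y)
      (fun y hy => by
        rw [laplacian_sub, laplacian_sub, laplacian_const_mul, hharm y hy, hvL y hy]
        linarith [(abs_le.1 (hLu y (hBr y hy))).2])
      (fun y hy _ => by rw [hh2 y hy, hvB y hy]; linarith) y hy
    rw [abs_le]
    constructor <;> linarith
  have hhb : ∀ y ∈ Γ.ball 0 (κ * r), 0 ≤ h y ∧ h y ≤ cc / r ^ d := by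
    intro y hy
    have hyB := hΓ.mem_ballFinset.2 hy
    have h1 := hΓ.nonpos_of_laplacian (s := s) hd B le_rfl (u := fun y => -1 * h y)
      (fun y hy => by rw [laplacian_const_mul, hharm y hy]; linarith)
      (fun y hy _ => by rw [hh2 y hy]; linarith [hu0 y]) y hyB
    have h2 := hΓ.nonpos_of_laplacian (s := s) hd B le_rfl (u := fun y => h y - cc / r ^ d)
      (fun y hy => by rw [laplacian_sub, laplacian_const, hharm y hy]; linarith)
      (fun y hy hy' => by rw [hh2 y hy]; linarith [huc y (hbdr y hy')]) y hyB
    constructor <;> linarith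
  have hzκ : z ∈ Γ.ball 0 (κ * r / 4 ^ k) := by rwa [div_mul_eq_mul_div] at hz
  have hzB : z ∈ B := hΓ.mem_ballFinset.2 (hΓ.ball_mono
    (div_le_self hκr0.le (one_le_pow₀ (by norm_num))) hzκ)
  have h0B : (0 : Fin d → ℤ) ∈ B := hΓ.mem_ballFinset.2 (hΓ.mem_ball_self hκr0)
  have h1 := hosc k (κ * r) hr1 h 0 (cc / r ^ d) hhb
    (fun y hy => hharm y (hΓ.mem_ballFinset.2 hy)) z hzκ
  have h2 : ∀ y ∈ B, |u y - h y| ≤ ε / 4 / r ^ d := by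
    intro y hy
    refine (hw y hy).trans ?_
    calc b * v y ≤ b * (C * (κ * r) ^ 2) := mul_le_mul_of_nonneg_left (hvup y) hb0
      _ = (4 * cc * C * κ ^ 2) / 2 / r ^ d := by rw [hb]; field_simp; ring
      _ ≤ ε / 4 / r ^ d := div_le_div_of_nonneg_right (by linarith) (by positivity)
  have h3 : (1 - γ) ^ k * (cc / r ^ d - 0) ≤ ε / 2 / r ^ d := by
    rw [sub_zero, ← mul_div_assoc]
    refine div_le_div_of_nonneg_right ?_ (by positivity)
    have := mul_le_mul_of_nonneg_right hk.le hcc0.le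
    refine this.trans (le_of_eq ?_)
    field_simp
  have h4 := abs_le.1 (h2 z hzB)
  have h5 := abs_le.1 (h2 0 h0B)
  have h6 := abs_le.1 (h1.trans h3)
  have h7 : ε / r ^ d = ε / 4 / r ^ d + ε / 4 / r ^ d + ε / 2 / r ^ d := by ring
  rw [abs_le, h7]
  constructor <;> linarith

end IsLattice

/-! ### From cubes to test functions. -/

/-- If weighted point configurations have asymptotically the mass `∫ f` on all small cubes with
centre in the support of `φ`, then they integrate `φ` asymptotically like `f`. -/
theorem tendsto_sum_mul_of_tendsto_cube {d : ℕ} {ι : Type*} {F : ℕ → Finset ι} {w : ℕ → ι → ℝ}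
    {p : ℕ → ι → Fin d → ℝ} {f φ : (Fin d → ℝ) → ℝ} {C : ℝ} (hf : Continuous f)
    (hφ : Continuous φ) (hφc : HasCompactSupport φ) (hw : ∀ n, ∀ z ∈ F n, 0 ≤ w n z)
    (hC : ∀ n, ∑ z ∈ F n, w n z ≤ C)
    (h : ∀ y ∈ tsupport φ, ∀ R ∈ Ioc (0 : ℝ) 1, Tendsto
      (fun n => ∑ z ∈ F n, (Metric.closedBall y R).indicator 1 (p n z) * w n z) atTop
      (𝓝 (∫ z in Metric.closedBall y R, f z))) :
    Tendsto (fun n => ∑ z ∈ F n, w n z * φ (p n z)) atTop (𝓝 (∫ y, φ y * f y)) := by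
  have hC0 : 0 ≤ C := (Finset.sum_nonneg (hw 0)).trans (hC 0)
  set I := ∫ y, |φ y| with hI
  have hI0 : 0 ≤ I := integral_nonneg fun y => abs_nonneg _
  have hφi : Integrable φ := hφ.integrable_of_hasCompactSupport hφc
  rw [Metric.tendsto_atTop]
  intro ε hε
  -- The three errors, relative to `v`, are `ε' * C`, `ε' * I` and `ε'`; one more `ε'` is slack for
  -- the strict inequality.
  set ε' := ε / (C + I + 2) with hε'
  have hε'0 : 0 < ε' := by positivity
  obtain ⟨δ₁, hδ₁, h1⟩ := Metric.uniformContinuous_iff.1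
    (hφ.uniformContinuous_of_tendsto_cocompact hφc.is_zero_at_infty) ε' hε'0
  obtain ⟨δ₂, hδ₂, h2⟩ := Metric.mem_uniformity_dist.1
    (hφc.isCompact.uniformContinuousAt_of_continuousAt f (fun a _ => hf.continuousAt)
      (Metric.dist_mem_uniformity hε'0))
  set R := min 1 (min δ₁ δ₂) / 2 with hR
  have hR0 : 0 < R := by positivity
  have hR1 : R ≤ 1 := by linarith [min_le_left 1 (min δ₁ δ₂)]
  have hRδ₁ : R < δ₁ := by
    linarith [(min_le_right 1 (min δ₁ δ₂)).trans (min_le_left _ _)]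
  have hRδ₂ : R < δ₂ := by
    linarith [(min_le_right 1 (min δ₁ δ₂)).trans (min_le_right _ _)]
  set v := (volume : Measure (Fin d → ℝ)).real (Metric.closedBall 0 R) with hv
  have hvol : ∀ y : Fin d → ℝ, (volume : Measure (Fin d → ℝ)).real (Metric.closedBall y R) = v :=
    fun y => by simp [hv, measureReal_def, Measure.addHaar_closedBall_center]
  have hv0 : 0 < v := ENNReal.toReal_pos (Metric.measure_closedBall_pos _ _ hR0).ne'
    (isCompact_closedBall _ _).measure_lt_top.ne
  have hmeas : ∀ y : Fin d → ℝ, MeasurableSet (Metric.closedBall y R) :=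
    fun y => Metric.isClosed_closedBall.measurableSet
  set G : (Fin d → ℝ) → ℝ := fun y => ∫ z in Metric.closedBall y R, f z with hG
  have hGf : ∀ y ∈ tsupport φ, |G y - v * f y| ≤ ε' * v := by
    intro y hy
    have h3 : v * f y = ∫ z in Metric.closedBall y R, f y := by
      rw [setIntegral_const, hvol, smul_eq_mul]
    have hfi : IntegrableOn f (Metric.closedBall y R) :=
      hf.continuousOn.integrableOn_compact (isCompact_closedBall _ _)
    rw [h3, hG, ← integral_sub hfi (integrableOn_const (isCompact_closedBall _ _).measure_lt_top.ne)]
    rw [← hvol y, ← Real.norm_eq_abs]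
    refine norm_setIntegral_le_of_norm_le_const (isCompact_closedBall _ _).measure_lt_top
      fun z hz => ?_
    rw [← dist_eq_norm, dist_comm]
    refine (h2 (a := y) (b := z) ?_ hy).le
    rw [dist_comm]
    exact (Metric.mem_closedBall.1 hz).trans_lt hRδ₂
  -- Integrating `φ` against the masses `g n` of small cubes is, by Fubini, summing the integrals of
  -- `φ` over cubes around the points, which is nearly `v` times the wanted sum. Dominated
  -- convergence gives the limit of the same integral.
  set g : ℕ → (Fin d → ℝ) → ℝ := fun n y =>
    ∑ z ∈ F n, (Metric.closedBall y R).indicator 1 (p n z) * w n z with hg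
  have hind : ∀ x y : Fin d → ℝ, (Metric.closedBall y R).indicator (1 : (Fin d → ℝ) → ℝ) x
      = (Metric.closedBall x R).indicator (1 : (Fin d → ℝ) → ℝ) y := fun x y => by
    simp only [indicator, Metric.mem_closedBall, dist_comm, Pi.one_apply]
  have hgm : ∀ n, Measurable (g n) := fun n => by
    refine Finset.measurable_sum _ fun z _ => Measurable.mul_const ?_ _
    simp_rw [fun y => hind (p n z) y]
    exact measurable_one.indicator (hmeas _)
  have hgb : ∀ n y, |g n y| ≤ C := fun n y => by
    have h0 : ∀ z, (0 : ℝ) ≤ (Metric.closedBall y R).indicator 1 (p n z) := fun z =>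
      indicator_nonneg (fun _ _ => zero_le_one) _
    rw [abs_of_nonneg (Finset.sum_nonneg fun z hz => mul_nonneg (h0 z) (hw n z hz))]
    refine (Finset.sum_le_sum fun z hz => ?_).trans (hC n)
    refine mul_le_of_le_one_left (hw n z hz) ?_
    exact indicator_le_self' (s := Metric.closedBall y R) (f := (1 : (Fin d → ℝ) → ℝ))
      (fun _ _ => zero_le_one) _
  have hpt : ∀ y, Tendsto (fun n => φ y * g n y) atTop (𝓝 (φ y * G y)) := fun y => by
    by_cases hy : y ∈ tsupport φ
    · exact (h y hy R ⟨hR0, hR1⟩).const_mul _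
    · simp [image_eq_zero_of_notMem_tsupport hy]
  have hgφ : ∀ n y, ‖φ y * g n y‖ ≤ |φ y| * C := fun n y => by
    rw [Real.norm_eq_abs, abs_mul]
    exact mul_le_mul_of_nonneg_left (hgb n y) (abs_nonneg _)
  have hgφm : ∀ n, AEStronglyMeasurable (fun y => φ y * g n y) volume := fun n =>
    (hφ.measurable.mul (hgm n)).aestronglyMeasurable
  have hlim : Tendsto (fun n => ∫ y, φ y * g n y) atTop (𝓝 (∫ y, φ y * G y)) :=
    tendsto_integral_of_dominated_convergence (fun y => |φ y| * C) hgφm (hφi.abs.mul_const C)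
      (fun n => Eventually.of_forall (hgφ n)) (Eventually.of_forall hpt)
  have hswap : ∀ n, ∫ y, φ y * g n y
      = ∑ z ∈ F n, w n z * ∫ y in Metric.closedBall (p n z) R, φ y := by
    intro n
    simp_rw [hg, Finset.mul_sum]
    rw [integral_finsetSum]
    · refine Finset.sum_congr rfl fun z _ => ?_
      rw [← integral_indicator (hmeas _), ← integral_const_mul]
      refine integral_congr_ae (Eventually.of_forall fun y => ?_)
      beta_reduce
      rw [hind (p n z)]
      simp only [indicator, Pi.one_apply]
      split_ifs <;> ring
    · intro z _
      refine ((hφi.indicator (hmeas (p n z))).mul_const (w n z)).congr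
        (Eventually.of_forall fun y => ?_)
      beta_reduce
      rw [hind (p n z)]
      simp only [indicator, Pi.one_apply]
      split_ifs <;> ring
  have hφG : |(∫ y, φ y * G y) - v * ∫ y, φ y * f y| ≤ ε' * v * I := by
    have hGi : Integrable fun y => φ y * G y :=
      (hφi.abs.mul_const C).mono (aestronglyMeasurable_of_tendsto_ae _ hgφm
        (Eventually.of_forall hpt)) (Eventually.of_forall fun y => by
          refine (le_of_tendsto' (hpt y).norm (hgφ · y)).trans (le_abs_self _))
    have hfi : Integrable fun y => v * (φ y * f y) :=
      ((hφ.mul hf).integrable_of_hasCompactSupport hφc.mul_right).const_mul v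
    rw [← integral_const_mul, ← integral_sub hGi hfi, ← Real.norm_eq_abs, hI,
      ← integral_const_mul]
    refine norm_integral_le_of_norm_le (hφi.abs.const_mul _) (Eventually.of_forall fun y => ?_)
    rw [show φ y * G y - v * (φ y * f y) = φ y * (G y - v * f y) by ring, Real.norm_eq_abs,
      abs_mul, mul_comm]
    by_cases hy : y ∈ tsupport φ
    · exact mul_le_mul_of_nonneg_right (hGf y hy) (abs_nonneg _)
    · simp [image_eq_zero_of_notMem_tsupport hy]
  have herr : ∀ n, |v * ∑ z ∈ F n, w n z * φ (p n z) - ∫ y, φ y * g n y| ≤ ε' * v * C := by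
    intro n
    rw [hswap, Finset.mul_sum, ← Finset.sum_sub_distrib]
    refine (Finset.abs_sum_le_sum_abs _ _).trans ?_
    calc _ ≤ ∑ z ∈ F n, w n z * (ε' * v) := by
          refine Finset.sum_le_sum fun z hz => ?_
          rw [mul_left_comm, ← mul_sub, abs_mul, abs_of_nonneg (hw n z hz)]
          refine mul_le_mul_of_nonneg_left ?_ (hw n z hz)
          have h3 : v * φ (p n z) = ∫ y in Metric.closedBall (p n z) R, φ (p n z) := by
            rw [setIntegral_const, hvol, smul_eq_mul]
          have hci : IntegrableOn (fun _ => φ (p n z)) (Metric.closedBall (p n z) R) :=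
            integrableOn_const (isCompact_closedBall _ _).measure_lt_top.ne
          rw [h3, ← integral_sub hci hφi.integrableOn, ← hvol (p n z), ← Real.norm_eq_abs]
          refine norm_setIntegral_le_of_norm_le_const (isCompact_closedBall _ _).measure_lt_top
            fun y hy => ?_
          rw [← dist_eq_norm]
          refine (h1 ?_).le
          rw [dist_comm]
          exact (Metric.mem_closedBall.1 hy).trans_lt hRδ₁
      _ ≤ ε' * v * C := by
          rw [← Finset.sum_mul, mul_comm]
          exact mul_le_mul_of_nonneg_left (hC n) (by positivity)
  obtain ⟨n₀, hn₀⟩ := Metric.tendsto_atTop.1 hlim (ε' * v) (by positivity)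
  refine ⟨n₀, fun n hn => ?_⟩
  have h3 := hn₀ n hn
  rw [Real.dist_eq] at h3 ⊢
  have h4 : v * |∑ z ∈ F n, w n z * φ (p n z) - ∫ y, φ y * f y| < v * ε := by
    rw [← abs_of_pos hv0, ← abs_mul, abs_of_pos hv0, mul_sub]
    have h5 := herr n
    have h6 : v * ε = ε' * v * C + ε' * v * I + 2 * (ε' * v) := by
      rw [hε']; field_simp
    have h7 : 0 < ε' * v := by positivity
    rw [abs_lt] at h3 ⊢
    rw [abs_le] at h5 hφG
    constructor <;> linarith
  exact lt_of_mul_lt_mul_left h4 hv0.le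

/-! ### The Gaussian kernel. -/

section Gaussian

variable {d : ℕ} {S : Matrix (Fin d) (Fin d) ℝ}

theorem continuous_quadraticForm (A : Matrix (Fin d) (Fin d) ℝ) :
    Continuous fun x : Fin d → ℝ => x ⬝ᵥ (A *ᵥ x) :=
  continuous_id.dotProduct (continuous_const.matrix_mulVec continuous_id)

theorem continuous_gaussianKernel (t : ℝ) : Continuous (gaussianKernel S t) := by
  unfold gaussianKernel
  exact continuous_const.mul (Real.continuous_exp.comp
    (((continuous_quadraticForm _).neg).div_const _))

theorem gaussianKernel_nonneg (t : ℝ) (x : Fin d → ℝ) : 0 ≤ gaussianKernel S t x :=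
  mul_nonneg (inv_nonneg.2 (Real.sqrt_nonneg _)) (Real.exp_pos _).le

theorem gaussianKernel_zero (S : Matrix (Fin d) (Fin d) ℝ) (t : ℝ) :
    gaussianKernel S t 0 = (√((2 * Real.pi * t) ^ d * S.det))⁻¹ := by
  simp [gaussianKernel]

theorem gaussianKernel_eq (t : ℝ) (x : Fin d → ℝ) : gaussianKernel S t x =
    gaussianKernel S t 0 * Real.exp (-(x ⬝ᵥ (S⁻¹ *ᵥ x)) / (2 * t)) := by
  rw [gaussianKernel_zero, gaussianKernel]

variable (hS : S.PosDef)

include hS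

theorem quadraticForm_inv_nonneg (x : Fin d → ℝ) : 0 ≤ x ⬝ᵥ (S⁻¹ *ᵥ x) := by
  simpa using hS.inv.posSemidef.dotProduct_mulVec_nonneg x

theorem gaussianKernel_zero_pos {t : ℝ} (ht : 0 < t) : 0 < gaussianKernel S t 0 := by
  rw [gaussianKernel_zero]
  have := hS.det_pos
  have := Real.pi_pos
  positivity

theorem gaussianKernel_le_zero {t : ℝ} (ht : 0 < t) (x : Fin d → ℝ) :
    gaussianKernel S t x ≤ gaussianKernel S t 0 := by
  rw [gaussianKernel_eq]
  refine mul_le_of_le_one_right (gaussianKernel_nonneg _ _) (Real.exp_le_one_iff.2 ?_)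
  exact div_nonpos_of_nonpos_of_nonneg (neg_nonpos.2 (quadraticForm_inv_nonneg hS x)) (by linarith)

theorem sqrt_pow_mul_gaussianKernel_zero {t : ℝ} (ht : 0 < t) :
    √t ^ d * gaussianKernel S t 0 = gaussianKernel S 1 0 := by
  have := hS.det_pos
  have := Real.pi_pos
  rw [gaussianKernel_zero, gaussianKernel_zero, mul_one, mul_pow,
    mul_right_comm, Real.sqrt_mul (by positivity),
    show t ^ d = (√t ^ d) ^ 2 by rw [← pow_mul, mul_comm, pow_mul, Real.sq_sqrt ht.le],
    Real.sqrt_sq (by positivity)]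
  have : 0 < √t := Real.sqrt_pos.2 ht
  field_simp

theorem gaussianKernel_zero_anti {t r : ℝ} (hr : 0 < r) (h : r ≤ t) :
    gaussianKernel S t 0 ≤ gaussianKernel S r 0 := by
  have := hS.det_pos
  have := Real.pi_pos
  rw [gaussianKernel_zero, gaussianKernel_zero]
  gcongr

/-- Squaring halves the time in the exponent. This replaces the convolution identity: the integral
of `k_t²` reduces to the mass of `k_{t/2}`, for which tightness suffices. -/
theorem gaussianKernel_sq {t : ℝ} (ht : 0 < t) (x : Fin d → ℝ) :
    gaussianKernel S t x ^ 2 = gaussianKernel S (2 * t) 0 * gaussianKernel S (t / 2) x := by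
  have h0 : gaussianKernel S t 0 ^ 2 = gaussianKernel S (2 * t) 0 * gaussianKernel S (t / 2) 0 := by
    have hD := hS.det_pos
    have := Real.pi_pos
    simp only [gaussianKernel_zero]
    rw [inv_pow, ← mul_inv, Real.sq_sqrt (by positivity), ← Real.sqrt_mul (by positivity)]
    congr 1
    rw [eq_comm, show (2 * Real.pi * (2 * t)) ^ d * S.det * ((2 * Real.pi * (t / 2)) ^ d * S.det)
      = ((2 * Real.pi * (2 * t)) * (2 * Real.pi * (t / 2))) ^ d * S.det ^ 2 by
        rw [mul_mul_mul_comm, ← mul_pow, ← pow_two],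
      show (2 * Real.pi * (2 * t)) * (2 * Real.pi * (t / 2)) = (2 * Real.pi * t) ^ 2 by ring,
      pow_right_comm, ← mul_pow, Real.sqrt_sq (by positivity)]
  rw [gaussianKernel_eq, gaussianKernel_eq (t / 2), mul_pow, h0, ← Real.exp_nat_mul]
  rw [show ((2 : ℕ) : ℝ) * (-(x ⬝ᵥ (S⁻¹ *ᵥ x)) / (2 * t)) = -(x ⬝ᵥ (S⁻¹ *ᵥ x)) / (2 * (t / 2)) by
    push_cast; field_simp]
  ring

theorem continuousOn_gaussianKernel_uncurry :
    ContinuousOn (fun p : ℝ × (Fin d → ℝ) => gaussianKernel S p.1 p.2) (Ioi 0 ×ˢ univ) := by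
  have hD := hS.det_pos
  have := Real.pi_pos
  unfold gaussianKernel
  refine ContinuousOn.mul (ContinuousOn.inv₀ (Continuous.continuousOn (by fun_prop)) ?_)
    (Real.continuous_exp.comp_continuousOn (ContinuousOn.div
      ((continuous_quadraticForm _).comp continuous_snd).neg.continuousOn
      (by fun_prop) ?_))
  · rintro ⟨t, x⟩ ⟨ht, -⟩
    have : 0 < t := ht
    positivity
  · rintro ⟨t, x⟩ ⟨ht, -⟩
    exact mul_ne_zero two_ne_zero (ne_of_gt ht)

/-- Uniform continuity of the Gaussian kernel in time and space, on compact sets. -/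
theorem uniformContinuous_gaussianKernel {t : ℝ} (ht : 0 < t) (M : ℝ) {ε : ℝ} (hε : 0 < ε) :
    ∃ δ > (0 : ℝ), ∀ r ∈ Icc (t / 2) (2 * t), ∀ r' ∈ Icc (t / 2) (2 * t), |r - r'| ≤ δ →
      ∀ x ∈ Metric.closedBall (0 : Fin d → ℝ) M, ∀ y ∈ Metric.closedBall (0 : Fin d → ℝ) M,
        dist x y ≤ δ → |gaussianKernel S r x - gaussianKernel S r' y| ≤ ε := by
  have hK : IsCompact (Icc (t / 2) (2 * t) ×ˢ Metric.closedBall (0 : Fin d → ℝ) M) :=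
    isCompact_Icc.prod (isCompact_closedBall _ _)
  have hc := hK.uniformContinuousOn_of_continuous
    ((continuousOn_gaussianKernel_uncurry hS).mono (prod_mono
      (fun r hr => (by linarith [hr.1] : (0 : ℝ) < r)) (subset_univ _)))
  obtain ⟨δ, hδ, h⟩ := Metric.uniformContinuousOn_iff_le.1 hc ε hε
  refine ⟨δ, hδ, fun r hr r' hr' hrr x hx y hy hxy => ?_⟩
  exact h (r, x) ⟨hr, hx⟩ (r', y) ⟨hr', hy⟩ (max_le hrr hxy)

/-- `t^{d/2} k_t` is almost constant on bounded sets for large `t`. -/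
theorem abs_sqrt_pow_mul_gaussianKernel_sub_le (b : ℝ) {ε : ℝ} (hε : 0 < ε) :
    ∃ T > (0 : ℝ), ∀ t ≥ T, ∀ x ∈ Metric.closedBall (0 : Fin d → ℝ) b,
      |√t ^ d * gaussianKernel S t x - gaussianKernel S 1 0| ≤ ε := by
  obtain ⟨C, hC⟩ := (isCompact_closedBall (0 : Fin d → ℝ) b).exists_bound_of_continuousOn
    (continuous_quadraticForm S⁻¹).continuousOn
  have hk := gaussianKernel_zero_pos hS one_pos
  set C' := max C 1 with hC'
  have hC'0 : 0 < C' := zero_lt_one.trans_le (le_max_right _ _)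
  refine ⟨gaussianKernel S 1 0 * C' / ε, by positivity, fun t ht x hx => ?_⟩
  have ht0 : 0 < t := lt_of_lt_of_le (by positivity) ht
  rw [gaussianKernel_eq, ← mul_assoc, sqrt_pow_mul_gaussianKernel_zero hS ht0]
  have h0 := quadraticForm_inv_nonneg hS x
  have h1 : x ⬝ᵥ (S⁻¹ *ᵥ x) ≤ C' :=
    (le_abs_self _).trans ((hC x hx).trans (le_max_left _ _))
  have h2 := Real.add_one_le_exp (-(x ⬝ᵥ (S⁻¹ *ᵥ x)) / (2 * t))
  have h3 : Real.exp (-(x ⬝ᵥ (S⁻¹ *ᵥ x)) / (2 * t)) ≤ 1 := Real.exp_le_one_iff.2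
    (div_nonpos_of_nonpos_of_nonneg (neg_nonpos.2 h0) (by linarith))
  have h4 : x ⬝ᵥ (S⁻¹ *ᵥ x) / (2 * t) ≤ C' / t := by
    rw [div_le_div_iff₀ (by linarith) ht0]
    nlinarith
  have h5 : gaussianKernel S 1 0 * (C' / t) ≤ ε := by
    rw [ge_iff_le, div_le_iff₀ hε] at ht
    rw [← mul_div_assoc, div_le_iff₀ ht0]
    linarith
  rw [neg_div] at h2 h3
  rw [neg_div, abs_le]
  constructor <;> nlinarith

end Gaussian

/-! ### Rescaling and the invariance principle. -/

/-- The embedding `z ↦ z / N` of the lattice into `ℝ^d`. -/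
def latticeEmb {d : ℕ} (N : ℕ) (z : Fin d → ℤ) : Fin d → ℝ := fun i => (N : ℝ)⁻¹ * z i

theorem latticeEmb_zero {d : ℕ} (N : ℕ) : latticeEmb N (0 : Fin d → ℤ) = 0 := by
  ext i
  simp [latticeEmb]

/-- The integral of `φ` against the image under `z ↦ z / N` of the measure with weights `w`. -/
def latticeSum {d : ℕ} (N : ℕ) (w : (Fin d → ℤ) → ℝ) (φ : (Fin d → ℝ) → ℝ) : ℝ :=
  ∑' z, w z * φ (latticeEmb N z)

/-- The integer time `⌊N² t⌋`. -/
def scaledTime (N : ℕ) (t : ℝ) : ℝ := (⌊(N : ℝ) ^ 2 * t⌋₊ : ℝ)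

theorem scaledTime_nonneg (N : ℕ) (t : ℝ) : 0 ≤ scaledTime N t := Nat.cast_nonneg _

theorem scaledTime_le (N : ℕ) {t : ℝ} (ht : 0 ≤ t) : scaledTime N t ≤ (N : ℝ) ^ 2 * t :=
  Nat.floor_le (by positivity)

theorem lt_scaledTime_add_one (N : ℕ) (t : ℝ) : (N : ℝ) ^ 2 * t < scaledTime N t + 1 :=
  Nat.lt_floor_add_one _

theorem cube_eq_closedBall {d : ℕ} (y : Fin d → ℝ) {R : ℝ} (hR : 0 ≤ R) :
    cube y R = Metric.closedBall y R := by
  ext z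
  rw [Metric.mem_closedBall, dist_pi_le_iff hR]
  rfl

namespace IsLattice

open WeightedGraph

variable {d : ℕ} {Γ : WeightedGraph (Fin d → ℤ)} (hΓ : IsLattice Γ)

include hΓ

theorem dist_latticeEmb_le {N : ℕ} {η : ℝ} {y z : Fin d → ℤ}
    (hz : z ∈ Γ.ball y (η * N)) : dist (latticeEmb N z) (latticeEmb N y) ≤ η := by
  rw [hΓ.mem_ball] at hz
  have h0 : (0 : ℝ) ≤ latticeDist y z := by exact_mod_cast latticeDist_nonneg y z
  have hN : (0 : ℝ) < N := by
    rcases Nat.eq_zero_or_pos N with rfl | h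
    · simp only [Nat.cast_zero, mul_zero] at hz
      linarith
    · exact_mod_cast h
  have hη : 0 ≤ η := by
    by_contra! h
    nlinarith
  refine (dist_pi_le_iff hη).2 fun i => ?_
  have h1 : |(z i : ℝ) - y i| ≤ latticeDist y z := by
    rw [abs_sub_comm]
    exact_mod_cast abs_sub_le_latticeDist y z i
  rw [Real.dist_eq, latticeEmb, latticeEmb, ← mul_sub, abs_mul, abs_of_pos (inv_pos.2 hN),
    inv_mul_le_iff₀ hN, mul_comm]
  exact h1.trans hz.le

theorem norm_latticeEmb_le {N : ℕ} {η : ℝ} {z : Fin d → ℤ} (hz : z ∈ Γ.ball 0 (η * N)) :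
    ‖latticeEmb N z‖ ≤ η := by
  have h := hΓ.dist_latticeEmb_le hz
  rwa [latticeEmb_zero, dist_zero_right] at h

/-- The factor `d` compares the `ℓ¹` distance of the graph with the sup norm on `ℝ^d`. -/
theorem mem_ball_of_norm_latticeEmb_le {N : ℕ} (hN : 0 < N) {b ρ : ℝ} (hbρ : d * b < ρ)
    {z : Fin d → ℤ} (hz : ‖latticeEmb N z‖ ≤ b) : z ∈ Γ.ball 0 (ρ * N) := by
  have hN' : (0 : ℝ) < N := by exact_mod_cast hN
  rw [hΓ.mem_ball, latticeDist]
  push_cast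
  calc ∑ i, |((0 : Fin d → ℤ) i : ℝ) - z i| ≤ ∑ _i : Fin d, N * b := by
        refine Finset.sum_le_sum fun i _ => ?_
        have h := (norm_le_pi_norm (latticeEmb N z) i).trans hz
        rw [latticeEmb, Real.norm_eq_abs, abs_mul, abs_of_pos (inv_pos.2 hN'),
          inv_mul_le_iff₀ hN'] at h
        simpa using h
    _ = d * b * N := by simp; ring
    _ < ρ * N := mul_lt_mul_of_pos_right hbρ hN'

theorem latticeSum_eq_sum {N : ℕ} (hN : 0 < N) {b ρ : ℝ} (hbρ : d * b < ρ)
    {φ : (Fin d → ℝ) → ℝ} (hφ : ∀ x, φ x ≠ 0 → ‖x‖ ≤ b) (w : (Fin d → ℤ) → ℝ) :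
    latticeSum N w φ = ∑ z ∈ hΓ.ballFinset 0 (ρ * N), w z * φ (latticeEmb N z) := by
  refine tsum_eq_sum fun z hz => ?_
  by_contra h
  exact hz (hΓ.mem_ballFinset.2 (hΓ.mem_ball_of_norm_latticeEmb_le hN hbρ
    (hφ _ (right_ne_zero_of_mul h))))

theorem tendsto_sum_heatKernel_closedBall {s : Speed} (hd : 0 < d)
    {S : Matrix (Fin d) (Fin d) ℝ} (hinv : InvariancePrinciple Γ s S) {t : ℝ} (ht : 0 < t)
    (y : Fin d → ℝ) {R ρ : ℝ} (hR : 0 < R) (hρ : d * (‖y‖ + R) < ρ) :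
    Tendsto (fun N : ℕ => ∑ z ∈ hΓ.ballFinset 0 (ρ * N),
      (Metric.closedBall y R).indicator 1 (latticeEmb N z) *
        (Γ.heatKernel s (scaledTime N t) 0 z * Γ.θ s z)) atTop
      (𝓝 (∫ z in Metric.closedBall y R, gaussianKernel S t z)) := by
  classical
  -- The hypothesis is read along `n = N ^ 2`, so that `√n = N` and the time is `⌊N² t⌋`.
  have h := (hinv y R hR t ht).comp
    (tendsto_pow_atTop (α := ℕ) two_ne_zero)
  rw [cube_eq_closedBall y hR.le] at h
  refine h.congr' ?_
  filter_upwards [eventually_gt_atTop 0] with N hN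
  have h1 : ∀ z, (Metric.closedBall y R).indicator 1 (latticeEmb N z) *
      (Γ.heatKernel s (scaledTime N t) 0 z * Γ.θ s z) =
      if latticeEmb N z ∈ Metric.closedBall y R then
        Γ.heatKernel s (scaledTime N t) 0 z * Γ.θ s z else 0 := fun z => by
    simp only [indicator, Pi.one_apply]
    split_ifs <;> simp
  simp_rw [h1]
  rw [← Finset.sum_filter, ← Γ.measure_X_mem (hΓ.π_pos hd), Function.comp_apply]
  congr 1
  ext w
  simp only [mem_ofPred_eq, Finset.mem_filter]
  have h2 : √((N ^ 2 : ℕ) : ℝ) = N := by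
    rw [Nat.cast_pow, Real.sqrt_sq (Nat.cast_nonneg N)]
  rw [h2, Nat.cast_pow]
  refine exists_congr fun z => ⟨fun ⟨hz1, hz2⟩ => ⟨⟨?_, hz2⟩, hz1⟩, fun ⟨⟨_, hz2⟩, hz1⟩ => ⟨hz1, hz2⟩⟩
  refine hΓ.mem_ballFinset.2 (hΓ.mem_ball_of_norm_latticeEmb_le hN hρ ?_)
  have := norm_le_norm_add_norm_sub' (latticeEmb N z) y
  rw [← dist_eq_norm] at this
  have h3 : dist (latticeEmb N z) y ≤ R := hz2
  linarith

theorem tendsto_latticeSum_heatKernel {s : Speed} (hd : 0 < d)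
    {S : Matrix (Fin d) (Fin d) ℝ} (hinv : InvariancePrinciple Γ s S) {t : ℝ} (ht : 0 < t)
    {φ : (Fin d → ℝ) → ℝ} (hφ : Continuous φ) (hφc : HasCompactSupport φ) :
    Tendsto (fun N : ℕ => latticeSum N
      (fun z => Γ.heatKernel s (scaledTime N t) 0 z * Γ.θ s z) φ) atTop
      (𝓝 (∫ x, φ x * gaussianKernel S t x)) := by
  have hπ := hΓ.π_pos hd
  obtain ⟨b, hb⟩ := hφc.isCompact.isBounded.exists_norm_le
  set ρ := d * (max b 0 + 1) + 1 with hρ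
  have hbρ : d * (max b 0 + 1) < ρ := by linarith
  refine (tendsto_sum_mul_of_tendsto_cube (F := fun N => hΓ.ballFinset 0 (ρ * N))
    (w := fun N z => Γ.heatKernel s (scaledTime N t) 0 z * Γ.θ s z)
    (p := fun N z => latticeEmb N z) (C := 1) (continuous_gaussianKernel t) hφ hφc
    (fun N z _ => mul_nonneg (Γ.heatKernel_nonneg hπ _ _ _) (Γ.θ_pos hπ z).le)
    (fun N => Γ.sum_heatKernel_le_one hπ _ _ _) fun y hy R hR => ?_).congr' ?_
  · refine hΓ.tendsto_sum_heatKernel_closedBall hd hinv ht y hR.1 (lt_of_le_of_lt ?_ hbρ)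
    exact mul_le_mul_of_nonneg_left (add_le_add ((hb y hy).trans (le_max_left _ _)) hR.2)
      (Nat.cast_nonneg d)
  · filter_upwards [eventually_gt_atTop 0] with N hN
    refine (hΓ.latticeSum_eq_sum hN hbρ (fun x hx => ?_) _).symm
    exact (hb x (subset_tsupport φ hx)).trans ((le_max_left b 0).trans (by linarith))

/-- The Gaussian limits are tight. -/
theorem exists_le_integral_gaussianKernel {s : Speed} (hd : 0 < d)
    (hA : Γ.StandingAssumption s 0 d) {S : Matrix (Fin d) (Fin d) ℝ}
    (hinv : InvariancePrinciple Γ s S) {t : ℝ} (ht : 0 < t) {ε : ℝ} (hε : 0 < ε) :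
    ∃ ρ > (0 : ℝ), 1 - ε ≤ ∫ z in Metric.closedBall 0 ρ, gaussianKernel S t z := by
  have hπ := hΓ.π_pos hd
  obtain ⟨s₀, hs₀, R, hR, h⟩ := hΓ.le_sum_heatKernel_ball hd hA hε one_pos one_pos
  -- With this `ρ`, `N² t = s₀ (ρ N)²` is the longest time that confinement at scale `ρ * N` covers.
  -- The mass of the Gaussian is thus bounded through the walk instead of being computed.
  set ρ := √(t / s₀) with hρ
  have hρ0 : 0 < ρ := Real.sqrt_pos.2 (by positivity)
  refine ⟨ρ, hρ0, ge_of_tendsto (hΓ.tendsto_sum_heatKernel_closedBall hd hinv ht 0 hρ0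
    (ρ := d * ρ + ρ + 1) (by rw [norm_zero]; linarith)) ?_⟩
  have hev : ∀ᶠ N : ℕ in atTop, R ≤ ρ * N :=
    (tendsto_natCast_atTop_atTop.const_mul_atTop hρ0).eventually_ge_atTop R
  filter_upwards [hev] with N hN
  have h1 := h (ρ * N) hN 0 (hΓ.mem_ball_self (by linarith)) (scaledTime N t)
    (scaledTime_nonneg N t) (by
      refine (scaledTime_le N ht.le).trans (le_of_eq ?_)
      rw [mul_pow, hρ, Real.sq_sqrt (by positivity)]
      field_simp)
  rw [one_mul] at h1
  refine h1.trans ?_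
  have hsub : hΓ.ballFinset (0 : Fin d → ℤ) (ρ * N) ⊆ hΓ.ballFinset 0 ((d * ρ + ρ + 1) * N) := by
    intro z hz
    refine hΓ.mem_ballFinset.2 (hΓ.ball_mono ?_ (hΓ.mem_ballFinset.1 hz))
    refine mul_le_mul_of_nonneg_right ?_ (Nat.cast_nonneg N)
    have : (0 : ℝ) ≤ d * ρ := by positivity
    linarith
  have h0 : ∀ z, 0 ≤ Γ.heatKernel s (scaledTime N t) 0 z * Γ.θ s z := fun z =>
    mul_nonneg (Γ.heatKernel_nonneg hπ _ _ _) (Γ.θ_pos hπ z).le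
  refine le_trans (le_of_eq ?_) (Finset.sum_le_sum_of_subset_of_nonneg hsub fun z _ _ =>
    mul_nonneg (indicator_nonneg (fun _ _ => zero_le_one) _) (h0 z))
  refine Finset.sum_congr rfl fun z hz => ?_
  rw [indicator_of_mem, Pi.one_apply, one_mul]
  rw [mem_closedBall_zero_iff]
  exact hΓ.norm_latticeEmb_le (hΓ.mem_ballFinset.1 hz)

end IsLattice

/-! ### Vague convergence of the rescaled reference measure. -/

/-- The function `(δ - ‖x‖₁)⁺`. -/
def tent {d : ℕ} (δ : ℝ) (x : Fin d → ℝ) : ℝ := max (δ - ∑ i, |x i|) 0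

section Tent

variable {d : ℕ}

theorem continuous_tent (δ : ℝ) : Continuous (tent δ : (Fin d → ℝ) → ℝ) := by
  unfold tent
  fun_prop

theorem tent_nonneg (δ : ℝ) (x : Fin d → ℝ) : 0 ≤ tent δ x := le_max_right _ _

theorem norm_le_of_tent_ne_zero {δ : ℝ} {x : Fin d → ℝ} (h : tent δ x ≠ 0) : ‖x‖ ≤ δ := by
  have h1 : ∑ i, |x i| < δ := by
    by_contra! hc
    exact h (max_eq_right (by linarith))
  have h0 : 0 ≤ ∑ i, |x i| := Finset.sum_nonneg fun i _ => abs_nonneg _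
  exact (pi_norm_le_iff_of_nonneg (by linarith)).2 fun i =>
    (Finset.single_le_sum (f := fun i => |x i|) (fun _ _ => abs_nonneg _)
      (Finset.mem_univ i)).trans h1.le

theorem hasCompactSupport_tent (δ : ℝ) : HasCompactSupport (tent δ : (Fin d → ℝ) → ℝ) :=
  HasCompactSupport.of_support_subset_isCompact (isCompact_closedBall 0 δ) fun x hx => by
    rw [mem_closedBall_zero_iff]
    exact norm_le_of_tent_ne_zero hx

theorem integral_tent_pos {δ : ℝ} (hδ : 0 < δ) : 0 < ∫ x : Fin d → ℝ, tent δ x :=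
  (continuous_tent δ).integral_pos_of_hasCompactSupport_nonneg_nonzero
    (hasCompactSupport_tent δ) (tent_nonneg δ) (x := 0) (by simp [tent, hδ.ne', hδ.le])

end Tent

namespace WeightedGraph

/-- The integral of `φ` against the rescaled reference measure `N^{-d} θ(N ·)`. -/
def scaledMass {d : ℕ} (Γ : WeightedGraph (Fin d → ℤ)) (s : Speed) (N : ℕ)
    (φ : (Fin d → ℝ) → ℝ) : ℝ :=
  latticeSum N (Γ.θ s) φ / (N : ℝ) ^ d

end WeightedGraph

theorem norm_le_of_hasCompactSupport {d : ℕ} {φ : (Fin d → ℝ) → ℝ} (hφc : HasCompactSupport φ) :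
    ∃ b ≥ (0 : ℝ), ∀ x, φ x ≠ 0 → ‖x‖ ≤ b := by
  obtain ⟨b, hb⟩ := hφc.isCompact.isBounded.exists_norm_le
  exact ⟨max b 0, le_max_right _ _, fun x hx =>
    (hb x (subset_tsupport φ hx)).trans (le_max_left _ _)⟩

theorem eventually_le_mul_natCast (R : ℝ) {ρ : ℝ} (hρ : 0 < ρ) :
    ∀ᶠ N : ℕ in atTop, R ≤ ρ * N :=
  (tendsto_natCast_atTop_atTop.const_mul_atTop hρ).eventually_ge_atTop R

namespace IsLattice

open WeightedGraph

variable {d : ℕ} {Γ : WeightedGraph (Fin d → ℤ)} (hΓ : IsLattice Γ)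

include hΓ

/-- Regularity of the heat kernel near the origin, on the diffusive scale. -/
theorem abs_heatKernel_scaledTime_sub_le {s : Speed} (hd : 0 < d)
    (hA : Γ.StandingAssumption s 0 d) {ε : ℝ} (hε : 0 < ε) :
    ∃ η > (0 : ℝ), ∀ t > (0 : ℝ), ∀ᶠ N : ℕ in atTop, ∀ z ∈ Γ.ball 0 (η * √t * N),
      |Γ.heatKernel s (scaledTime N t) 0 z - Γ.heatKernel s (scaledTime N t) 0 0| ≤
        ε / √t ^ d / N ^ d := by
  -- Rounding the time costs at most a factor `2` in the scale, `r ≥ √t * N / 2`. The factor `2 ^ d`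
  -- here and the halving of `η` absorb it.
  obtain ⟨η, hη, R, hR, h⟩ := hΓ.abs_heatKernel_sub_zero_le hd hA (ε := ε / 2 ^ d) (by positivity)
  refine ⟨η / 2, by positivity, fun t ht => ?_⟩
  have ht' : 0 < √t := Real.sqrt_pos.2 ht
  filter_upwards [eventually_le_mul_natCast (2 * R) ht', eventually_gt_atTop 0] with N hN hN0 z hz
  have hN0' : (0 : ℝ) < N := by exact_mod_cast hN0
  set r := √(scaledTime N t) with hr
  have hr2 : r ^ 2 = scaledTime N t := Real.sq_sqrt (scaledTime_nonneg N t)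
  have hrN : √t * N / 2 ≤ r := by
    refine Real.le_sqrt_of_sq_le ?_
    have h1 := lt_scaledTime_add_one N t
    have h2 : (√t * N) ^ 2 = (N : ℝ) ^ 2 * t := by rw [mul_pow, Real.sq_sqrt ht.le]; ring
    nlinarith
  rw [← hr2]
  refine (h r (by linarith) z (hΓ.ball_mono ?_ hz)).trans ?_
  · nlinarith
  · rw [div_div, div_div, ← mul_pow, ← mul_pow]
    refine div_le_div_of_nonneg_left hε.le (by positivity) (pow_le_pow_left₀ (by positivity) ?_ d)
    linarith

theorem scaledMass_abs_le {s : Speed} (hd : 0 < d) (N : ℕ) {φ : (Fin d → ℝ) → ℝ}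
    (hφc : HasCompactSupport φ) : |Γ.scaledMass s N φ| ≤ Γ.scaledMass s N fun x => |φ x| := by
  rcases Nat.eq_zero_or_pos N with rfl | hN
  · simp [scaledMass, hd.ne']
  obtain ⟨b, hb0, hb⟩ := norm_le_of_hasCompactSupport hφc
  rw [scaledMass, scaledMass, hΓ.latticeSum_eq_sum hN (lt_add_one _) hb,
    hΓ.latticeSum_eq_sum hN (lt_add_one (d * b)) fun x hx => hb x (abs_ne_zero.1 hx), abs_div,
    abs_of_nonneg (by positivity : (0 : ℝ) ≤ (N : ℝ) ^ d)]
  refine div_le_div_of_nonneg_right ((Finset.abs_sum_le_sum_abs _ _).trans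
    (Finset.sum_le_sum fun z _ => ?_)) (by positivity)
  rw [abs_mul, abs_of_pos (Γ.θ_pos (hΓ.π_pos hd) z)]

theorem exists_scaledMass_le {s : Speed} (hd : 0 < d) (hV : Γ.VolumeRegular s 0 d)
    {φ : (Fin d → ℝ) → ℝ} (hφ : Continuous φ) (hφc : HasCompactSupport φ) :
    ∃ C > (0 : ℝ), ∀ᶠ N : ℕ in atTop, Γ.scaledMass s N (fun x => |φ x|) ≤ C := by
  obtain ⟨b, hb0, hb⟩ := norm_le_of_hasCompactSupport hφc
  obtain ⟨K, hK⟩ := hφ.bounded_above_of_compact_support hφc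
  obtain ⟨C, hC, h⟩ := hΓ.volume_le hV
  obtain ⟨R, hR, h⟩ := h 1 one_pos
  set ρ := d * b + 1 with hρ
  have hρ0 : 0 < ρ := by positivity
  have hK0 : 0 ≤ K := (norm_nonneg _).trans (hK 0)
  refine ⟨K * (C * ρ ^ d) + 1, by positivity, ?_⟩
  filter_upwards [eventually_gt_atTop 0, eventually_le_mul_natCast R hρ0] with N hN hNR
  have hN0 : (0 : ℝ) < N := by exact_mod_cast hN
  rw [scaledMass, hΓ.latticeSum_eq_sum hN (lt_add_one (d * b)) fun x hx => hb x (abs_ne_zero.1 hx),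
    div_le_iff₀ (by positivity)]
  have h1 := h (ρ * N) hNR 0 (hΓ.mem_ball_self (by positivity))
  calc _ ≤ ∑ z ∈ hΓ.ballFinset 0 (ρ * N), Γ.θ s z * K := Finset.sum_le_sum fun z _ =>
        mul_le_mul_of_nonneg_left (hK _) (Γ.θ_pos (hΓ.π_pos hd) z).le
    _ = K * ∑ z ∈ hΓ.ballFinset 0 (ρ * N), Γ.θ s z := by rw [← Finset.sum_mul, mul_comm]
    _ ≤ K * (C * (ρ * N) ^ d) := mul_le_mul_of_nonneg_left h1 hK0
    _ = K * (C * ρ ^ d) * N ^ d := by rw [mul_pow]; ring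
    _ ≤ _ := by
      rw [add_mul]
      linarith [pow_pos hN0 d]

/-- Close to the origin, the law of the walk is almost proportional to the reference measure. -/
theorem abs_latticeSum_heatKernel_sub_le {s : Speed} (hd : 0 < d)
    (hA : Γ.StandingAssumption s 0 d) {ε : ℝ} (hε : 0 < ε) :
    ∃ η > (0 : ℝ), ∀ t > (0 : ℝ), ∀ b : ℝ, d * b < η * √t → ∀ φ : (Fin d → ℝ) → ℝ,
      (∀ x, φ x ≠ 0 → ‖x‖ ≤ b) → ∀ᶠ N : ℕ in atTop,
      |latticeSum N (fun z => Γ.heatKernel s (scaledTime N t) 0 z * Γ.θ s z) φ -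
        N ^ d * Γ.heatKernel s (scaledTime N t) 0 0 * Γ.scaledMass s N φ| ≤
        ε / √t ^ d * Γ.scaledMass s N fun x => |φ x| := by
  obtain ⟨η, hη, h⟩ := hΓ.abs_heatKernel_scaledTime_sub_le hd hA hε
  refine ⟨η, hη, fun t ht b hb φ hφ => ?_⟩
  filter_upwards [h t ht, eventually_gt_atTop 0] with N hN hN0
  have hN0' : (0 : ℝ) < N := by exact_mod_cast hN0
  have hNd : (N : ℝ) ^ d ≠ 0 := by positivity
  rw [scaledMass, scaledMass, hΓ.latticeSum_eq_sum hN0 hb hφ, hΓ.latticeSum_eq_sum hN0 hb hφ,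
    hΓ.latticeSum_eq_sum hN0 hb fun x hx => hφ x (abs_ne_zero.1 hx)]
  rw [mul_div_assoc', mul_assoc ((N : ℝ) ^ d), mul_div_cancel_left₀ _ hNd, mul_div_assoc',
    mul_div_right_comm, Finset.mul_sum, Finset.mul_sum, ← Finset.sum_sub_distrib]
  refine (Finset.abs_sum_le_sum_abs _ _).trans (Finset.sum_le_sum fun z hz => ?_)
  rw [show ∀ a b c e : ℝ, a * b * c - e * (b * c) = (a - e) * (b * c) by intros; ring, abs_mul,
    abs_mul (Γ.θ s z), abs_of_pos (Γ.θ_pos (hΓ.π_pos hd) z)]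
  exact mul_le_mul_of_nonneg_right (hN z (hΓ.mem_ballFinset.1 hz))
    (mul_nonneg (Γ.θ_pos (hΓ.π_pos hd) z).le (abs_nonneg _))

/-- For large `t` the window of radius `η * √t` contains the support of `φ`, while `√t ^ d * k_t` is
almost the constant `k_1(0)` on it. The factor multiplying the mass of `φ` does not depend on `φ`,
so masses of two test functions can be compared. -/
theorem abs_scaledMass_sub_le {s : Speed} (hd : 0 < d) (hA : Γ.StandingAssumption s 0 d)
    {S : Matrix (Fin d) (Fin d) ℝ} (hS : S.PosDef) (hinv : InvariancePrinciple Γ s S)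
    {φ : (Fin d → ℝ) → ℝ} (hφ : Continuous φ) (hφc : HasCompactSupport φ) {ε : ℝ} (hε : 0 < ε) :
    ∃ T > (0 : ℝ), ∀ t ≥ T, ∀ᶠ N : ℕ in atTop,
      |√t ^ d * (N ^ d * Γ.heatKernel s (scaledTime N t) 0 0) * Γ.scaledMass s N φ -
        gaussianKernel S 1 0 * ∫ x, φ x| ≤ ε := by
  obtain ⟨b, hb0, hb⟩ := norm_le_of_hasCompactSupport hφc
  obtain ⟨C, hC, hCm⟩ := hΓ.exists_scaledMass_le (s := s) hd hA.volumeRegular hφ hφc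
  set J := ∫ x, |φ x| with hJ
  have hJ0 : 0 ≤ J := integral_nonneg fun x => abs_nonneg _
  set ε' := ε / (C + 1 + J) with hε'
  have hε'0 : 0 < ε' := by positivity
  obtain ⟨η, hη, h1⟩ := hΓ.abs_latticeSum_heatKernel_sub_le hd hA hε'0
  obtain ⟨T, hT, h2⟩ := abs_sqrt_pow_mul_gaussianKernel_sub_le hS b hε'0
  refine ⟨max T ((d * b / η) ^ 2 + 1), by positivity, fun t ht => ?_⟩
  have ht0 : 0 < t := hT.trans_le ((le_max_left _ _).trans ht)
  have hbt : d * b < η * √t := by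
    rw [← div_lt_iff₀' hη]
    refine Real.lt_sqrt_of_sq_lt ?_
    linarith [(le_max_right T ((d * b / η) ^ 2 + 1)).trans ht]
  have hp : 0 < √t ^ d := pow_pos (Real.sqrt_pos.2 ht0) d
  have h3 := Metric.tendsto_nhds.1 (hΓ.tendsto_latticeSum_heatKernel hd hinv ht0 hφ hφc)
    (ε' / √t ^ d) (by positivity)
  have hφi : Integrable φ := hφ.integrable_of_hasCompactSupport hφc
  have h4 : |√t ^ d * (∫ x, φ x * gaussianKernel S t x) - gaussianKernel S 1 0 * ∫ x, φ x| ≤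
      ε' * J := by
    have hi : Integrable fun x => φ x * gaussianKernel S t x :=
      (hφ.mul (continuous_gaussianKernel t)).integrable_of_hasCompactSupport hφc.mul_right
    rw [← integral_const_mul, ← integral_const_mul, ← integral_sub (hi.const_mul _)
      (hφi.const_mul _), ← Real.norm_eq_abs, hJ, ← integral_const_mul]
    refine norm_integral_le_of_norm_le (hφi.abs.const_mul _) (Eventually.of_forall fun x => ?_)
    rw [show √t ^ d * (φ x * gaussianKernel S t x) - gaussianKernel S 1 0 * φ x
      = (√t ^ d * gaussianKernel S t x - gaussianKernel S 1 0) * φ x by ring, Real.norm_eq_abs,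
      abs_mul]
    by_cases hx : φ x = 0
    · simp [hx]
    · exact mul_le_mul_of_nonneg_right (h2 t ((le_max_left _ _).trans ht) x
        (mem_closedBall_zero_iff.2 (hb x hx))) (abs_nonneg _)
  filter_upwards [h1 t ht0 b hbt φ hb, h3, hCm] with N h5 h6 h7
  rw [Real.dist_eq] at h6
  set P := latticeSum N (fun z => Γ.heatKernel s (scaledTime N t) 0 z * Γ.θ s z) φ
  set q := (N : ℝ) ^ d * Γ.heatKernel s (scaledTime N t) 0 0
  set m := Γ.scaledMass s N φ
  set I := ∫ x, φ x * gaussianKernel S t x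
  have h8 : √t ^ d * |P - q * m| ≤ ε' * C := by
    calc √t ^ d * |P - q * m| ≤ √t ^ d * (ε' / √t ^ d * C) := mul_le_mul_of_nonneg_left
          (h5.trans (mul_le_mul_of_nonneg_left h7 (by positivity))) hp.le
      _ = ε' * C := by field_simp
  have h9 : √t ^ d * |P - I| ≤ ε' := by
    calc √t ^ d * |P - I| ≤ √t ^ d * (ε' / √t ^ d) := mul_le_mul_of_nonneg_left h6.le hp.le
      _ = ε' := by field_simp
  have h10 : ε = ε' * C + ε' + ε' * J := by rw [hε']; field_simp
  rw [← abs_of_pos hp, ← abs_mul] at h8 h9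
  rw [abs_le] at h4 h8 h9 ⊢
  constructor <;> linarith

end IsLattice

namespace IsLattice

open WeightedGraph

variable {d : ℕ} {Γ : WeightedGraph (Fin d → ℤ)} (hΓ : IsLattice Γ)

open scoped Pointwise in
/-- Riemann sums over the lattice `N⁻¹ ℤ^d`. -/
theorem tendsto_scaledMass_variable (Γ : WeightedGraph (Fin d → ℤ)) {φ : (Fin d → ℝ) → ℝ}
    (hφ : Continuous φ) (hφc : HasCompactSupport φ) :
    Tendsto (fun N : ℕ => Γ.scaledMass .variable N φ) atTop (𝓝 (∫ x, φ x)) := by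
  obtain ⟨b, hb0, hb⟩ := norm_le_of_hasCompactSupport hφc
  set s := Metric.closedBall (0 : Fin d → ℝ) b with hs
  -- Convergence of Riemann sums requires a null frontier, which the ball has by convexity.
  have h := tendsto_tsum_div_pow_atTop_integral s φ hφ Metric.isBounded_closedBall
    Metric.isClosed_closedBall.measurableSet ((convex_closedBall _ _).addHaar_frontier volume)
  have hout : ∀ x ∉ s, φ x = 0 := fun x hx => by
    by_contra hc
    exact hx (mem_closedBall_zero_iff.2 (hb x hc))
  rw [setIntegral_eq_integral_of_forall_compl_eq_zero hout, Fintype.card_fin] at h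
  refine h.congr' ?_
  filter_upwards [eventually_gt_atTop 0] with N hN
  have hN0 : (N : ℝ) ≠ 0 := by exact_mod_cast hN.ne'
  rw [scaledMass, latticeSum]
  congr 1
  have hinj : Function.Injective (latticeEmb N : (Fin d → ℤ) → Fin d → ℝ) := by
    intro y z hyz
    ext i
    have := congrFun hyz i
    simp only [latticeEmb, mul_eq_mul_left_iff, inv_eq_zero, hN0, or_false] at this
    exact_mod_cast this
  simp only [θ, one_mul]
  rw [← tsum_range φ hinj, tsum_subtype, tsum_subtype]
  refine tsum_congr fun x => ?_
  have hmem : x ∈ (N : ℝ)⁻¹ • (Submodule.span ℤ (Set.range (Pi.basisFun ℝ (Fin d))) :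
      Set (Fin d → ℝ)) ↔ x ∈ range (latticeEmb N : (Fin d → ℤ) → Fin d → ℝ) := by
    rw [mem_smul_set]
    constructor
    · rintro ⟨y, hy, rfl⟩
      choose z hz using ((Pi.basisFun ℝ (Fin d)).mem_span_iff_repr_mem ℤ y).1 hy
      refine ⟨z, funext fun i => ?_⟩
      have hi : (z i : ℝ) = y i := by simpa using hz i
      rw [latticeEmb, hi, Pi.smul_apply, smul_eq_mul]
    · rintro ⟨z, rfl⟩
      exact ⟨fun i => z i, ((Pi.basisFun ℝ (Fin d)).mem_span_iff_repr_mem ℤ _).2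
        fun i => ⟨z i, by simp⟩, rfl⟩
  rw [← indicator_indicator]
  by_cases hx : x ∈ s
  · rw [indicator_of_mem hx]
    by_cases hx' : x ∈ range (latticeEmb N : (Fin d → ℤ) → Fin d → ℝ)
    · rw [indicator_of_mem hx', indicator_of_mem (hmem.2 hx')]
    · rw [indicator_of_notMem hx', indicator_of_notMem (hx' ∘ hmem.1)]
  · rw [indicator_of_notMem hx]
    exact (indicator_apply_eq_zero.2 fun _ => hout x hx).symm

include hΓ

/-- Layer-cake formula: the tent is the integral over `u ∈ [0, 1]` of the indicators of `ℓ¹` balls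
of radius `u`, which are the graph balls. The mass is therefore an integral of ball volumes, and `c
* u ^ d` integrates to `c / (d + 1)`. -/
theorem tendsto_scaledMass_tent {s : Speed} (hd : 0 < d) (hV : Γ.VolumeRegular s 0 d) {c : ℝ}
    (hvol : Tendsto (fun R : ℝ => (R ^ d)⁻¹ * mass (Γ.θ s) (Γ.ball 0 R)) atTop (𝓝 c)) :
    Tendsto (fun N : ℕ => Γ.scaledMass s N (tent 1)) atTop (𝓝 (c / (d + 1))) := by
  obtain ⟨C, hC, h⟩ := hΓ.volume_le hV
  obtain ⟨R, hR, h⟩ := h 1 one_pos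
  have hθ := fun z => (Γ.θ_pos (s := s) (hΓ.π_pos hd) z).le
  set f : ℕ → ℝ → ℝ := fun N u => mass (Γ.θ s) (Γ.ball 0 (u * N)) / (N : ℝ) ^ d with hf
  have hmono : ∀ a b : ℝ, a ≤ b → mass (Γ.θ s) (Γ.ball 0 a) ≤ mass (Γ.θ s) (Γ.ball 0 b) := by
    intro a b hab
    rw [hΓ.mass_ball, hΓ.mass_ball]
    refine Finset.sum_le_sum_of_subset_of_nonneg (fun z hz => ?_) fun z _ _ => hθ z
    exact hΓ.mem_ballFinset.2 (hΓ.ball_mono hab (hΓ.mem_ballFinset.1 hz))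
  have hm0 : ∀ a : ℝ, 0 ≤ mass (Γ.θ s) (Γ.ball 0 a) := fun a => by
    rw [hΓ.mass_ball]
    exact Finset.sum_nonneg fun z _ => hθ z
  have hfmono : ∀ N : ℕ, Monotone (f N) := fun N u v huv =>
    div_le_div_of_nonneg_right (hmono _ _ (mul_le_mul_of_nonneg_right huv (Nat.cast_nonneg N)))
      (by positivity)
  have hlim : Tendsto (fun N => ∫ u in (0 : ℝ)..1, f N u) atTop
      (𝓝 (∫ u in (0 : ℝ)..1, u ^ d * c)) := by
    refine intervalIntegral.tendsto_integral_filter_of_dominated_convergence (fun _ => C)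
      (Eventually.of_forall fun N => (hfmono N).measurable.aestronglyMeasurable) ?_
      intervalIntegrable_const (Eventually.of_forall fun u hu => ?_)
    · filter_upwards [eventually_le_mul_natCast R one_pos, eventually_gt_atTop 0] with N hN hN0
      refine Eventually.of_forall fun u hu => ?_
      rw [uIoc_of_le zero_le_one] at hu
      have hN0' : (0 : ℝ) < N := by exact_mod_cast hN0
      rw [one_mul] at hN
      have h1 := h N hN 0 (hΓ.mem_ball_self (by positivity))
      rw [← hΓ.mass_ball] at h1
      rw [Real.norm_eq_abs, abs_of_nonneg (div_nonneg (hm0 _) (by positivity)),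
        div_le_iff₀ (by positivity)]
      exact (hmono _ _ (by nlinarith [hu.2])).trans h1
    · rw [uIoc_of_le zero_le_one] at hu
      have h1 := (hvol.comp (tendsto_natCast_atTop_atTop.const_mul_atTop hu.1)).const_mul (u ^ d)
      refine h1.congr fun N => ?_
      have : u ^ d ≠ 0 := (pow_pos hu.1 d).ne'
      simp only [hf, Function.comp_apply, mul_pow]
      field_simp
  have hint : ∫ u in (0 : ℝ)..1, u ^ d * c = c / (d + 1) := by
    rw [intervalIntegral.integral_mul_const, integral_pow]
    simp
    ring
  rw [hint] at hlim
  refine hlim.congr' ?_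
  filter_upwards [eventually_gt_atTop 0] with N hN
  have hN0 : (0 : ℝ) < N := by exact_mod_cast hN
  rw [scaledMass, hΓ.latticeSum_eq_sum hN (lt_add_one (d * (1 : ℝ)))
    fun x hx => norm_le_of_tent_ne_zero hx]
  simp only [hf]
  rw [intervalIntegral.integral_div]
  congr 1
  set F := hΓ.ballFinset 0 ((d * 1 + 1) * N) with hF
  have htent : ∀ z : Fin d → ℤ, tent 1 (latticeEmb N z) =
      ∫ u in (0 : ℝ)..1, (Ioi ((latticeDist 0 z : ℝ) / N)).indicator (fun _ => (1 : ℝ)) u := by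
    intro z
    have h0 : (0 : ℝ) ≤ latticeDist 0 z := by exact_mod_cast latticeDist_nonneg 0 z
    have h1 : ∑ i, |latticeEmb N z i| = (latticeDist 0 z : ℝ) / N := by
      rw [latticeDist, Int.cast_sum, Finset.sum_div]
      refine Finset.sum_congr rfl fun i _ => ?_
      rw [latticeEmb, abs_mul, abs_of_pos (inv_pos.2 hN0), inv_mul_eq_div]
      simp
    rw [intervalIntegral.integral_of_le zero_le_one, setIntegral_indicator measurableSet_Ioi,
      Ioc_inter_Ioi, setIntegral_const, smul_eq_mul, mul_one, Real.volume_real_Ioc,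
      max_eq_right (div_nonneg h0 hN0.le), tent, h1]
  have hii : ∀ z : Fin d → ℤ, IntervalIntegrable
      (fun u => Γ.θ s z * (Ioi ((latticeDist 0 z : ℝ) / N)).indicator (fun _ => (1 : ℝ)) u)
      volume 0 1 := fun z =>
    ((intervalIntegrable_iff.2 ((integrableOn_const (by simp)).indicator
      measurableSet_Ioi)).const_mul _)
  simp_rw [htent, ← intervalIntegral.integral_const_mul]
  rw [← intervalIntegral.integral_finsetSum fun z _ => hii z]
  refine intervalIntegral.integral_congr fun u hu => ?_
  rw [uIcc_of_le zero_le_one] at hu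
  rw [hΓ.mass_ball]
  refine Finset.sum_subset_zero_on_sdiff (fun z hz => ?_) (fun z hz => ?_) fun z hz => ?_
  · refine hΓ.mem_ballFinset.2 (hΓ.ball_mono ?_ (hΓ.mem_ballFinset.1 hz))
    refine mul_le_mul_of_nonneg_right ?_ hN0.le
    have : (0 : ℝ) ≤ d := Nat.cast_nonneg d
    linarith [hu.2]
  · rw [Finset.mem_sdiff, hΓ.mem_ballFinset, hΓ.mem_ballFinset, hΓ.mem_ball (R := u * N)] at hz
    rw [indicator_of_notMem, mul_zero]
    rw [mem_Ioi, div_lt_iff₀ hN0]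
    exact hz.2
  · rw [hΓ.mem_ballFinset, hΓ.mem_ball] at hz
    rw [indicator_of_mem, mul_one]
    rw [mem_Ioi, div_lt_iff₀ hN0]
    exact hz

/-- By `abs_scaledMass_sub_le`, used for `φ` and for the tent at one common time, the ratio of their
masses tends to the ratio of their integrals. Convergence for the tent thus implies it for `φ`. -/
theorem tendsto_scaledMass_of_tent {s : Speed} (hd : 0 < d) (hA : Γ.StandingAssumption s 0 d)
    {S : Matrix (Fin d) (Fin d) ℝ} (hS : S.PosDef) (hinv : InvariancePrinciple Γ s S) {c₀ : ℝ}
    (h₀ : Tendsto (fun N : ℕ => Γ.scaledMass s N (tent 1)) atTop (𝓝 c₀))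
    {φ : (Fin d → ℝ) → ℝ} (hφ : Continuous φ) (hφc : HasCompactSupport φ) :
    Tendsto (fun N : ℕ => Γ.scaledMass s N φ) atTop
      (𝓝 (((∫ x : Fin d → ℝ, tent 1 x) / c₀)⁻¹ * ∫ x, φ x)) := by
  have hI : 0 < ∫ x : Fin d → ℝ, tent 1 x := integral_tent_pos one_pos
  have hk := gaussianKernel_zero_pos hS one_pos
  obtain ⟨C₀, hC₀, hm₀⟩ := hΓ.exists_scaledMass_le (s := s) hd hA.volumeRegular
    (continuous_tent (d := d) 1) (hasCompactSupport_tent 1)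
  obtain ⟨C, hC, hm⟩ := hΓ.exists_scaledMass_le (s := s) hd hA.volumeRegular hφ hφc
  set I₀ := ∫ x : Fin d → ℝ, tent 1 x
  set I := ∫ x, φ x
  set k := gaussianKernel S 1 0 with hk'
  have hlim : Tendsto (fun N : ℕ => k * I₀ * Γ.scaledMass s N φ - k * I * Γ.scaledMass s N (tent 1))
      atTop (𝓝 0) := by
    rw [Metric.tendsto_nhds]
    intro ε hε
    set ε' := ε / (C + C₀ + 1) with hε'
    have hε'0 : 0 < ε' := by positivity
    obtain ⟨T, hT, h1⟩ := hΓ.abs_scaledMass_sub_le hd hA hS hinv hφ hφc hε'0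
    obtain ⟨T₀, hT₀, h2⟩ := hΓ.abs_scaledMass_sub_le hd hA hS hinv (continuous_tent (d := d) 1)
      (hasCompactSupport_tent 1) hε'0
    filter_upwards [h1 _ (le_max_left T T₀), h2 _ (le_max_right T T₀), hm₀, hm] with N h3 h4 h5 h6
    have h7 := (hΓ.scaledMass_abs_le (s := s) hd N hφc).trans h6
    have h8 := (hΓ.scaledMass_abs_le (s := s) hd N (hasCompactSupport_tent (d := d) 1)).trans h5
    rw [dist_zero_right, Real.norm_eq_abs]
    set q := √(max T T₀) ^ d * (N ^ d * Γ.heatKernel s (scaledTime N (max T T₀)) 0 0)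
    set m := Γ.scaledMass s N φ
    set m₀ := Γ.scaledMass s N (tent 1)
    -- The uncontrolled on-diagonal factor `q` cancels in this combination.
    calc |k * I₀ * m - k * I * m₀| = |(q * m - k * I) * m₀ - (q * m₀ - k * I₀) * m| := by
          congr 1; ring
      _ ≤ |q * m - k * I| * |m₀| + |q * m₀ - k * I₀| * |m| := by
          rw [← abs_mul, ← abs_mul]; exact abs_sub _ _
      _ ≤ ε' * C₀ + ε' * C := add_le_add
          (mul_le_mul h3 h8 (abs_nonneg _) hε'0.le) (mul_le_mul h4 h7 (abs_nonneg _) hε'0.le)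
      _ < ε := by
          have : ε = ε' * C + ε' * C₀ + ε' := by rw [hε']; field_simp
          linarith
  have h := (hlim.add (h₀.const_mul (k * I))).const_mul (k * I₀)⁻¹
  convert h using 2
  · field_simp
    ring
  · rw [zero_add, inv_div]
    field_simp

/-- The rescaled reference measure converges vaguely to a multiple of Lebesgue measure. -/
theorem exists_tendsto_scaledMass {s : Speed} (hd : 0 < d) (hA : Γ.StandingAssumption s 0 d)
    (hvol : ∃ c > (0 : ℝ), Tendsto
      (fun R : ℝ => (R ^ d)⁻¹ * WeightedGraph.mass Γ.π (Γ.ball 0 R)) atTop (𝓝 c))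
    {S : Matrix (Fin d) (Fin d) ℝ} (hS : S.PosDef) (hinv : InvariancePrinciple Γ s S) :
    ∃ a > (0 : ℝ), ∀ φ : (Fin d → ℝ) → ℝ, Continuous φ → HasCompactSupport φ →
      Tendsto (fun N : ℕ => Γ.scaledMass s N φ) atTop (𝓝 (a⁻¹ * ∫ x, φ x)) := by
  cases s
  · obtain ⟨c, hc, h⟩ := hvol
    exact ⟨_, div_pos (integral_tent_pos one_pos) (by positivity), fun φ hφ hφc =>
      hΓ.tendsto_scaledMass_of_tent hd hA hS hinv
        (hΓ.tendsto_scaledMass_tent hd hA.volumeRegular h) hφ hφc⟩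
  · refine ⟨1, one_pos, fun φ hφ hφc => ?_⟩
    rw [inv_one, one_mul]
    exact tendsto_scaledMass_variable Γ hφ hφc

end IsLattice

/-! ### On-diagonal limit and convergence in `L²`. -/

/-- A continuous function that is `1` on the ball of radius `M` and `0` off the ball of radius
`M + 1`. -/
def cutoff {d : ℕ} (M : ℝ) (x : Fin d → ℝ) : ℝ := max (min (M + 1 - ‖x‖) 1) 0

section Cutoff

variable {d : ℕ} (M : ℝ)

theorem continuous_cutoff : Continuous (cutoff M : (Fin d → ℝ) → ℝ) := by
  unfold cutoff
  fun_prop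

theorem cutoff_nonneg (x : Fin d → ℝ) : 0 ≤ cutoff M x := le_max_right _ _

theorem cutoff_le_one (x : Fin d → ℝ) : cutoff M x ≤ 1 := max_le (min_le_right _ _) zero_le_one

theorem cutoff_eq_one {x : Fin d → ℝ} (hx : ‖x‖ ≤ M) : cutoff M x = 1 := by
  rw [cutoff, min_eq_right (by linarith), max_eq_left zero_le_one]

theorem norm_le_of_cutoff_ne_zero {x : Fin d → ℝ} (h : cutoff M x ≠ 0) : ‖x‖ ≤ M + 1 := by
  by_contra! hc
  exact h (max_eq_right ((min_le_left _ _).trans (by linarith)))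

theorem hasCompactSupport_cutoff : HasCompactSupport (cutoff M : (Fin d → ℝ) → ℝ) :=
  HasCompactSupport.of_support_subset_isCompact (isCompact_closedBall 0 (M + 1)) fun _ hx =>
    mem_closedBall_zero_iff.2 (norm_le_of_cutoff_ne_zero M hx)

end Cutoff

theorem tendsto_scaledTime_atTop {t : ℝ} (ht : 0 < t) :
    Tendsto (fun N : ℕ => scaledTime N t) atTop atTop := by
  refine tendsto_natCast_atTop_atTop.comp (tendsto_nat_floor_atTop.comp ?_)
  exact (((tendsto_pow_atTop two_ne_zero).comp tendsto_natCast_atTop_atTop)).atTop_mul_const ht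

namespace IsLattice

open WeightedGraph

variable {d : ℕ} {Γ : WeightedGraph (Fin d → ℤ)} (hΓ : IsLattice Γ)

include hΓ

/-- Test against a tent of small width `δ`. The law integrates it to nearly `k_t(0) * I`, and also
to nearly the on-diagonal kernel times the mass, which tends to `a⁻¹ * I`. Dividing isolates the
kernel at the origin. -/
theorem tendsto_heatKernel_zero_zero {s : Speed} (hd : 0 < d) (hA : Γ.StandingAssumption s 0 d)
    {S : Matrix (Fin d) (Fin d) ℝ} (hS : S.PosDef) (hinv : InvariancePrinciple Γ s S) {a : ℝ}
    (ha : 0 < a) (hmass : ∀ φ : (Fin d → ℝ) → ℝ, Continuous φ → HasCompactSupport φ →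
      Tendsto (fun N : ℕ => Γ.scaledMass s N φ) atTop (𝓝 (a⁻¹ * ∫ x, φ x))) {t : ℝ} (ht : 0 < t) :
    Tendsto (fun N : ℕ => (N : ℝ) ^ d * Γ.heatKernel s (scaledTime N t) 0 0) atTop
      (𝓝 (a * gaussianKernel S t 0)) := by
  rw [Metric.tendsto_nhds]
  intro ε hε
  have hst : 0 < √t := Real.sqrt_pos.2 ht
  set ε' := ε / (1 / √t ^ d + a + 2) with hε'
  have hε'0 : 0 < ε' := by positivity
  obtain ⟨η, hη, h1⟩ := hΓ.abs_latticeSum_heatKernel_sub_le hd hA hε'0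
  obtain ⟨δ', hδ', h2⟩ := uniformContinuous_gaussianKernel hS ht 1 hε'0
  have hd0 : (0 : ℝ) < d := by exact_mod_cast hd
  set δ := min (η * √t / (2 * d)) (min 1 δ') with hδ
  have hδ0 : 0 < δ := by positivity
  have hδη : d * δ < η * √t := by
    calc d * δ ≤ d * (η * √t / (2 * d)) := mul_le_mul_of_nonneg_left (min_le_left _ _) hd0.le
      _ = η * √t / 2 := by field_simp
      _ < η * √t := half_lt_self (by positivity)
  have hδ1 : δ ≤ 1 := (min_le_right _ _).trans (min_le_left _ _)
  have hδδ : δ ≤ δ' := (min_le_right _ _).trans (min_le_right _ _)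
  have hφ : Continuous (tent δ : (Fin d → ℝ) → ℝ) := continuous_tent δ
  have hφc : HasCompactSupport (tent δ : (Fin d → ℝ) → ℝ) := hasCompactSupport_tent δ
  set I := ∫ x : Fin d → ℝ, tent δ x with hI
  have hI0 : 0 < I := integral_tent_pos hδ0
  have hP := hΓ.tendsto_latticeSum_heatKernel hd hinv ht hφ hφc
  have hm := hmass _ hφ hφc
  set J := ∫ x, tent δ x * gaussianKernel S t x with hJ
  set k := gaussianKernel S t 0 with hk
  have hJk : |J - k * I| ≤ ε' * I := by
    have hi : Integrable fun x => tent δ x * gaussianKernel S t x :=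
      (hφ.mul (continuous_gaussianKernel t)).integrable_of_hasCompactSupport hφc.mul_right
    have hi' : Integrable (tent δ : (Fin d → ℝ) → ℝ) := hφ.integrable_of_hasCompactSupport hφc
    rw [hJ, hI, ← integral_const_mul, ← integral_sub hi (hi'.const_mul _), ← integral_const_mul,
      ← Real.norm_eq_abs]
    refine norm_integral_le_of_norm_le (hi'.const_mul _) (Eventually.of_forall fun x => ?_)
    rw [show tent δ x * gaussianKernel S t x - k * tent δ x
      = (gaussianKernel S t x - k) * tent δ x by ring, Real.norm_eq_abs, abs_mul,
      abs_of_nonneg (tent_nonneg δ x)]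
    by_cases hx : tent δ x = 0
    · simp [hx]
    · have hxδ := norm_le_of_tent_ne_zero hx
      have htt : t ∈ Icc (t / 2) (2 * t) := ⟨by linarith, by linarith⟩
      exact mul_le_mul_of_nonneg_right (h2 t htt t htt (by simpa using hδ'.le) x
        (mem_closedBall_zero_iff.2 (hxδ.trans hδ1)) 0 (by simp)
        (by rw [dist_zero_right]; exact hxδ.trans hδδ)) (tent_nonneg δ x)
  have hquot := hP.div hm (mul_ne_zero (inv_ne_zero ha.ne') hI0.ne')
  have hlim : |J / (a⁻¹ * I) - a * k| ≤ a * ε' := by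
    rw [show J / (a⁻¹ * I) - a * k = a / I * (J - k * I) by field_simp, abs_mul,
      abs_of_pos (by positivity)]
    calc a / I * |J - k * I| ≤ a / I * (ε' * I) := mul_le_mul_of_nonneg_left hJk (by positivity)
      _ = a * ε' := by field_simp
  filter_upwards [h1 t ht δ hδη (tent δ) fun x hx => norm_le_of_tent_ne_zero hx,
    Metric.tendsto_nhds.1 hquot ε' hε'0,
    hm.eventually_const_lt (mul_pos (inv_pos.2 ha) hI0)] with N h3 h4 h5
  simp only [abs_of_nonneg (tent_nonneg _ _)] at h3
  rw [Real.dist_eq] at h4 ⊢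
  simp only [Pi.div_apply] at h4
  set P := latticeSum N (fun z => Γ.heatKernel s (scaledTime N t) 0 z * Γ.θ s z) (tent δ)
  set q := (N : ℝ) ^ d * Γ.heatKernel s (scaledTime N t) 0 0
  set m := Γ.scaledMass s N (tent δ)
  have h6 : |q - P / m| ≤ ε' / √t ^ d := by
    rw [← mul_le_mul_iff_left₀ h5]
    refine le_trans (le_of_eq ?_) h3
    nth_rewrite 2 [← abs_of_pos h5]
    rw [← abs_mul, abs_sub_comm P]
    congr 1
    field_simp
  have h7 : ε = ε' / √t ^ d + a * ε' + ε' + ε' := by rw [hε']; field_simp; ring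
  rw [abs_lt] at h4 ⊢
  rw [abs_le] at h6 hlim
  constructor <;> linarith

/-- `2 ⌊N² t⌋` and `⌊2 N² t⌋` differ by at most `1`. The bound for time differences makes the effect
of order `1 / N²` relative to the kernel at time `⌊N² t⌋`. -/
theorem tendsto_heatKernel_two_mul {s : Speed} (hd : 0 < d)
    {S : Matrix (Fin d) (Fin d) ℝ} {a : ℝ}
    (h : ∀ t > (0 : ℝ), Tendsto (fun N : ℕ => (N : ℝ) ^ d * Γ.heatKernel s (scaledTime N t) 0 0)
      atTop (𝓝 (a * gaussianKernel S t 0))) {t : ℝ} (ht : 0 < t) :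
    Tendsto (fun N : ℕ => (N : ℝ) ^ d *
      Γ.heatKernel s (scaledTime N t + scaledTime N t) 0 0) atTop
      (𝓝 (a * gaussianKernel S (2 * t) 0)) := by
  have hπ := hΓ.π_pos hd
  have h1 := h (2 * t) (by linarith)
  have h2 := (tendsto_scaledTime_atTop ht).inv_tendsto_atTop.mul (h t ht)
  rw [zero_mul] at h2
  have h3 : Tendsto (fun N : ℕ => (N : ℝ) ^ d * Γ.heatKernel s (scaledTime N (2 * t)) 0 0 -
      (N : ℝ) ^ d * Γ.heatKernel s (scaledTime N t + scaledTime N t) 0 0) atTop (𝓝 0) := by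
    refine squeeze_zero_norm' ?_ h2
    filter_upwards [(tendsto_scaledTime_atTop ht).eventually_gt_atTop 0] with N hN
    have h4 : scaledTime N t + scaledTime N t ≤ scaledTime N (2 * t) := by
      have : scaledTime N t + scaledTime N t = ((⌊(N : ℝ) ^ 2 * t⌋₊ + ⌊(N : ℝ) ^ 2 * t⌋₊ : ℕ) : ℝ) := by
        rw [Nat.cast_add, scaledTime]
      rw [this]
      refine Nat.cast_le.2 (Nat.le_floor ?_)
      rw [← this]
      linarith [scaledTime_le N ht.le]
    have h5 : scaledTime N (2 * t) ≤ scaledTime N t + scaledTime N t + 1 := by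
      have h6 : scaledTime N (2 * t) < ((⌊(N : ℝ) ^ 2 * t⌋₊ + ⌊(N : ℝ) ^ 2 * t⌋₊ + 2 : ℕ) : ℝ) := by
        refine (scaledTime_le N (by linarith)).trans_lt ?_
        have := lt_scaledTime_add_one N t
        rw [scaledTime] at this
        push_cast
        linarith
      have h7 := Nat.lt_succ_iff.1 (Nat.cast_lt.1 h6)
      rw [scaledTime, scaledTime]
      exact_mod_cast h7
    have h6 := Γ.abs_heatKernel_sub_le (s := s) hπ (by linarith : 0 < scaledTime N t + scaledTime N t)
      h4 0 0
    rw [← mul_sub, norm_mul, Real.norm_eq_abs, Real.norm_eq_abs, abs_of_nonneg (by positivity),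
      Pi.inv_apply, ← mul_assoc, mul_comm (scaledTime N t)⁻¹, mul_assoc]
    refine mul_le_mul_of_nonneg_left (h6.trans ?_) (by positivity)
    rw [add_self_div_two, ← two_mul (Γ.heatKernel _ _ _ _), ← mul_assoc]
    refine mul_le_mul_of_nonneg_right ?_ (Γ.heatKernel_nonneg hπ _ _ _)
    rw [← two_mul, div_mul_eq_mul_div, div_le_iff₀ (by linarith)]
    field_simp
    linarith
  simpa using h1.sub h3

/-- Truncation of the Gaussian kernel. -/
theorem exists_gaussianKernel_truncation {s : Speed} (hd : 0 < d)
    (hA : Γ.StandingAssumption s 0 d) {S : Matrix (Fin d) (Fin d) ℝ} (hS : S.PosDef)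
    (hinv : InvariancePrinciple Γ s S) {a : ℝ} (ha : 0 < a) {t : ℝ} (ht : 0 < t) {ε : ℝ}
    (hε : 0 < ε) (M : ℝ) :
    ∃ g : (Fin d → ℝ) → ℝ, Continuous g ∧ HasCompactSupport g ∧ (∀ x, 0 ≤ g x) ∧
      (∀ x, g x ≤ gaussianKernel S t x) ∧ (∀ x, ‖x‖ ≤ M → g x = gaussianKernel S t x) ∧
      a * gaussianKernel S (2 * t) 0 - 2 * a * (∫ x, g x * gaussianKernel S t x) +
        a ^ 2 * (a⁻¹ * ∫ x, g x ^ 2) < ε := by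
  set k₂ := gaussianKernel S (2 * t) 0 with hk₂
  have hk₂0 : 0 < k₂ := gaussianKernel_zero_pos hS (by linarith)
  set ε' := ε / (a * k₂ + 1) with hε'
  have hε'0 : 0 < ε' := by positivity
  obtain ⟨ρ, hρ, htight⟩ := hΓ.exists_le_integral_gaussianKernel hd hA hinv (half_pos ht) hε'0
  set K := max M ρ with hK
  set g : (Fin d → ℝ) → ℝ := fun x => cutoff K x * gaussianKernel S t x with hg
  have hg0 : ∀ x, 0 ≤ g x := fun x => mul_nonneg (cutoff_nonneg _ _) (gaussianKernel_nonneg _ _)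
  have hgk : ∀ x, g x ≤ gaussianKernel S t x := fun x =>
    mul_le_of_le_one_left (gaussianKernel_nonneg _ _) (cutoff_le_one _ _)
  have hgc : Continuous g := (continuous_cutoff K).mul (continuous_gaussianKernel t)
  have hgs : HasCompactSupport g := (hasCompactSupport_cutoff K).mul_right
  refine ⟨g, hgc, hgs, hg0, hgk, fun x hx => ?_, ?_⟩
  · rw [hg]
    simp only [cutoff_eq_one K (hx.trans (le_max_left _ _)), one_mul]
  have hgki : Integrable fun x => g x * gaussianKernel S t x :=
    (hgc.mul (continuous_gaussianKernel t)).integrable_of_hasCompactSupport hgs.mul_right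
  -- Since `∫ g² ≤ ∫ g k_t` and `∫ g k_t ≥ k₂ (1 - ε')`, the quantity to be bounded is at most `a *
  -- k₂ * ε' < ε`.
  have h5 : ∫ x, g x ^ 2 ≤ ∫ x, g x * gaussianKernel S t x := by
    have hgg : Integrable fun x => g x * g x :=
      (hgc.mul hgc).integrable_of_hasCompactSupport hgs.mul_right
    simp_rw [pow_two]
    refine integral_mono hgg hgki fun x => ?_
    exact mul_le_mul_of_nonneg_left (hgk x) (hg0 x)
  have hχk : Integrable fun x => cutoff K x * gaussianKernel S (t / 2) x :=
    ((continuous_cutoff K).mul (continuous_gaussianKernel _)).integrable_of_hasCompactSupport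
      (hasCompactSupport_cutoff K).mul_right
  have h8 : ∫ x in Metric.closedBall 0 ρ, gaussianKernel S (t / 2) x ≤
      ∫ x, cutoff K x * gaussianKernel S (t / 2) x := by
    refine le_trans (le_of_eq (setIntegral_congr_fun Metric.isClosed_closedBall.measurableSet
      fun x hx => ?_)) (setIntegral_le_integral hχk (Eventually.of_forall fun x =>
        mul_nonneg (cutoff_nonneg K x) (gaussianKernel_nonneg _ _)))
    rw [cutoff_eq_one K ((mem_closedBall_zero_iff.1 hx).trans (le_max_right _ _)), one_mul]
  have h6 : k₂ * (1 - ε') ≤ ∫ x, g x * gaussianKernel S t x := by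
    have h7 : ∀ x, g x * gaussianKernel S t x = k₂ * (cutoff K x * gaussianKernel S (t / 2) x) :=
      fun x => by
        rw [hg]
        beta_reduce
        rw [mul_assoc, ← pow_two, gaussianKernel_sq hS ht]
        ring
    simp_rw [h7]
    rw [integral_const_mul]
    exact mul_le_mul_of_nonneg_left (htight.trans h8) hk₂0.le
  have h12 : a ^ 2 * (a⁻¹ * ∫ x, g x ^ 2) = a * ∫ x, g x ^ 2 := by field_simp
  have h9 : ε = a * k₂ * ε' + ε' := by rw [hε']; field_simp
  rw [h12]
  have h10 := mul_le_mul_of_nonneg_left h5 ha.le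
  have h11 := mul_le_mul_of_nonneg_left h6 ha.le
  nlinarith

/-- Convergence of the heat kernel in `L²`. -/
theorem exists_sum_sq_heatKernel_sub_le {s : Speed} (hd : 0 < d)
    (hA : Γ.StandingAssumption s 0 d) {S : Matrix (Fin d) (Fin d) ℝ} (hS : S.PosDef)
    (hinv : InvariancePrinciple Γ s S) {a : ℝ} (ha : 0 < a)
    (hmass : ∀ φ : (Fin d → ℝ) → ℝ, Continuous φ → HasCompactSupport φ →
      Tendsto (fun N : ℕ => Γ.scaledMass s N φ) atTop (𝓝 (a⁻¹ * ∫ x, φ x)))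
    {t : ℝ} (ht : 0 < t) {ε : ℝ} (hε : 0 < ε) (M : ℝ) :
    ∃ g : (Fin d → ℝ) → ℝ, (∀ x, 0 ≤ g x) ∧ (∀ x, g x ≤ gaussianKernel S t 0) ∧
      (∀ x, ‖x‖ ≤ M → g x = gaussianKernel S t x) ∧ ∀ᶠ N : ℕ in atTop,
        ∀ F : Finset (Fin d → ℤ), ∑ z ∈ F, (Γ.heatKernel s (scaledTime N t) 0 z -
          a / N ^ d * g (latticeEmb N z)) ^ 2 * Γ.θ s z ≤ ε / N ^ d := by
  classical
  have hπ := hΓ.π_pos hd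
  obtain ⟨g, hgc, hgs, hg0, hgk, hgM, h7⟩ := hΓ.exists_gaussianKernel_truncation hd hA hS hinv ha ht
    hε M
  obtain ⟨b, hb0, hgb⟩ := norm_le_of_hasCompactSupport hgs
  refine ⟨g, hg0, fun x => (hgk x).trans (gaussianKernel_le_zero hS ht x), hgM, ?_⟩
  have h1 := hΓ.tendsto_heatKernel_two_mul (s := s) hd
    (fun t ht => hΓ.tendsto_heatKernel_zero_zero hd hA hS hinv ha hmass ht) ht
  have h2 := hΓ.tendsto_latticeSum_heatKernel hd hinv ht hgc hgs
  have h3 := hmass (fun x => g x ^ 2) (hgc.pow 2) (hgs.comp_left (g := fun u : ℝ => u ^ 2) (by simp))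
  -- These are the limits of the three terms of the expanded square: `p_{2t}(0, 0)`, the mixed term
  -- from the invariance principle, and the mass of `g²`.
  have h4 := (h1.sub (h2.const_mul (2 * a))).add (h3.const_mul (a ^ 2))
  filter_upwards [h4.eventually_lt_const h7, eventually_gt_atTop 0] with N hN hN0 F
  have hN0' : (0 : ℝ) < N := by exact_mod_cast hN0
  have hNd : (0 : ℝ) < (N : ℝ) ^ d := by positivity
  set F₀ := hΓ.ballFinset 0 ((d * b + 1) * N) with hF₀
  have hout : ∀ z ∉ F ∪ F₀, g (latticeEmb N z) = 0 := fun z hz => by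
    by_contra hc
    exact hz (Finset.mem_union_right _ (hΓ.mem_ballFinset.2
      (hΓ.mem_ball_of_norm_latticeEmb_le hN0 (lt_add_one _) (hgb _ hc))))
  have hP : latticeSum N (fun z => Γ.heatKernel s (scaledTime N t) 0 z * Γ.θ s z) g =
      ∑ z ∈ F ∪ F₀, Γ.heatKernel s (scaledTime N t) 0 z * Γ.θ s z * g (latticeEmb N z) :=
    tsum_eq_sum fun z hz => by rw [hout z hz, mul_zero]
  have hm : latticeSum N (Γ.θ s) (fun x => g x ^ 2) =
      ∑ z ∈ F ∪ F₀, Γ.θ s z * g (latticeEmb N z) ^ 2 :=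
    tsum_eq_sum fun z hz => by
      beta_reduce
      rw [hout z hz]
      simp
  -- By symmetry and Chapman-Kolmogorov the full sum of squares is the on-diagonal kernel at twice
  -- the time.
  have hq : ∑ z ∈ F ∪ F₀, Γ.heatKernel s (scaledTime N t) 0 z ^ 2 * Γ.θ s z ≤
      Γ.heatKernel s (scaledTime N t + scaledTime N t) 0 0 := by
    have h8 := Γ.hasSum_heatKernel_mul (s := s) hπ (scaledTime_nonneg N t)
      (scaledTime_nonneg N t) 0 0
    simp_rw [fun z => Γ.heatKernel_symm (s := s) hπ (scaledTime_nonneg N t) z 0, ← pow_two] at h8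
    exact sum_le_hasSum _ (fun z _ => mul_nonneg (sq_nonneg _) (Γ.θ_pos hπ z).le) h8
  rw [le_div_iff₀' hNd]
  refine le_trans ?_ hN.le
  rw [hP, scaledMass, hm]
  calc _ ≤ (N : ℝ) ^ d * ∑ z ∈ F ∪ F₀, (Γ.heatKernel s (scaledTime N t) 0 z -
          a / N ^ d * g (latticeEmb N z)) ^ 2 * Γ.θ s z :=
        mul_le_mul_of_nonneg_left (Finset.sum_le_sum_of_subset_of_nonneg Finset.subset_union_left
          fun z _ _ => mul_nonneg (sq_nonneg _) (Γ.θ_pos hπ z).le) hNd.le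
    _ = (N : ℝ) ^ d * (∑ z ∈ F ∪ F₀, Γ.heatKernel s (scaledTime N t) 0 z ^ 2 * Γ.θ s z) -
        2 * a * (∑ z ∈ F ∪ F₀, Γ.heatKernel s (scaledTime N t) 0 z * Γ.θ s z *
          g (latticeEmb N z)) +
        a ^ 2 * ((∑ z ∈ F ∪ F₀, Γ.θ s z * g (latticeEmb N z) ^ 2) / (N : ℝ) ^ d) := by
      rw [Finset.sum_div, Finset.mul_sum, Finset.mul_sum, Finset.mul_sum, Finset.mul_sum,
        ← Finset.sum_sub_distrib, ← Finset.sum_add_distrib]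
      refine Finset.sum_congr rfl fun z _ => ?_
      field_simp
      ring
    _ ≤ _ := by
      have := mul_le_mul_of_nonneg_left hq hNd.le
      linarith

end IsLattice

/-! ### The local limit theorem at a fixed time. -/

/-- An average with sub-probability weights concentrated on `B`: the deviation on `B` costs `ε`, the
weight off `B` costs `ε * K`, and the missing mass costs another `ε * K`. -/
theorem abs_sum_mul_sub_le {ι : Type*} [DecidableEq ι] {B F : Finset ι} (hBF : B ⊆ F)
    {w g : ι → ℝ} {k K ε : ℝ} (hw : ∀ z ∈ F, 0 ≤ w z) (hF : ∑ z ∈ F, w z ≤ 1)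
    (hB : 1 - ε ≤ ∑ z ∈ B, w z) (hk : 0 ≤ k) (hkK : k ≤ K) (hgB : ∀ z ∈ B, |g z - k| ≤ ε)
    (hgF : ∀ z ∈ F, |g z - k| ≤ K) :
    |∑ z ∈ F, w z * g z - k| ≤ ε * (1 + 2 * K) := by
  have hBw : ∑ z ∈ B, w z ≤ ∑ z ∈ F, w z :=
    Finset.sum_le_sum_of_subset_of_nonneg hBF fun z hz _ => hw z hz
  have hε : 0 ≤ ε := by linarith
  have hsplit := Finset.sum_sdiff (f := w) hBF
  have h1 : |∑ z ∈ F, w z * (g z - k)| ≤ ε + ε * K := by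
    refine (Finset.abs_sum_le_sum_abs _ _).trans ?_
    rw [← Finset.sum_sdiff hBF, add_comm]
    have h2 : ∑ z ∈ B, |w z * (g z - k)| ≤ ε := by
      calc _ ≤ ∑ z ∈ B, w z * ε := Finset.sum_le_sum fun z hz => by
            rw [abs_mul, abs_of_nonneg (hw z (hBF hz))]
            exact mul_le_mul_of_nonneg_left (hgB z hz) (hw z (hBF hz))
        _ ≤ ε := by
            rw [← Finset.sum_mul]
            exact mul_le_of_le_one_left hε (hBw.trans hF)
    have h3 : ∑ z ∈ F \ B, |w z * (g z - k)| ≤ ε * K := by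
      calc _ ≤ ∑ z ∈ F \ B, w z * K := Finset.sum_le_sum fun z hz => by
            have hz' := (Finset.mem_sdiff.1 hz).1
            rw [abs_mul, abs_of_nonneg (hw z hz')]
            exact mul_le_mul_of_nonneg_left (hgF z hz') (hw z hz')
        _ ≤ ε * K := by
            rw [← Finset.sum_mul]
            exact mul_le_mul_of_nonneg_right (by linarith) (hk.trans hkK)
    exact add_le_add h2 h3
  have h4 : ∑ z ∈ F, w z * g z - k =
      ∑ z ∈ F, w z * (g z - k) - k * (1 - ∑ z ∈ F, w z) := by
    simp_rw [mul_sub]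
    rw [Finset.sum_sub_distrib, ← Finset.sum_mul]
    ring
  have h5 : k * (1 - ∑ z ∈ F, w z) ≤ ε * K := by
    rw [mul_comm ε]
    exact mul_le_mul hkK (by linarith) (by linarith) (hk.trans hkK)
  have h6 : 0 ≤ k * (1 - ∑ z ∈ F, w z) := mul_nonneg hk (by linarith)
  rw [h4]
  rw [abs_le] at h1 ⊢
  constructor <;> linarith

namespace IsLattice

open WeightedGraph

variable {d : ℕ} {Γ : WeightedGraph (Fin d → ℤ)} (hΓ : IsLattice Γ)

include hΓ

theorem heatKernel_self_le {s : Speed} (hd : 0 < d) (h : Γ.HeatKernelUpper s 0 d) :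
    ∃ c > (0 : ℝ), ∀ u > (0 : ℝ), ∀ M > (0 : ℝ), ∀ᶠ N : ℕ in atTop, ∀ y ∈ Γ.ball 0 (M * N),
      ∀ t, (N : ℝ) ^ 2 * u ≤ t → Γ.heatKernel s t y y ≤ c / √u ^ d / N ^ d := by
  obtain ⟨c, hc, h⟩ := hΓ.heatKernel_le h
  refine ⟨c, hc, fun u hu M hM => ?_⟩
  have hu' : 0 < √u := Real.sqrt_pos.2 hu
  obtain ⟨R, hR, h⟩ := h (M / √u) (by positivity)
  filter_upwards [eventually_le_mul_natCast R hu'] with N hN y hy t ht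
  have hy' : y ∈ Γ.ball 0 (M / √u * (√u * N)) := by
    rwa [← mul_assoc, div_mul_cancel₀ _ hu'.ne']
  have h1 := h (√u * N) hN y hy' y hy'
  have h2 : (√u * N) ^ 2 = (N : ℝ) ^ 2 * u := by rw [mul_pow, Real.sq_sqrt hu.le, mul_comm]
  rw [h2, mul_pow, ← div_div] at h1
  exact (Γ.heatKernel_self_antitone (hΓ.π_pos hd) (by positivity) ht y).trans h1

/-- The local limit theorem at a fixed time. -/
theorem eventually_abs_heatKernel_sub_le {s : Speed} (hd : 0 < d)
    (hA : Γ.StandingAssumption s 0 d) {S : Matrix (Fin d) (Fin d) ℝ} (hS : S.PosDef)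
    (hinv : InvariancePrinciple Γ s S) {a : ℝ} (ha : 0 < a)
    (hmass : ∀ φ : (Fin d → ℝ) → ℝ, Continuous φ → HasCompactSupport φ →
      Tendsto (fun N : ℕ => Γ.scaledMass s N φ) atTop (𝓝 (a⁻¹ * ∫ x, φ x)))
    {t : ℝ} (ht : 0 < t) {ε : ℝ} (hε : 0 < ε) {M : ℝ} (hM : 0 < M) :
    ∀ᶠ N : ℕ in atTop, ∀ y : Fin d → ℤ, ‖latticeEmb N y‖ ≤ M →
      |(N : ℝ) ^ d * Γ.heatKernel s ((N : ℝ) ^ 2 * t) 0 y -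
        a * gaussianKernel S t (latticeEmb N y)| ≤ ε := by
  classical
  have hπ := hΓ.π_pos hd
  set K := gaussianKernel S (t / 2) 0 with hK
  have hK0 : 0 < K := gaussianKernel_zero_pos hS (by linarith)
  set ε' := ε / (1 + a * (1 + 2 * K)) with hε'
  have hε'0 : 0 < ε' := by positivity
  obtain ⟨δ, hδ, hδk⟩ := uniformContinuous_gaussianKernel hS ht (M + 1) hε'0
  set η := min δ 1 with hη
  have hη0 : 0 < η := lt_min hδ one_pos
  set b := d * M + 1 with hb
  have hb0 : 0 < b := by positivity
  obtain ⟨s₀, hs₀, R, hR, hexit⟩ := hΓ.le_sum_heatKernel_ball hd hA hε'0 hη0 hb0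
  -- The final time span `u` is short for the Gaussian (`δ`) and for confinement (`s₀`). The factor
  -- `1 / 2` on `s₀` leaves room for rounding the other time to an integer.
  set u := min (min (t / 2) δ) (s₀ / 2) with hu
  have hu0 : 0 < u := by positivity
  have hut : u ≤ t / 2 := (min_le_left _ _).trans (min_le_left _ _)
  have huδ : u ≤ δ := (min_le_left _ _).trans (min_le_right _ _)
  have hus : u ≤ s₀ / 2 := min_le_right _ _
  obtain ⟨c, hc, hself⟩ := hΓ.heatKernel_self_le hd hA.heatKernelUpper
  set C := c / √u ^ d with hC
  have hC0 : 0 < C := div_pos hc (pow_pos (Real.sqrt_pos.2 hu0) d)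
  -- The precision `ε' ^ 2 / C` is what Cauchy-Schwarz needs against the on-diagonal bound `C`.
  -- Radius `M + 1` makes `g` the exact Gaussian at every point within distance `1` of a target
  -- point.
  obtain ⟨g, hg0, hgK, hgM, hL2⟩ := hΓ.exists_sum_sq_heatKernel_sub_le hd hA hS hinv ha hmass
    (t := t - u) (by linarith) (ε := ε' ^ 2 / C) (by positivity) (M + 1)
  have hgK' : ∀ x, g x ≤ K := fun x =>
    (hgK x).trans (gaussianKernel_zero_anti hS (by linarith) (by linarith))
  filter_upwards [hL2, hself u hu0 b hb0, eventually_gt_atTop 0,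
    eventually_le_mul_natCast R one_pos, eventually_le_mul_natCast (1 + 2 / s₀) one_pos]
    with N hN hselfN hN0 hNR hNs y hy
  rw [one_mul] at hNR hNs
  have hN0' : (0 : ℝ) < N := by exact_mod_cast hN0
  have hNd : (0 : ℝ) < (N : ℝ) ^ d := by positivity
  set r := scaledTime N (t - u) with hr
  have hr0 : 0 ≤ r := scaledTime_nonneg _ _
  set σ := (N : ℝ) ^ 2 * t - r with hσ
  have hσ1 : (N : ℝ) ^ 2 * u ≤ σ := by
    have := scaledTime_le N (t := t - u) (by linarith)
    rw [hσ]
    linarith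
  have hσ0 : 0 ≤ σ := le_trans (by positivity) hσ1
  have hσ2 : σ ≤ s₀ * (N : ℝ) ^ 2 := by
    have h1 := lt_scaledTime_add_one N (t - u)
    have h2 : 2 / s₀ ≤ (N : ℝ) ^ 2 := by nlinarith [div_pos two_pos hs₀]
    rw [div_le_iff₀ hs₀] at h2
    rw [← hr] at h1
    have h3 := mul_le_mul_of_nonneg_left hus (sq_nonneg (N : ℝ))
    rw [hσ]
    linarith
  have hyb : y ∈ Γ.ball 0 (b * N) := hΓ.mem_ball_of_norm_latticeEmb_le hN0 (lt_add_one _) hy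
  set k := gaussianKernel S t (latticeEmb N y) with hk
  have hk0 : 0 ≤ k := gaussianKernel_nonneg _ _
  have hkK : k ≤ K := (gaussianKernel_le_zero hS ht _).trans
    (gaussianKernel_zero_anti hS (by linarith) (by linarith))
  set B := hΓ.ballFinset y (η * N) with hB
  have hexitN := hexit N hNR y hyb σ hσ0 hσ2
  have hsum := Γ.hasSum_heatKernel_mul (s := s) hπ hr0 hσ0 0 y
  rw [show r + σ = (N : ℝ) ^ 2 * t by rw [hσ]; ring] at hsum
  simp_rw [fun z => Γ.heatKernel_symm (s := s) hπ hσ0 z y] at hsum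
  have hp2 : ∀ F : Finset (Fin d → ℤ),
      ∑ z ∈ F, Γ.heatKernel s σ y z ^ 2 * Γ.θ s z ≤ C / N ^ d := by
    intro F
    have h8 := Γ.hasSum_heatKernel_mul (s := s) hπ hσ0 hσ0 y y
    simp_rw [fun z => Γ.heatKernel_symm (s := s) hπ hσ0 z y, ← pow_two] at h8
    refine (sum_le_hasSum _ (fun z _ => mul_nonneg (sq_nonneg _) (Γ.θ_pos hπ z).le) h8).trans ?_
    exact hselfN y hyb _ (by linarith)
  have hmain : ∀ F : Finset (Fin d → ℤ), B ⊆ F →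
      |∑ z ∈ F, Γ.heatKernel s r 0 z * Γ.heatKernel s σ y z * Γ.θ s z - a / N ^ d * k| ≤
        ε / N ^ d := by
    intro F hBF
    set f : (Fin d → ℤ) → ℝ := fun z => Γ.heatKernel s r 0 z - a / N ^ d * g (latticeEmb N z)
    -- Cauchy-Schwarz in `ℓ²(θ)`: the `L²` error of the kernel from `0`, times the `L²` norm of the
    -- kernel from `y`.
    have h1 : |∑ z ∈ F, f z * Γ.heatKernel s σ y z * Γ.θ s z| ≤ ε' / N ^ d := by
      refine abs_le_of_sq_le_sq ?_ (by positivity)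
      have h2 := Finset.sum_mul_sq_le_sq_mul_sq F (fun z => f z * √(Γ.θ s z))
        fun z => Γ.heatKernel s σ y z * √(Γ.θ s z)
      have h3 : ∀ z, √(Γ.θ s z) ^ 2 = Γ.θ s z := fun z => Real.sq_sqrt (Γ.θ_pos hπ z).le
      simp_rw [mul_pow, h3] at h2
      have h4 : ∀ z, f z * √(Γ.θ s z) * (Γ.heatKernel s σ y z * √(Γ.θ s z)) =
          f z * Γ.heatKernel s σ y z * Γ.θ s z := fun z => by
        nth_rewrite 3 [← h3 z]
        ring
      simp_rw [h4] at h2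
      refine h2.trans ?_
      calc _ ≤ (ε' ^ 2 / C / N ^ d) * (C / N ^ d) := mul_le_mul (hN F) (hp2 F)
            (Finset.sum_nonneg fun z _ => mul_nonneg (sq_nonneg _) (Γ.θ_pos hπ z).le)
            (by positivity)
        _ = (ε' / N ^ d) ^ 2 := by field_simp
    -- Over time `σ` the walk from `y` rarely leaves `B`, where the Gaussian is nearly `k`.
    have h5 := abs_sum_mul_sub_le hBF (w := fun z => Γ.heatKernel s σ y z * Γ.θ s z)
      (g := fun z => g (latticeEmb N z)) (k := k) (K := K) (ε := ε')
      (fun z _ => mul_nonneg (Γ.heatKernel_nonneg hπ _ _ _) (Γ.θ_pos hπ z).le)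
      (Γ.sum_heatKernel_le_one hπ _ _ _) hexitN hk0 hkK (fun z hz => ?_) fun z _ => ?_
    · have h6 : ∑ z ∈ F, Γ.heatKernel s r 0 z * Γ.heatKernel s σ y z * Γ.θ s z - a / N ^ d * k =
          ∑ z ∈ F, f z * Γ.heatKernel s σ y z * Γ.θ s z +
          a / N ^ d * (∑ z ∈ F, Γ.heatKernel s σ y z * Γ.θ s z * g (latticeEmb N z) - k) := by
        rw [mul_sub, Finset.mul_sum, ← add_sub_assoc, ← Finset.sum_add_distrib]
        congr 1
        refine Finset.sum_congr rfl fun z _ => ?_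
        ring
      rw [h6]
      refine (abs_add_le _ _).trans ?_
      rw [abs_mul, abs_of_pos (div_pos ha hNd)]
      calc _ ≤ ε' / N ^ d + a / N ^ d * (ε' * (1 + 2 * K)) :=
            add_le_add h1 (mul_le_mul_of_nonneg_left h5 (by positivity))
        _ = ε / N ^ d := by rw [hε']; field_simp
    · have hz1 := hΓ.dist_latticeEmb_le (hΓ.mem_ballFinset.1 hz)
      have hz2 : ‖latticeEmb N z‖ ≤ M + 1 := by
        have := norm_le_norm_add_norm_sub' (latticeEmb N z) (latticeEmb N y)
        rw [← dist_eq_norm] at this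
        linarith [min_le_right δ 1]
      rw [hgM _ hz2]
      refine hδk (t - u) ⟨by linarith, by linarith⟩ t ⟨by linarith, by linarith⟩ ?_ _
        (mem_closedBall_zero_iff.2 hz2) _ (mem_closedBall_zero_iff.2 (by linarith))
        (hz1.trans (min_le_left _ _))
      rw [sub_sub_cancel_left, abs_neg, abs_of_pos hu0]
      exact huδ
    · rw [abs_le]
      constructor <;> linarith [hg0 (latticeEmb N z), hgK' (latticeEmb N z)]
  -- The estimate is uniform in finite `F ⊇ B`, so it passes to the full Chapman-Kolmogorov sum.
  have hlim : |Γ.heatKernel s ((N : ℝ) ^ 2 * t) 0 y - a / N ^ d * k| ≤ ε / N ^ d :=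
    le_of_tendsto (Tendsto.abs (Tendsto.sub_const hsum _))
      ((eventually_ge_atTop B).mono fun F hF => hmain F hF)
  rw [le_div_iff₀' hNd] at hlim
  nth_rewrite 1 [← abs_of_pos hNd] at hlim
  rw [← abs_mul, mul_sub, ← mul_assoc, mul_div_cancel₀ _ hNd.ne'] at hlim
  exact hlim

end IsLattice

/-! ### Uniformity in time and space. -/

theorem dist_latticeEmb_floor_le {d : ℕ} {N : ℕ} (hN : 0 < N) (x : Fin d → ℝ) :
    dist x (latticeEmb N fun i => ⌊(N : ℝ) * x i⌋) ≤ (N : ℝ)⁻¹ := by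
  have hN0 : (0 : ℝ) < N := by exact_mod_cast hN
  refine (dist_pi_le_iff (by positivity)).2 fun i => ?_
  have h : x i - (N : ℝ)⁻¹ * ⌊(N : ℝ) * x i⌋ = (N : ℝ)⁻¹ * Int.fract ((N : ℝ) * x i) := by
    rw [Int.fract, mul_sub, inv_mul_cancel_left₀ hN0.ne']
  rw [latticeEmb, Real.dist_eq, h, abs_mul, abs_of_pos (inv_pos.2 hN0),
    abs_of_nonneg (Int.fract_nonneg _)]
  exact mul_le_of_le_one_right (by positivity) (Int.fract_lt_one _).le

theorem norm_le_norm_toLp {d : ℕ} (x : Fin d → ℝ) : ‖x‖ ≤ ‖WithLp.toLp 2 x‖ :=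
  (pi_norm_le_iff_of_nonneg (norm_nonneg _)).2 fun i => PiLp.norm_apply_le (WithLp.toLp 2 x) i

namespace IsLattice

open WeightedGraph

variable {d : ℕ} {Γ : WeightedGraph (Fin d → ℤ)} (hΓ : IsLattice Γ)

include hΓ

/-- Equicontinuity in time of the rescaled heat kernel. -/
theorem abs_heatKernel_sub_heatKernel_le {s : Speed} (hd : 0 < d)
    (hU : Γ.HeatKernelUpper s 0 d) {T : ℝ} (hT : 0 < T) {M : ℝ} (hM : 0 < M) :
    ∃ C > (0 : ℝ), ∀ᶠ N : ℕ in atTop, ∀ y ∈ Γ.ball 0 (M * N), ∀ t ≥ T, ∀ r ≥ T,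
      |(N : ℝ) ^ d * Γ.heatKernel s ((N : ℝ) ^ 2 * t) 0 y -
        (N : ℝ) ^ d * Γ.heatKernel s ((N : ℝ) ^ 2 * r) 0 y| ≤ C * |t - r| := by
  have hπ := hΓ.π_pos hd
  obtain ⟨c, hc, h⟩ := hΓ.heatKernel_self_le hd hU
  set C := c / √(T / 2) ^ d with hC
  have hC0 : 0 < C := div_pos hc (pow_pos (Real.sqrt_pos.2 (by linarith)) d)
  refine ⟨2 * C / T, by positivity, ?_⟩
  filter_upwards [h (T / 2) (by linarith) M hM, eventually_gt_atTop 0] with N hN hN0 y hy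
  have hN0' : (0 : ℝ) < N := by exact_mod_cast hN0
  have hNd : (0 : ℝ) < (N : ℝ) ^ d := by positivity
  have key : ∀ r ≥ T, ∀ t ≥ r, |(N : ℝ) ^ d * Γ.heatKernel s ((N : ℝ) ^ 2 * t) 0 y -
      (N : ℝ) ^ d * Γ.heatKernel s ((N : ℝ) ^ 2 * r) 0 y| ≤ 2 * C / T * |t - r| := by
    intro r hr t ht
    have hr0 : 0 < r := lt_of_lt_of_le hT hr
    have h1 := Γ.abs_heatKernel_sub_le (s := s) hπ (r := (N : ℝ) ^ 2 * r) (t := (N : ℝ) ^ 2 * t)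
      (by positivity) (mul_le_mul_of_nonneg_left ht (by positivity)) 0 y
    have h2 : (N : ℝ) ^ 2 * (T / 2) ≤ (N : ℝ) ^ 2 * r / 2 := by
      rw [← mul_div_assoc]
      linarith [mul_le_mul_of_nonneg_left hr (sq_nonneg (N : ℝ))]
    have h3 := hN 0 (hΓ.mem_ball_self (by positivity)) _ h2
    have h4 := hN y hy _ h2
    rw [← mul_sub, abs_mul, abs_of_pos hNd, abs_of_nonneg (sub_nonneg.2 ht)]
    have h5 : ((N : ℝ) ^ 2 * t - (N : ℝ) ^ 2 * r) / ((N : ℝ) ^ 2 * r) ≤ (t - r) / T := by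
      rw [← mul_sub, mul_div_mul_left _ _ (by positivity)]
      exact div_le_div_of_nonneg_left (sub_nonneg.2 ht) hT hr
    calc _ ≤ (N : ℝ) ^ d * ((t - r) / T * (C / N ^ d + C / N ^ d)) := by
          refine mul_le_mul_of_nonneg_left (h1.trans (mul_le_mul h5 (add_le_add h3 h4)
            (add_nonneg (Γ.heatKernel_nonneg hπ _ _ _) (Γ.heatKernel_nonneg hπ _ _ _)) ?_)) hNd.le
          exact div_nonneg (sub_nonneg.2 ht) hT.le
      _ = 2 * C / T * (t - r) := by field_simp; ring
  intro t ht r hr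
  rcases le_total r t with h1 | h1
  · exact key r hr t h1
  · rw [abs_sub_comm, abs_sub_comm t]
    exact key t ht r h1

/-- Compactness of the time interval reduces the claim to a neighbourhood of one time `r`. The
errors there are `ε / 3` each: moving the kernel from `t` to `r`, the local limit theorem at `r`,
and continuity of the Gaussian in time and space, including the rounding of `N * x`. -/
theorem eventually_forall_Icc_abs_heatKernel_sub_le {s : Speed} (hd : 0 < d)
    (hA : Γ.StandingAssumption s 0 d) {S : Matrix (Fin d) (Fin d) ℝ} (hS : S.PosDef)
    (hinv : InvariancePrinciple Γ s S) {a : ℝ} (ha : 0 < a)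
    (hmass : ∀ φ : (Fin d → ℝ) → ℝ, Continuous φ → HasCompactSupport φ →
      Tendsto (fun N : ℕ => Γ.scaledMass s N φ) atTop (𝓝 (a⁻¹ * ∫ x, φ x)))
    {T₁ : ℝ} (hT₁ : 0 < T₁) (T₂ : ℝ) {ε : ℝ} (hε : 0 < ε) {M : ℝ} (hM : 0 < M) :
    ∀ᶠ N : ℕ in atTop, ∀ t ∈ Icc T₁ T₂, ∀ x : Fin d → ℝ, ‖x‖ ≤ M →
      |(N : ℝ) ^ d * Γ.heatKernel s ((N : ℝ) ^ 2 * t) 0 (fun i => ⌊(N : ℝ) * x i⌋) -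
        a * gaussianKernel S t x| ≤ ε := by
  set b := d * (M + 1) + 1 with hb
  have hb0 : 0 < b := by positivity
  obtain ⟨C, hC, htime⟩ := hΓ.abs_heatKernel_sub_heatKernel_le hd hA.heatKernelUpper hT₁ hb0
  refine (isCompact_Icc (a := T₁) (b := T₂)).induction_on
    (p := fun K => ∀ᶠ N : ℕ in atTop, ∀ t ∈ K, ∀ x : Fin d → ℝ, ‖x‖ ≤ M →
      |(N : ℝ) ^ d * Γ.heatKernel s ((N : ℝ) ^ 2 * t) 0 (fun i => ⌊(N : ℝ) * x i⌋) -
        a * gaussianKernel S t x| ≤ ε) (Eventually.of_forall fun N t ht => ht.elim)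
    (fun K K' hKK h => h.mono fun N hN t ht => hN t (hKK ht))
    (fun K K' h h' => (h.and h').mono fun N hN t ht => ht.elim (hN.1 t) (hN.2 t)) fun r hr => ?_
  have hr0 : 0 < r := hT₁.trans_le hr.1
  obtain ⟨δ, hδ, hk⟩ := uniformContinuous_gaussianKernel hS hr0 (M + 1)
    (ε := ε / (3 * a)) (by positivity)
  set δ' := min (min δ (r / 2)) (ε / (3 * C)) with hδ'
  have hδ'0 : 0 < δ' := by positivity
  refine ⟨Icc T₁ T₂ ∩ Metric.closedBall r δ', inter_mem_nhdsWithin _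
    (Metric.closedBall_mem_nhds r hδ'0), ?_⟩
  filter_upwards [htime, hΓ.eventually_abs_heatKernel_sub_le hd hA hS hinv ha hmass hr0
    (ε := ε / 3) (by positivity) (M := M + 1) (by positivity), eventually_gt_atTop 0,
    eventually_le_mul_natCast 1 (lt_min hδ one_pos)] with N h1 h2 hN0 hN t ht x hx
  have hN0' : (0 : ℝ) < N := by exact_mod_cast hN0
  set y : Fin d → ℤ := fun i => ⌊(N : ℝ) * x i⌋ with hy
  have hNinv : (N : ℝ)⁻¹ ≤ min δ 1 := by
    rwa [inv_eq_one_div, div_le_iff₀ hN0']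
  have hxy : dist x (latticeEmb N y) ≤ min δ 1 := (dist_latticeEmb_floor_le hN0 x).trans hNinv
  have hyM : ‖latticeEmb N y‖ ≤ M + 1 := by
    have := norm_le_norm_add_norm_sub x (latticeEmb N y)
    rw [← dist_eq_norm] at this
    linarith [min_le_right δ 1]
  have htr : |t - r| ≤ δ' := ht.2
  have htδ : |t - r| ≤ δ := htr.trans ((min_le_left _ _).trans (min_le_left _ _))
  have htr2 : |t - r| ≤ r / 2 := htr.trans ((min_le_left _ _).trans (min_le_right _ _))
  have htC : |t - r| ≤ ε / (3 * C) := htr.trans (min_le_right _ _)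
  have h3 := h1 y (hΓ.mem_ball_of_norm_latticeEmb_le hN0 (lt_add_one _) hyM) t ht.1.1 r hr.1
  have h4 := h2 y hyM
  rw [abs_le] at htr2
  have h5 := hk t ⟨by linarith, by linarith⟩ r ⟨by linarith, by linarith⟩ htδ x
    (mem_closedBall_zero_iff.2 (by linarith)) _ (mem_closedBall_zero_iff.2 hyM)
    (hxy.trans (min_le_left _ _))
  have h6 : C * |t - r| ≤ ε / 3 := by
    calc C * |t - r| ≤ C * (ε / (3 * C)) := mul_le_mul_of_nonneg_left htC hC.le
      _ = ε / 3 := by field_simp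
  have h7 : |a * gaussianKernel S t x - a * gaussianKernel S r (latticeEmb N y)| ≤ ε / 3 := by
    rw [← mul_sub, abs_mul, abs_of_pos ha]
    calc _ ≤ a * (ε / (3 * a)) := mul_le_mul_of_nonneg_left h5 ha.le
      _ = ε / 3 := by field_simp
  have h8 := h3.trans h6
  rw [abs_le] at h4 h7 h8 ⊢
  constructor <;> linarith

end IsLattice

end

theorem proposition1p7 {d : ℕ} (hd : 2 ≤ d) (Γ : WeightedGraph (Fin d → ℤ)) (hΓ : IsLattice Γ)
    (s : Speed) (hA : Γ.StandingAssumption s 0 d)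
    (hvol : ∃ c > (0 : ℝ), Tendsto
      (fun R : ℝ => (R ^ d)⁻¹ * WeightedGraph.mass Γ.π (Γ.ball 0 R)) atTop (𝓝 c))
    (S : Matrix (Fin d) (Fin d) ℝ) (hS : S.PosDef) (hinv : InvariancePrinciple Γ s S) :
    ∃ a > (0 : ℝ), ∀ T₁ > (0 : ℝ), ∀ T₂ > (0 : ℝ), ∀ M > (0 : ℝ),
      Tendsto (fun n : ℕ =>
          ⨆ (x : Fin d → ℝ) (_ : ‖WithLp.toLp 2 x‖ ≤ M) (t : ℝ) (_ : t ∈ Icc T₁ T₂),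
            ENNReal.ofReal |(n : ℝ) ^ d *
                Γ.heatKernel s ((n : ℝ) ^ 2 * t) 0 (fun i => ⌊(n : ℝ) * x i⌋) -
              a * gaussianKernel S t x|)
        atTop (𝓝 0) := by
  have hd0 : 0 < d := by omega
  obtain ⟨a, ha, hmass⟩ := hΓ.exists_tendsto_scaledMass hd0 hA hvol hS hinv
  refine ⟨a, ha, fun T₁ hT₁ T₂ _ M hM => ?_⟩
  rw [ENNReal.tendsto_atTop_zero]
  intro ε hε
  obtain ⟨ε', hε', hεε⟩ := ENNReal.lt_iff_exists_real_btwn.1 hε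
  obtain ⟨h0, h1⟩ := hεε
  have hε0 : 0 < ε' := ENNReal.ofReal_pos.1 h0
  obtain ⟨n₀, hn₀⟩ := eventually_atTop.1
    (hΓ.eventually_forall_Icc_abs_heatKernel_sub_le hd0 hA hS hinv ha hmass hT₁ T₂ hε0 hM)
  refine ⟨n₀, fun n hn => iSup₂_le fun x hx => iSup₂_le fun t ht => ?_⟩
  -- The supremum is over a Euclidean ball, which lies in the sup-norm ball of the same radius.
  exact (ENNReal.ofReal_le_ofReal (hn₀ n hn t ht x ((norm_le_norm_toLp x).trans hx))).trans h1.le
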